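/- All manifolds are smooth, Hausdorff, second countable and without boundary. A Dirac structure on a manifold $M$ is a smooth subbundle $L\subset TM\oplus T^*M$ of rank $\dim M$ which is isotropic for the pairing $\langle (X,\xi),(Y,\eta)\rangle=\xi(Y)+\eta(X)$ and whose sections are closed under the Courant bracket. A Poisson manifold $(P,\Pi)$ has a sharp map $\sharp\xi=\Pi(\xi,\cdot)$ and an associated Dirac structure $L_\Pi=\{(\sharp\xi,\xi)\}$. For a smooth map $f$ and a Dirac structure $D$ on its target put $f^*D=\{(v,\eta\circ df):(df\,v,\eta)\in D\}$ pointwise; for a 2-form $B$ put $\tau_BD=\{(X,\xi+i_XB):(X,\xi)\in D\}$. A coisotropic embedding of $(M,L)$ into $(P,\Pi)$ is a smooth embedding $i:M\to P$ with $i^*L_\Pi=L$ and $\sharp\,(T_{i(x)}i(M))^\circ\subset T_{i(x)}i(M)$ for all $x\in M$. Let $(M,L)$ be a Dirac manifold such that $E:=L\cap TM$ has constant rank $k$, and let $\pi:E^*\to M$ be the vector bundle dual to $E$. A smooth distribution $V$ with $TM=E\oplus V$ determines an embedding $j_V:E^*\to T^*M$ (extend functionals on $E$ by zero on $V$) and the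 Dirac structure $L_{E^*}:=\tau_{j_V^*\omega}\,\pi^*L$ on $E^*$, where $\omega=dp\wedge dq$ is the canonical symplectic form of $T^*M$. The set of points of $E^*$ at which $L_{E^*}\cap TE^*=0$, on which $L_{E^*}$ is the graph of a Poisson bivector, is the canonical Poisson manifold of $(M,L)$ for $V$; $M$ sits in it as the zero section. \textbf{Proposition (local uniqueness).} Let $(P,\Pi)$ be a Poisson manifold of dimension $\dim M+k$ and $i:M\to P$ a coisotropic embedding of $(M,L)$ into $(P,\Pi)$. Then for every smooth distribution $V$ with $TM=E\oplus V$ and every $x\in M$ there are an open neighborhood $U$ of $i(x)$ in $P$, an open subset $W$ of the canonical Poisson manifold of $(M,L)$ for $V$, and a Poisson diffeomorphism $\Phi:U\to W$. Moreover $\Phi$ can be chosen so that $\Phi(i(x))=0_x$ and $\Phi(U\cap i(M))$ is the set of zero vectors in $W$. -/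

import Mathlib

open Bundle Manifold Topology
open scoped ContDiff

noncomputable section

/-! ## Linear Dirac structures

For a real vector space `W`, subspaces of `W × W*` are modelled by
`Submodule ℝ (W × (W →L[ℝ] ℝ))`. -/

section Linear

variable {V W : Type*} [AddCommGroup V] [Module ℝ V] [TopologicalSpace V]
  [AddCommGroup W] [Module ℝ W] [TopologicalSpace W]

/-- Pullback of `D ⊆ W × W*` under a linear map `A : V → W`:
`{(v, η ∘ A) : (A v, η) ∈ D}`. -/
def diracPullback (A : V →L[ℝ] W) (D : Submodule ℝ (W × (W →L[ℝ] ℝ))) :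
    Submodule ℝ (V × (V →L[ℝ] ℝ)) where
  carrier := {a | ∃ η : W →L[ℝ] ℝ, (A a.1, η) ∈ D ∧ a.2 = η.comp A}
  zero_mem' := ⟨0, by simp [← Prod.zero_eq_mk], by simp⟩
  add_mem' := by
    rintro ⟨v, _⟩ ⟨w, _⟩ ⟨η, hη, rfl⟩ ⟨θ, hθ, rfl⟩
    exact ⟨η + θ, by simpa using D.add_mem hη hθ, by ext; simp⟩
  smul_mem' := by
    rintro c ⟨v, _⟩ ⟨η, hη, rfl⟩
    exact ⟨c • η, by simpa using D.smul_mem c hη, by ext; simp⟩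

/-- Gauge transformation of `D ⊆ V × V*` by a bilinear form `B`, given by its contraction
`B X = i_X B`: `{(X, ξ + i_X B) : (X, ξ) ∈ D}`. -/
def diracGauge (B : V →ₗ[ℝ] (V →L[ℝ] ℝ)) (D : Submodule ℝ (V × (V →L[ℝ] ℝ))) :
    Submodule ℝ (V × (V →L[ℝ] ℝ)) where
  carrier := {a | ∃ ξ : V →L[ℝ] ℝ, (a.1, ξ) ∈ D ∧ a.2 = ξ + B a.1}
  zero_mem' := ⟨0, by simp [← Prod.zero_eq_mk], by simp⟩
  add_mem' := by
    rintro a b ⟨η, hη, ha⟩ ⟨θ, hθ, hb⟩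
    exact ⟨η + θ, by simpa using D.add_mem hη hθ, by
      rw [Prod.snd_add, ha, hb, Prod.fst_add, map_add]; abel⟩
  smul_mem' := by
    rintro c a ⟨η, hη, ha⟩
    exact ⟨c • η, by simpa using D.smul_mem c hη, by
      rw [Prod.smul_snd, ha, Prod.smul_fst, map_smul, smul_add]⟩

end Linear

/-! ## Vector fields, one-forms and the Courant bracket

`N` is a manifold (without boundary) modelled on `E` through `I`. -/

section Calculus

variable {E H : Type*} [NormedAddCommGroup E] [NormedSpace ℝ E] [TopologicalSpace H]
  (I : ModelWithCorners ℝ E H) {N : Type*} [TopologicalSpace N] [ChartedSpace H N]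

/-- The vector field `X` is smooth on `U`. -/
def SmoothVectorFieldOn [IsManifold I ∞ N] (X : ∀ x : N, TangentSpace I x) (U : Set N) : Prop :=
  ContMDiffOn I I.tangent ∞ (fun x => (⟨x, X x⟩ : TangentBundle I N)) U

/-- The cotangent bundle `T*N`. -/
abbrev CotangentBundle (N : Type*) [TopologicalSpace N] [ChartedSpace H N] [IsManifold I ∞ N] :=
  TotalSpace (E →L[ℝ] ℝ) (fun x : N => TangentSpace I x →L[ℝ] ℝ)

/-- The one-form `ξ` is smooth on `U`. -/
def SmoothOneFormOn [IsManifold I ∞ N] (ξ : ∀ x : N, TangentSpace I x →L[ℝ] ℝ) (U : Set N) :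
    Prop :=
  ContMDiffOn I (I.prod 𝓘(ℝ, E →L[ℝ] ℝ)) ∞ (fun x => (⟨x, ξ x⟩ : CotangentBundle I N)) U

/-- The differential of a function, as a one-form. -/
def dFun (f : N → ℝ) (x : N) : TangentSpace I x →L[ℝ] ℝ :=
  mfderiv I 𝓘(ℝ, ℝ) f x

/-- A one-form `α` read in the chart at `x`, a one-form on the model space. -/
def oneFormInChart (α : ∀ x : N, TangentSpace I x →L[ℝ] ℝ) (x : N) : E → E →L[ℝ] ℝ :=
  fun y => (α ((extChartAt I x).symm y)).comp (mfderiv 𝓘(ℝ, E) I (extChartAt I x).symm y)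

/-- The exterior derivative of a one-form, `u ↦ i_u dα`, computed in the chart at `x`:
`dα(u, v) = (Dα̂ · û) v̂ - (Dα̂ · v̂) û`, where hats denote representatives in the chart. -/
def extDerivOneForm (α : ∀ x : N, TangentSpace I x →L[ℝ] ℝ) (x : N) :
    TangentSpace I x →ₗ[ℝ] (TangentSpace I x →L[ℝ] ℝ) :=
  let D : E →L[ℝ] E →L[ℝ] ℝ := fderiv ℝ (oneFormInChart I α x) (extChartAt I x x)
  let c : TangentSpace I x →L[ℝ] E := mfderiv I 𝓘(ℝ, E) (extChartAt I x) x
  { toFun := fun u => ((D - D.flip) (c u)).comp c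
    map_add' := fun u v => by simp only [map_add]; rfl
    map_smul' := fun r u => by simp only [map_smul]; rfl }

/-- Lie derivative of a one-form, by Cartan's formula. -/
def lieDerivOneForm (X : ∀ x : N, TangentSpace I x) (η : ∀ x : N, TangentSpace I x →L[ℝ] ℝ)
    (x : N) : TangentSpace I x →L[ℝ] ℝ :=
  extDerivOneForm I η x (X x) + dFun I (fun y => η y (X y)) x

/-- The Courant bracket
`[(X, ξ), (Y, η)] = ([X, Y], L_X η - L_Y ξ + ½ d(ξ(Y) - η(X)))`. -/
def courantBracket (X : ∀ x : N, TangentSpace I x) (ξ : ∀ x : N, TangentSpace I x →L[ℝ] ℝ)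
    (Y : ∀ x : N, TangentSpace I x) (η : ∀ x : N, TangentSpace I x →L[ℝ] ℝ) (x : N) :
    TangentSpace I x × (TangentSpace I x →L[ℝ] ℝ) :=
  (VectorField.mlieBracket I X Y x,
    lieDerivOneForm I X η x - lieDerivOneForm I Y ξ x +
      (1 / 2 : ℝ) • dFun I (fun y => ξ y (Y y) - η y (X y)) x)

end Calculus

/-! ## Dirac and Poisson manifolds -/

section Structures

variable {E H : Type*} [NormedAddCommGroup E] [NormedSpace ℝ E] [TopologicalSpace H]
  (I : ModelWithCorners ℝ E H) (N : Type*) [TopologicalSpace N] [ChartedSpace H N]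
  [IsManifold I ∞ N]

/-- A Dirac structure on `N`: a smooth subbundle `L` of `TN ⊕ T*N` which is maximal isotropic
(isotropic, of rank `dim N`) for the symmetric pairing and whose sections are closed under the
Courant bracket. -/
structure DiracStructure where
  /-- the fibre of `L` -/
  fiber : ∀ x : N, Submodule ℝ (TangentSpace I x × (TangentSpace I x →L[ℝ] ℝ))
  isotropic : ∀ x, ∀ a ∈ fiber x, ∀ b ∈ fiber x, a.2 b.1 + b.2 a.1 = 0
  finrank_fiber : ∀ x, Module.finrank ℝ (fiber x) = Module.finrank ℝ E
  exists_frame : ∀ x₀ : N, ∃ U : Set N, IsOpen U ∧ x₀ ∈ U ∧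
    ∃ (X : Fin (Module.finrank ℝ E) → ∀ x : N, TangentSpace I x)
      (ξ : Fin (Module.finrank ℝ E) → ∀ x : N, TangentSpace I x →L[ℝ] ℝ),
      (∀ a, SmoothVectorFieldOn I (X a) U) ∧ (∀ a, SmoothOneFormOn I (ξ a) U) ∧
      ∀ x ∈ U, Submodule.span ℝ (Set.range fun a => (X a x, ξ a x)) = fiber x
  courant_mem : ∀ U : Set N, IsOpen U →
    ∀ (X Y : ∀ x : N, TangentSpace I x) (ξ η : ∀ x : N, TangentSpace I x →L[ℝ] ℝ),
      SmoothVectorFieldOn I X U → SmoothOneFormOn I ξ U →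
      SmoothVectorFieldOn I Y U → SmoothOneFormOn I η U →
      (∀ x ∈ U, (X x, ξ x) ∈ fiber x) → (∀ x ∈ U, (Y x, η x) ∈ fiber x) →
      ∀ x ∈ U, courantBracket I X ξ Y η x ∈ fiber x

/-- A Poisson structure on `N`: a smooth bivector field `Π` with `[Π, Π] = 0`. The bivector is
given by its sharp map `♯ ξ = Π(ξ, ·)`, and `[Π, Π] = 0` is the Jacobi identity of the bracket
`{f, g} = Π(df, dg)` of (locally defined) smooth functions. -/
structure PoissonStructure where
  /-- the map `♯ : T*N → TN` -/
  sharp : ∀ x : N, (TangentSpace I x →L[ℝ] ℝ) →L[ℝ] TangentSpace I x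
  skew : ∀ (x : N) (ξ η : TangentSpace I x →L[ℝ] ℝ), η (sharp x ξ) = - ξ (sharp x η)
  smooth : ContMDiff I (I.prod 𝓘(ℝ, (E →L[ℝ] ℝ) →L[ℝ] E)) ∞
    (fun x => (⟨x, sharp x⟩ : TotalSpace ((E →L[ℝ] ℝ) →L[ℝ] E)
      (fun x : N => (TangentSpace I x →L[ℝ] ℝ) →L[ℝ] TangentSpace I x)))
  jacobi : ∀ U : Set N, IsOpen U → ∀ f g h : N → ℝ,
    ContMDiffOn I 𝓘(ℝ, ℝ) ∞ f U → ContMDiffOn I 𝓘(ℝ, ℝ) ∞ g U → ContMDiffOn I 𝓘(ℝ, ℝ) ∞ h U →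
    let bracket : (N → ℝ) → (N → ℝ) → N → ℝ := fun a b x => dFun I b x (sharp x (dFun I a x))
    ∀ x ∈ U, bracket f (bracket g h) x + bracket g (bracket h f) x + bracket h (bracket f g) x = 0

variable {I N}

/-- The Dirac structure `L_Π = {(♯ ξ, ξ)}` of a Poisson structure. -/
def PoissonStructure.graph (Pi : PoissonStructure I N) (x : N) :
    Submodule ℝ (TangentSpace I x × (TangentSpace I x →L[ℝ] ℝ)) :=
  LinearMap.range ((Pi.sharp x).toLinearMap.prod LinearMap.id)

/-- The characteristic subspace `E_x = L_x ∩ T_x N`. -/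
def DiracStructure.char (L : DiracStructure I N) (x : N) : Submodule ℝ (TangentSpace I x) :=
  (L.fiber x).comap (LinearMap.inl ℝ _ _)

/-- `L ∩ TN` has constant rank `k`. -/
def DiracStructure.HasCharRank (L : DiracStructure I N) (k : ℕ) : Prop :=
  ∀ x, Module.finrank ℝ (L.char x) = k

/-- A smooth distribution `V` with `TN = (L ∩ TN) ⊕ V`. -/
structure DiracStructure.Splitting (L : DiracStructure I N) where
  /-- the fibre of `V` -/
  fiber : ∀ x : N, Submodule ℝ (TangentSpace I x)
  isCompl : ∀ x, IsCompl (L.char x) (fiber x)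
  smooth : ∀ x₀ : N, ∃ U : Set N, IsOpen U ∧ x₀ ∈ U ∧
    ∃ (r : ℕ) (X : Fin r → ∀ x : N, TangentSpace I x),
      (∀ a, SmoothVectorFieldOn I (X a) U) ∧
      ∀ x ∈ U, Submodule.span ℝ (Set.range fun a => X a x) = fiber x

/-- `i : N → P` is a coisotropic embedding of the Dirac manifold `(N, L)` into the Poisson
manifold `(P, Π)`: a smooth embedding with `i^* L_Π = L` and `♯ (T i(N))° ⊆ T i(N)`. -/
structure IsCoisotropicEmbedding {E' H' : Type*} [NormedAddCommGroup E'] [NormedSpace ℝ E']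
    [TopologicalSpace H'] {I' : ModelWithCorners ℝ E' H'} {P : Type*} [TopologicalSpace P]
    [ChartedSpace H' P] [IsManifold I' ∞ P] (L : DiracStructure I N) (Pi : PoissonStructure I' P)
    (i : N → P) : Prop where
  isSmoothEmbedding : IsSmoothEmbedding I I' ∞ i
  pullback_eq : ∀ x, diracPullback (mfderiv I I' i x) (Pi.graph (i x)) = L.fiber x
  coisotropic : ∀ x, ∀ ξ : TangentSpace I' (i x) →L[ℝ] ℝ,
    (∀ v : TangentSpace I x, ξ (mfderiv I I' i x v) = 0) →
    ∃ v : TangentSpace I x, mfderiv I I' i x v = Pi.sharp (i x) ξ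

end Structures

/-! ## Smooth frames of the characteristic distribution -/

section Frames

variable {E H : Type*} [NormedAddCommGroup E] [NormedSpace ℝ E] [TopologicalSpace H]
  {I : ModelWithCorners ℝ E H} {N : Type*} [TopologicalSpace N] [ChartedSpace H N]

theorem contMDiffAt_inverse_comp {V : Type*} [NormedAddCommGroup V] [NormedSpace ℝ V]
    [CompleteSpace V] {G : N → V →L[ℝ] V} {x₀ : N}
    (hG : ContMDiffAt I 𝓘(ℝ, V →L[ℝ] V) ∞ G x₀) (hinv : (G x₀).IsInvertible) :
    ContMDiffAt I 𝓘(ℝ, V →L[ℝ] V) ∞ (fun x => (G x).inverse) x₀ := by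
  obtain ⟨e, he⟩ := hinv
  have h : ContDiffAt ℝ ∞ (ContinuousLinearMap.inverse : (V →L[ℝ] V) → (V →L[ℝ] V)) (G x₀) := by
    rw [← he]; exact contDiffAt_map_inverse e
  exact h.contMDiffAt.comp x₀ hG

theorem eventually_isInvertible {V : Type*} [NormedAddCommGroup V] [NormedSpace ℝ V]
    [CompleteSpace V] {G : N → V →L[ℝ] V} {x₀ : N}
    (hG : ContinuousAt G x₀) (hinv : (G x₀).IsInvertible) :
    ∀ᶠ x in 𝓝 x₀, (G x).IsInvertible := by
  obtain ⟨e, he⟩ := hinv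
  have h := ContinuousLinearEquiv.nhds e
  rw [he] at h
  exact hG h

/-- The linear combination map of a finite family of vectors, as a continuous linear map. -/
def combMap {V : Type*} [NormedAddCommGroup V] [NormedSpace ℝ V] {k : ℕ} (σ : Fin k → V) :
    (Fin k → ℝ) →L[ℝ] V :=
  ∑ j, (ContinuousLinearMap.proj j : (Fin k → ℝ) →L[ℝ] ℝ).smulRight (σ j)

theorem combMap_apply {V : Type*} [NormedAddCommGroup V] [NormedSpace ℝ V] {k : ℕ}
    (σ : Fin k → V) (c : Fin k → ℝ) : combMap σ c = ∑ j, c j • σ j := by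
  simp [combMap]

theorem contMDiffAt_combMap {V : Type*} [NormedAddCommGroup V] [NormedSpace ℝ V] {k : ℕ}
    {σ : Fin k → N → V} {x₀ : N} (h : ∀ j, ContMDiffAt I 𝓘(ℝ, V) ∞ (σ j) x₀) :
    ContMDiffAt I 𝓘(ℝ, (Fin k → ℝ) →L[ℝ] V) ∞ (fun x => combMap fun j => σ j x) x₀ := by
  unfold combMap
  refine ContMDiffAt.sum fun j _ => ?_
  exact (ContinuousLinearMap.smulRightL ℝ (Fin k → ℝ) V
    (ContinuousLinearMap.proj j)).contMDiff.contMDiffAt.comp x₀ (h j)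

/-- The kernel of a smooth family of linear maps of constant corank has smooth local frames. -/
theorem exists_kernel_frame {V W : Type*} [NormedAddCommGroup V] [NormedSpace ℝ V]
    [FiniteDimensional ℝ V] [NormedAddCommGroup W] [NormedSpace ℝ W] [FiniteDimensional ℝ W]
    {k : ℕ} {A : N → V →L[ℝ] W} {U : Set N} (hU : IsOpen U)
    (hA : ContMDiffOn I 𝓘(ℝ, V →L[ℝ] W) ∞ A U)
    (hk : ∀ x ∈ U, Module.finrank ℝ (LinearMap.ker (A x).toLinearMap) = k) {x₀ : N}
    (hx₀ : x₀ ∈ U) :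
    ∃ U' ⊆ U, IsOpen U' ∧ x₀ ∈ U' ∧ ∃ c : Fin k → N → V,
      (∀ i, ContMDiffOn I 𝓘(ℝ, V) ∞ (c i) U') ∧
      ∀ x ∈ U', (∀ i, A x (c i x) = 0) ∧ LinearIndependent ℝ (fun i => c i x) := by
  have : CompleteSpace V := FiniteDimensional.complete ℝ V
  set K := LinearMap.ker (A x₀).toLinearMap with hK
  obtain ⟨C, hC⟩ := Submodule.exists_isCompl K
  have hinj : LinearMap.ker ((A x₀).toLinearMap.domRestrict C) = ⊥ := by
    rw [LinearMap.ker_domRestrict]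
    exact Submodule.disjoint_iff_comap_eq_bot.mp hC.disjoint.symm
  obtain ⟨R₀, hR₀⟩ := LinearMap.exists_leftInverse_of_injective _ hinj
  let R : W →L[ℝ] V := LinearMap.toContinuousLinearMap (C.subtype ∘ₗ R₀)
  let P : V →L[ℝ] V := LinearMap.toContinuousLinearMap (K.projection C hC)
  let G : N → V →L[ℝ] V := fun x => R.comp (A x) + P
  have hG : ∀ x ∈ U, ContMDiffAt I 𝓘(ℝ, V →L[ℝ] V) ∞ G x := fun x hx =>
    (((ContinuousLinearMap.compL ℝ V W V R).contMDiff.contMDiffAt.comp x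
      (hA.contMDiffAt (hU.mem_nhds hx))).add contMDiffAt_const)
  have hR : ∀ v ∈ C, R (A x₀ v) = v := fun v hv => by
    have := LinearMap.congr_fun hR₀ ⟨v, hv⟩
    exact congrArg Subtype.val this
  have hG₀ : G x₀ = ContinuousLinearMap.id ℝ V := by
    ext v
    obtain ⟨a, ha, b, hb, rfl⟩ : ∃ a ∈ K, ∃ b ∈ C, a + b = v := by
      have : v ∈ K ⊔ C := by rw [hC.sup_eq_top]; trivial
      exact Submodule.mem_sup.mp this
    have h1 : A x₀ a = 0 := ha
    have h2 : P a = a := K.projection_apply_left hC ⟨a, ha⟩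
    have h3 : P b = 0 := K.projection_apply_right hC ⟨b, hb⟩
    simp [G, h1, h2, h3, hR b hb, add_comm]
  have hinv : (G x₀).IsInvertible := by
    rw [hG₀]; exact ⟨ContinuousLinearEquiv.refl ℝ V, rfl⟩
  obtain ⟨U₁, hU₁, hU₁o, hxU₁⟩ := eventually_nhds_iff.mp
    (eventually_isInvertible (hG x₀ hx₀).continuousAt hinv)
  have hKk : Module.finrank ℝ K = k := hk x₀ hx₀
  let b := Module.finBasisOfFinrankEq ℝ K hKk
  refine ⟨U ∩ U₁, Set.inter_subset_left, hU.inter hU₁o, ⟨hx₀, hxU₁⟩,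
    fun i x => (G x).inverse (b i : V), fun i x hx => ?_, fun x hx => ?_⟩
  · exact ((contMDiffAt_inverse_comp (hG x hx.1) (hU₁ x hx.2)).clm_apply
      contMDiffAt_const).contMDiffWithinAt
  · obtain ⟨e, he⟩ := hU₁ x hx.2
    have hinv_eq : ∀ v, (G x).inverse v = e.symm v := fun v => by
      rw [← he, ContinuousLinearMap.inverse_equiv]; rfl
    have hcoe : ∀ v, e v = G x v := fun v => by rw [← he]; rfl
    constructor
    · intro i
      have hle : (LinearMap.ker (A x).toLinearMap).map e.toLinearEquiv.toLinearMap ≤ K := by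
        rintro _ ⟨v, hv, rfl⟩
        have hv' : A x v = 0 := hv
        have : e v = P v := by rw [hcoe]; simp [G, hv']
        change e v ∈ K
        rw [this]
        exact K.projection_apply_mem hC v
      have heq : (LinearMap.ker (A x).toLinearMap).map e.toLinearEquiv.toLinearMap = K := by
        refine Submodule.eq_of_le_of_finrank_eq hle ?_
        rw [hKk, ← hk x hx.1]
        exact LinearEquiv.finrank_map_eq e.toLinearEquiv _
      have hb : (b i : V) ∈ (LinearMap.ker (A x).toLinearMap).map e.toLinearEquiv.toLinearMap := by
        rw [heq]; exact (b i).2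
      obtain ⟨v, hv, hvb⟩ := hb
      have hvb' : e v = (b i : V) := hvb
      change A x ((G x).inverse (b i : V)) = 0
      rw [hinv_eq, ← hvb', e.symm_apply_apply]
      exact hv
    · have h1 : LinearIndependent ℝ (fun i => (b i : V)) :=
        b.linearIndependent.map' K.subtype (Submodule.ker_subtype K)
      have h2 := h1.map' e.symm.toLinearEquiv.toLinearMap (LinearEquiv.ker _)
      simp only [hinv_eq]
      exact h2

/-- Coefficients with respect to a smooth independent family of vectors are smooth. -/
theorem contMDiffAt_coeff {V : Type*} [NormedAddCommGroup V] [NormedSpace ℝ V]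
    [FiniteDimensional ℝ V] {k : ℕ} {σ : Fin k → N → V} {y : N → V} {c : N → Fin k → ℝ} {x₀ : N}
    (hσ : ∀ j, ContMDiffAt I 𝓘(ℝ, V) ∞ (σ j) x₀) (hy : ContMDiffAt I 𝓘(ℝ, V) ∞ y x₀)
    (hind : LinearIndependent ℝ (fun j => σ j x₀))
    (hc : ∀ᶠ x in 𝓝 x₀, y x = ∑ j, c x j • σ j x) :
    ContMDiffAt I 𝓘(ℝ, Fin k → ℝ) ∞ c x₀ := by
  have hinj : LinearMap.ker (combMap fun j => σ j x₀).toLinearMap = ⊥ := by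
    rw [LinearMap.ker_eq_bot']
    intro a ha
    have ha' : ∑ j, a j • σ j x₀ = 0 := by rw [← combMap_apply]; exact ha
    funext j
    exact Fintype.linearIndependent_iff.mp hind a ha' j
  obtain ⟨T₀, hT₀⟩ := LinearMap.exists_leftInverse_of_injective _ hinj
  let T : V →L[ℝ] (Fin k → ℝ) := LinearMap.toContinuousLinearMap T₀
  let G : N → (Fin k → ℝ) →L[ℝ] (Fin k → ℝ) := fun x => T.comp (combMap fun j => σ j x)
  have hG : ContMDiffAt I 𝓘(ℝ, (Fin k → ℝ) →L[ℝ] (Fin k → ℝ)) ∞ G x₀ :=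
    (ContinuousLinearMap.compL ℝ (Fin k → ℝ) V (Fin k → ℝ) T).contMDiff.contMDiffAt.comp x₀
      (contMDiffAt_combMap hσ)
  have hG₀ : G x₀ = ContinuousLinearMap.id ℝ _ := by
    apply ContinuousLinearMap.coe_injective
    exact hT₀
  have hinv : (G x₀).IsInvertible := by
    rw [hG₀]; exact ⟨ContinuousLinearEquiv.refl ℝ _, rfl⟩
  have hmain : ContMDiffAt I 𝓘(ℝ, Fin k → ℝ) ∞ (fun x => (G x).inverse (T (y x))) x₀ :=
    (contMDiffAt_inverse_comp hG hinv).clm_apply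
      (T.contMDiff.contMDiffAt.comp x₀ hy)
  refine hmain.congr_of_eventuallyEq ?_
  filter_upwards [hc, eventually_isInvertible hG.continuousAt hinv] with x hx hxinv
  have h1 : T (y x) = G x (c x) := by
    rw [hx, ← combMap_apply]; rfl
  obtain ⟨e, he⟩ := hxinv
  rw [h1, ← he, ContinuousLinearMap.inverse_equiv]
  simp

variable [IsManifold I ∞ N]

/-- A smooth vector field read in a trivialization of the tangent bundle is smooth. -/
theorem SmoothVectorFieldOn.contMDiffAt_triv {X : ∀ x : N, TangentSpace I x} {U : Set N}
    (hX : SmoothVectorFieldOn I X U) {x₀ : N} (hU : U ∈ 𝓝 x₀) :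
    ContMDiffAt I 𝓘(ℝ, E) ∞
      (fun x => (trivializationAt E (TangentSpace I) x₀ ⟨x, X x⟩).2) x₀ :=
  ((trivializationAt E (TangentSpace I) x₀).contMDiffAt_section_iff
    (mem_baseSet_trivializationAt E (TangentSpace I) x₀)).mp (hX.contMDiffAt hU)

variable [FiniteDimensional ℝ E]

/-- A smooth local frame of the characteristic distribution `E = L ∩ TN` of rank `k`
(outside of `base` its values are irrelevant). -/
structure CharFrame (L : DiracStructure I N) (k : ℕ) where
  /-- the domain of the frame -/
  base : Set N
  isOpen_base : IsOpen base
  /-- the sections -/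
  vec : Fin k → ∀ x : N, L.char x
  smooth : ∀ i, SmoothVectorFieldOn I (fun x => (vec i x : TangentSpace I x)) base
  indep : ∀ x ∈ base, LinearIndependent ℝ (fun i => vec i x)

theorem finiteDimensional_char (L : DiracStructure I N) (x : N) :
    FiniteDimensional ℝ (L.char x) := by
  have : FiniteDimensional ℝ (TangentSpace I x) := inferInstanceAs (FiniteDimensional ℝ E)
  infer_instance

theorem exists_charFrame (L : DiracStructure I N) {k : ℕ} (hL : L.HasCharRank k) (x₀ : N) :
    ∃ f : CharFrame L k, x₀ ∈ f.base := by
  classical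
  obtain ⟨U, hU, hx₀, X, ξ, hX, hξ, hspan⟩ := L.exists_frame x₀
  let τ := trivializationAt (E →L[ℝ] ℝ) (fun x : N => TangentSpace I x →L[ℝ] ℝ) x₀
  have hx₀τ : x₀ ∈ τ.baseSet :=
    mem_baseSet_trivializationAt (E →L[ℝ] ℝ) (fun x : N => TangentSpace I x →L[ℝ] ℝ) x₀
  let A : N → (Fin (Module.finrank ℝ E) → ℝ) →L[ℝ] (E →L[ℝ] ℝ) := fun x => combMap fun a => (τ ⟨x, ξ a x⟩).2
  have hWo : IsOpen (U ∩ τ.baseSet) := hU.inter τ.open_baseSet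
  have hA : ContMDiffOn I 𝓘(ℝ, (Fin (Module.finrank ℝ E) → ℝ) →L[ℝ] (E →L[ℝ] ℝ)) ∞ A (U ∩ τ.baseSet) := by
    intro x hx
    refine (contMDiffAt_combMap fun a => ?_).contMDiffWithinAt
    exact (τ.contMDiffAt_section_iff hx.2).mp ((hξ a).contMDiffAt (hU.mem_nhds hx.1))
  -- the linear combination map of the frame of `L`
  let Λ : ∀ x : N, (Fin (Module.finrank ℝ E) → ℝ) →ₗ[ℝ] TangentSpace I x × (TangentSpace I x →L[ℝ] ℝ) :=
    fun x => Fintype.linearCombination ℝ (fun a => (X a x, ξ a x))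
  have hΛ₁ : ∀ x c, (Λ x c).1 = ∑ a, c a • X a x := fun x c => by
    simp [Λ, Fintype.linearCombination_apply, Prod.fst_sum]
  have hΛ₂ : ∀ x c, (Λ x c).2 = ∑ a, c a • ξ a x := fun x c => by
    simp [Λ, Fintype.linearCombination_apply, Prod.snd_sum]
  have hrange : ∀ x ∈ U, LinearMap.range (Λ x) = L.fiber x := fun x hx => by
    rw [← hspan x hx, Fintype.range_linearCombination]
  have hinj : ∀ x ∈ U, Function.Injective (Λ x) := fun x hx => by
    have hli : LinearIndependent ℝ (fun a => (X a x, ξ a x)) := by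
      rw [linearIndependent_iff_card_eq_finrank_span, Set.finrank, hspan x hx,
        L.finrank_fiber x, Fintype.card_fin]
    rw [← LinearMap.ker_eq_bot, LinearMap.ker_eq_bot']
    intro c hc
    rw [Fintype.linearCombination_apply] at hc
    exact funext (Fintype.linearIndependent_iff.mp hli c hc)
  have hker : ∀ x ∈ τ.baseSet, ∀ c, A x c = 0 ↔ (Λ x c).2 = 0 := fun x hx c => by
    have h1 : A x c = τ.continuousLinearEquivAt ℝ x hx (Λ x c).2 := by
      rw [hΛ₂, map_sum]
      simp only [A, combMap_apply, map_smul]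
      rfl
    rw [h1]
    exact (τ.continuousLinearEquivAt ℝ x hx).map_eq_zero_iff
  have hmem : ∀ x ∈ U ∩ τ.baseSet, ∀ c, A x c = 0 → (Λ x c).1 ∈ L.char x := by
    intro x hx c hc
    have h2 := (hker x hx.2 c).mp hc
    have h3 : Λ x c ∈ L.fiber x := by rw [← hrange x hx.1]; exact LinearMap.mem_range_self _ c
    change ((Λ x c).1, (0 : TangentSpace I x →L[ℝ] ℝ)) ∈ L.fiber x
    rw [← h2]
    exact h3
  have hinj' : ∀ x ∈ U ∩ τ.baseSet, ∀ c, A x c = 0 → (Λ x c).1 = 0 → c = 0 := by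
    intro x hx c hc h1
    apply hinj x hx.1
    rw [map_zero]
    exact Prod.ext h1 ((hker x hx.2 c).mp hc)
  have hk : ∀ x ∈ U ∩ τ.baseSet, Module.finrank ℝ (LinearMap.ker (A x).toLinearMap) = k := by
    intro x hx
    let ψ : LinearMap.ker (A x).toLinearMap →ₗ[ℝ] L.char x :=
      ((LinearMap.fst ℝ _ _ ∘ₗ Λ x) ∘ₗ (LinearMap.ker (A x).toLinearMap).subtype).codRestrict
        (L.char x) (fun c => hmem x hx c.1 c.2)
    have hψ : Function.Bijective ψ := by
      constructor
      · rw [← LinearMap.ker_eq_bot, LinearMap.ker_eq_bot']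
        intro c hc
        exact Subtype.ext (hinj' x hx c.1 c.2 (congrArg Subtype.val hc))
      · intro v
        have hv : ((v : TangentSpace I x), (0 : TangentSpace I x →L[ℝ] ℝ)) ∈ L.fiber x := v.2
        rw [← hrange x hx.1] at hv
        obtain ⟨c, hc⟩ := hv
        refine ⟨⟨c, (hker x hx.2 c).mpr (by rw [hc])⟩, Subtype.ext ?_⟩
        change (Λ x c).1 = v
        rw [hc]
    rw [← hL x]
    exact (LinearEquiv.ofBijective ψ hψ).finrank_eq
  obtain ⟨U', hU'sub, hU'o, hxU', c, hc, hc'⟩ := exists_kernel_frame hWo hA hk ⟨hx₀, hx₀τ⟩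
  refine ⟨{ base := U'
            isOpen_base := hU'o
            vec := fun i x => if h : x ∈ U' then
              ⟨(Λ x (c i x)).1, hmem x (hU'sub h) _ ((hc' x h).1 i)⟩ else 0
            smooth := fun i => ?_
            indep := fun x hx => ?_ }, hxU'⟩
  · have h1 : SmoothVectorFieldOn I (fun x => ∑ a, c i x a • X a x) U' := by
      intro x hx
      have hxU : x ∈ U := (hU'sub hx).1
      refine ContMDiffWithinAt.sum_section fun a _ => ?_
      refine ContMDiffWithinAt.smul_section ?_ ?_
      · exact ((ContinuousLinearMap.proj (R := ℝ) (φ := fun _ : Fin (Module.finrank ℝ E) => ℝ) a).contMDiff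
          |>.contMDiffAt.comp_contMDiffWithinAt x (hc i x hx))
      · exact ((hX a).contMDiffAt (hU.mem_nhds hxU)).contMDiffWithinAt
    refine h1.congr fun x hx => ?_
    simp only [hx, dif_pos, hΛ₁]
  · have hx' := hU'sub hx
    simp only [hx, dif_pos]
    rw [Fintype.linearIndependent_iff]
    intro g hg
    have hg' : (Λ x (∑ i, g i • c i x)).1 = 0 := by
      have := congrArg Subtype.val hg
      simpa [Prod.fst_sum] using this
    have hA0 : A x (∑ i, g i • c i x) = 0 := by
      simp [(hc' x hx).1]
    exact Fintype.linearIndependent_iff.mp (hc' x hx).2 g (hinj' x hx' _ hA0 hg')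

end Frames

/-! ## The bundle `E*` dual to the characteristic distribution -/

section DualBundle

variable {E H : Type*} [NormedAddCommGroup E] [NormedSpace ℝ E] [FiniteDimensional ℝ E]
  [TopologicalSpace H] {I : ModelWithCorners ℝ E H} {N : Type*} [TopologicalSpace N]
  [ChartedSpace H N] [IsManifold I ∞ N]

/-- The fibre `E_x^*` of the dual of `E = L ∩ TN`, where `E` has constant rank `k`. -/
def DiracStructure.CharDual (L : DiracStructure I N) {k : ℕ} (_hL : L.HasCharRank k) (x : N) :
    Type _ :=
  L.char x →L[ℝ] ℝ

variable (L : DiracStructure I N) {k : ℕ} (hL : L.HasCharRank k)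

instance (x : N) : AddCommGroup (L.CharDual hL x) :=
  inferInstanceAs (AddCommGroup (L.char x →L[ℝ] ℝ))

instance (x : N) : Module ℝ (L.CharDual hL x) :=
  inferInstanceAs (Module ℝ (L.char x →L[ℝ] ℝ))

instance (x : N) : TopologicalSpace (L.CharDual hL x) :=
  inferInstanceAs (TopologicalSpace (L.char x →L[ℝ] ℝ))

instance (x : N) : IsTopologicalAddGroup (L.CharDual hL x) :=
  inferInstanceAs (IsTopologicalAddGroup (L.char x →L[ℝ] ℝ))

instance (x : N) : ContinuousSMul ℝ (L.CharDual hL x) :=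
  inferInstanceAs (ContinuousSMul ℝ (L.char x →L[ℝ] ℝ))

variable {L}

/-- A frame of `E` is a basis of `E_x` at each point of its domain. -/
def CharFrame.basis (f : CharFrame L k) {x : N} (hx : x ∈ f.base) :
    Module.Basis (Fin k) ℝ (L.char x) :=
  haveI := finiteDimensional_char L x
  Module.Basis.mk (f.indep x hx)
    ((f.indep x hx).span_eq_top_of_card_eq_finrank' (by rw [hL x, Fintype.card_fin])).ge

/-- The fibre coordinates `λ ↦ (λ(s₁), …, λ(s_k))` on `E_x^*` given by a frame `s` of `E`. -/
def CharFrame.dualEquiv (f : CharFrame L k) {x : N} (hx : x ∈ f.base) :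
    L.CharDual hL x ≃ₗ[ℝ] (Fin k → ℝ) :=
  haveI := finiteDimensional_char L x
  haveI : T2Space (TangentSpace I x) := inferInstanceAs (T2Space E)
  (LinearMap.toContinuousLinearMap (𝕜 := ℝ) (E := L.char x) (F' := ℝ)).symm.trans
    ((f.basis hL hx).constr ℝ).symm

theorem CharFrame.dualEquiv_apply (f : CharFrame L k) {x : N} (hx : x ∈ f.base)
    (l : L.CharDual hL x) (i : Fin k) :
    f.dualEquiv hL hx l i = (show L.char x →L[ℝ] ℝ from l) (f.vec i x) := by
  have h : f.basis hL hx i = f.vec i x := by simp [CharFrame.basis]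
  rw [← h]
  rfl

open Classical in
/-- The pretrivialization of `E*` over the domain of a frame of `E`. -/
def CharFrame.pretriv (f : CharFrame L k) :
    Pretrivialization (Fin k → ℝ) (π (Fin k → ℝ) (L.CharDual hL)) where
  toFun p := (p.1, fun i => (show L.char p.1 →L[ℝ] ℝ from p.2) (f.vec i p.1))
  invFun p := ⟨p.1, if h : p.1 ∈ f.base then (f.dualEquiv hL h).symm p.2 else 0⟩
  source := TotalSpace.proj ⁻¹' f.base
  target := f.base ×ˢ Set.univ
  baseSet := f.base
  open_baseSet := f.isOpen_base
  open_target := f.isOpen_base.prod isOpen_univ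
  source_eq := rfl
  target_eq := rfl
  proj_toFun _ _ := rfl
  map_source' p hp := ⟨hp, trivial⟩
  map_target' p hp := hp.1
  left_inv' := by
    rintro ⟨x, l⟩ hx
    have hx' : x ∈ f.base := hx
    have : (fun i => (show L.char x →L[ℝ] ℝ from l) (f.vec i x)) = f.dualEquiv hL hx' l := by
      funext i; rw [f.dualEquiv_apply]
    simp only [hx', dif_pos]
    rw [this, LinearEquiv.symm_apply_apply]
  right_inv' := by
    rintro ⟨x, c⟩ hx
    have hx' : x ∈ f.base := hx.1
    simp only [hx', dif_pos]
    congr 1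
    funext i
    rw [← f.dualEquiv_apply hL hx', LinearEquiv.apply_symm_apply]

theorem CharFrame.pretriv_apply (f : CharFrame L k) {x : N} (hx : x ∈ f.base)
    (l : L.CharDual hL x) : f.pretriv hL ⟨x, l⟩ = (x, f.dualEquiv hL hx l) := by
  refine Prod.ext rfl (funext fun i => ?_)
  exact (f.dualEquiv_apply hL hx l i).symm

theorem CharFrame.pretriv_isLinear (f : CharFrame L k) : (f.pretriv hL).IsLinear ℝ where
  linear x hx := by
    have hx' : x ∈ f.base := hx
    have h : (fun l : L.CharDual hL x => (f.pretriv hL ⟨x, l⟩).2) = f.dualEquiv hL hx' := by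
      funext l; rw [f.pretriv_apply hL hx']
    rw [h]
    exact (f.dualEquiv hL hx').toLinearMap.isLinear

theorem CharFrame.pretriv_symm (f : CharFrame L k) {x : N} (hx : x ∈ f.base) (c : Fin k → ℝ) :
    (f.pretriv hL).symm x c = (f.dualEquiv hL hx).symm c := by
  have h := (f.pretriv hL).symm_apply_apply_mk hx ((f.dualEquiv hL hx).symm c)
  rw [f.pretriv_apply hL hx, LinearEquiv.apply_symm_apply] at h
  exact h

/-- The change of fibre coordinates on `E*` between two frames of `E`. -/
theorem CharFrame.exists_coordChange (f g : CharFrame L k) :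
    ∃ F : N → (Fin k → ℝ) →L[ℝ] (Fin k → ℝ),
      ContMDiffOn I 𝓘(ℝ, (Fin k → ℝ) →L[ℝ] (Fin k → ℝ)) ∞ F
        ((f.pretriv hL).baseSet ∩ (g.pretriv hL).baseSet) ∧
      ∀ x ∈ (f.pretriv hL).baseSet ∩ (g.pretriv hL).baseSet, ∀ c : Fin k → ℝ,
        F x c = (g.pretriv hL ⟨x, (f.pretriv hL).symm x c⟩).2 := by
  classical
  -- the coefficients of the frame `g` with respect to the frame `f`
  let a : Fin k → N → Fin k → ℝ := fun i x =>
    if h : x ∈ f.base then (f.basis hL h).repr (g.vec i x) else 0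
  have ha : ∀ i, ∀ x ∈ f.base, g.vec i x = ∑ j, a i x j • f.vec j x := by
    intro i x hx
    have h : ∀ j, f.basis hL hx j = f.vec j x := fun j => by simp [CharFrame.basis]
    have := (f.basis hL hx).sum_repr (g.vec i x)
    simp only [h] at this
    simp only [a, hx, dif_pos]
    exact this.symm
  have hsm : ∀ i, ∀ x ∈ f.base ∩ g.base, ContMDiffAt I 𝓘(ℝ, Fin k → ℝ) ∞ (a i) x := by
    intro i x hx
    let e := trivializationAt E (TangentSpace I) x
    have hxe : x ∈ e.baseSet := mem_baseSet_trivializationAt E (TangentSpace I) x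
    refine contMDiffAt_coeff
      (σ := fun j y => (e ⟨y, (f.vec j y : TangentSpace I y)⟩).2)
      (y := fun y => (e ⟨y, (g.vec i y : TangentSpace I y)⟩).2)
      (fun j => (f.smooth j).contMDiffAt_triv (f.isOpen_base.mem_nhds hx.1))
      ((g.smooth i).contMDiffAt_triv (g.isOpen_base.mem_nhds hx.2)) ?_ ?_
    · have h1 := ((f.indep x hx.1).map' (L.char x).subtype (Submodule.ker_subtype _)).map'
        (e.continuousLinearEquivAt ℝ x hxe).toLinearEquiv.toLinearMap (LinearEquiv.ker _)
      exact h1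
    · filter_upwards [f.isOpen_base.mem_nhds hx.1, e.open_baseSet.mem_nhds hxe] with y hy hye
      have h2 : (g.vec i y : TangentSpace I y) = ∑ j, a i y j • (f.vec j y : TangentSpace I y) := by
        rw [ha i y hy]; simp
      have h3 := congrArg (e.continuousLinearEquivAt ℝ y hye) h2
      rw [map_sum] at h3
      simp only [map_smul] at h3
      exact h3
  refine ⟨fun x => ∑ i, (∑ j, a i x j •
      (ContinuousLinearMap.proj j : (Fin k → ℝ) →L[ℝ] ℝ)).smulRight
        (Pi.single i (1 : ℝ) : Fin k → ℝ), ?_, ?_⟩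
  · intro x hx
    refine ContMDiffAt.contMDiffWithinAt ?_
    refine ContMDiffAt.sum fun i _ => ?_
    have h1 : ContMDiffAt I 𝓘(ℝ, (Fin k → ℝ) →L[ℝ] ℝ) ∞ (fun x => ∑ j, a i x j •
        (ContinuousLinearMap.proj j : (Fin k → ℝ) →L[ℝ] ℝ)) x := by
      refine ContMDiffAt.sum fun j _ => ?_
      let p : (Fin k → ℝ) →L[ℝ] ℝ := ContinuousLinearMap.proj j
      let q : (Fin k → ℝ) →L[ℝ] ((Fin k → ℝ) →L[ℝ] ℝ) := p.smulRight p
      exact q.contMDiff.contMDiffAt.comp x (hsm i x hx)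
    let S : ((Fin k → ℝ) →L[ℝ] ℝ) →L[ℝ] ((Fin k → ℝ) →L[ℝ] (Fin k → ℝ)) :=
      (ContinuousLinearMap.smulRightL ℝ (Fin k → ℝ) (Fin k → ℝ)).flip (Pi.single i (1 : ℝ))
    exact S.contMDiff.contMDiffAt.comp x h1
  · intro x hx c
    have hxf : x ∈ f.base := hx.1
    have hxg : x ∈ g.base := hx.2
    rw [f.pretriv_symm hL hxf, g.pretriv_apply hL hxg]
    funext i
    change _ = g.dualEquiv hL hxg ((f.dualEquiv hL hxf).symm c) i
    let l : L.char x →L[ℝ] ℝ := (f.dualEquiv hL hxf).symm c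
    have hl : ∀ j, l (f.vec j x) = c j := fun j => by
      have h := f.dualEquiv_apply hL hxf ((f.dualEquiv hL hxf).symm c) j
      rw [LinearEquiv.apply_symm_apply] at h
      exact h.symm
    rw [g.dualEquiv_apply]
    change _ = l (g.vec i x)
    rw [ha i x hxf, map_sum]
    simp only [map_smul, hl]
    simp [Finset.sum_apply, Pi.single_apply]

variable (L)

/-- `E*` as a vector prebundle: its pretrivializations are given by all smooth local frames
of `E`. -/
def charDualPrebundle : VectorPrebundle ℝ (Fin k → ℝ) (L.CharDual hL) where
  pretrivializationAtlas := Set.range fun f : CharFrame L k => f.pretriv hL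
  pretrivialization_linear' := by rintro _ ⟨f, rfl⟩; exact f.pretriv_isLinear hL
  pretrivializationAt x := (exists_charFrame L hL x).choose.pretriv hL
  mem_base_pretrivializationAt x := (exists_charFrame L hL x).choose_spec
  pretrivialization_mem_atlas x := ⟨_, rfl⟩
  exists_coordChange := by
    rintro _ ⟨f, rfl⟩ _ ⟨g, rfl⟩
    obtain ⟨F, hF, hF'⟩ := f.exists_coordChange hL g
    exact ⟨F, hF.continuousOn, hF'⟩
  totalSpaceMk_isInducing x := by
    set f := (exists_charFrame L hL x).choose
    have hx : x ∈ f.base := (exists_charFrame L hL x).choose_spec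
    have : T2Space (TangentSpace I x) := inferInstanceAs (T2Space E)
    have : T2Space (L.CharDual hL x) := inferInstanceAs (T2Space (L.char x →L[ℝ] ℝ))
    have : FiniteDimensional ℝ (L.CharDual hL x) :=
      (f.dualEquiv hL hx).symm.finiteDimensional
    have h : (f.pretriv hL ∘ TotalSpace.mk x) =
        (fun c => (x, c)) ∘ (f.dualEquiv hL hx).toContinuousLinearEquiv := by
      funext l
      exact f.pretriv_apply hL hx l
    rw [h]
    exact (isInducing_const_prod.mpr Topology.IsInducing.id).comp
      (f.dualEquiv hL hx).toContinuousLinearEquiv.toHomeomorph.isInducing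

instance : (charDualPrebundle L hL).IsContMDiff I ∞ where
  exists_contMDiffCoordChange := by
    rintro _ ⟨f, rfl⟩ _ ⟨g, rfl⟩
    exact f.exists_coordChange hL g

instance : TopologicalSpace (TotalSpace (Fin k → ℝ) (L.CharDual hL)) :=
  (charDualPrebundle L hL).totalSpaceTopology

instance : FiberBundle (Fin k → ℝ) (L.CharDual hL) :=
  (charDualPrebundle L hL).toFiberBundle

instance : VectorBundle ℝ (Fin k → ℝ) (L.CharDual hL) :=
  (charDualPrebundle L hL).toVectorBundle

instance : ContMDiffVectorBundle ∞ (Fin k → ℝ) (L.CharDual hL) I :=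
  (charDualPrebundle L hL).contMDiffVectorBundle I

/-- The total space of the vector bundle `E* → N`, a smooth manifold modelled on
`E × ℝ^k`. -/
abbrev DiracStructure.CharDualSpace :=
  TotalSpace (Fin k → ℝ) (L.CharDual hL)

variable {L} {hL}

/-- The embedding `E* → T*N` determined by a splitting `TN = E ⊕ V`: a functional on `E_x` is
extended to `T_x N` by zero on `V_x`. -/
def DiracStructure.Splitting.embed (V : L.Splitting) (e : L.CharDualSpace hL) :
    CotangentBundle I N :=
  haveI : FiniteDimensional ℝ (TangentSpace I e.proj) := inferInstanceAs (FiniteDimensional ℝ E)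
  haveI : T2Space (TangentSpace I e.proj) := inferInstanceAs (T2Space E)
  ⟨e.proj, LinearMap.toContinuousLinearMap
    ((show L.char e.proj →L[ℝ] ℝ from e.2).toLinearMap ∘ₗ
      (L.char e.proj).projectionOnto (V.fiber e.proj) (V.isCompl e.proj))⟩

end DualBundle

/-! ## The canonical Poisson manifold -/

section Canonical

variable {E H : Type*} [NormedAddCommGroup E] [NormedSpace ℝ E]
  [TopologicalSpace H] (I : ModelWithCorners ℝ E H) {N : Type*} [TopologicalSpace N]
  [ChartedSpace H N] [IsManifold I ∞ N]

/-- The canonical one-form `α = p dq` on `T*N`: `α_{(x, ξ)}(w) = ξ(d pr(w))`. -/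
def canonicalOneForm (z : CotangentBundle I N) :
    TangentSpace (I.prod 𝓘(ℝ, E →L[ℝ] ℝ)) z →L[ℝ] ℝ :=
  z.2.comp (mfderiv (I.prod 𝓘(ℝ, E →L[ℝ] ℝ)) I (fun y : CotangentBundle I N => y.proj) z)

/-- The canonical symplectic form `ω = dα = dp ∧ dq` on `T*N`. -/
def canonicalTwoForm (z : CotangentBundle I N) :
    TangentSpace (I.prod 𝓘(ℝ, E →L[ℝ] ℝ)) z →ₗ[ℝ]
      (TangentSpace (I.prod 𝓘(ℝ, E →L[ℝ] ℝ)) z →L[ℝ] ℝ) :=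
  extDerivOneForm (I.prod 𝓘(ℝ, E →L[ℝ] ℝ)) (canonicalOneForm I) z

variable {I} [FiniteDimensional ℝ E] {L : DiracStructure I N} {k : ℕ} (hL : L.HasCharRank k)

/-- The pullback `i^* ω` of the canonical symplectic form under the embedding `i : E* → T*N` given
by `V`. -/
def DiracStructure.Splitting.pullbackForm (V : L.Splitting) (e : L.CharDualSpace hL) :
    TangentSpace (I.prod 𝓘(ℝ, Fin k → ℝ)) e →ₗ[ℝ]
      (TangentSpace (I.prod 𝓘(ℝ, Fin k → ℝ)) e →L[ℝ] ℝ) :=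
  let A := mfderiv (I.prod 𝓘(ℝ, Fin k → ℝ)) (I.prod 𝓘(ℝ, E →L[ℝ] ℝ))
    (fun y : L.CharDualSpace hL => V.embed y) e
  { toFun := fun w => (canonicalTwoForm I (V.embed e) (A w)).comp A
    map_add' := fun u v => by
      have h : A (u + v) = A u + A v := A.map_add u v
      rw [h, LinearMap.map_add]
      exact ContinuousLinearMap.add_comp _ _ _
    map_smul' := fun r u => by
      have h : A (r • u) = r • A u := A.map_smul r u
      rw [h, LinearMap.map_smul]
      exact ContinuousLinearMap.smul_comp _ _ _ }

/-- The Dirac structure `L_{E*} = τ_{i^* ω} (π^* L)` on the total space of `π : E* → N`. -/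
def DiracStructure.Splitting.canonicalDirac (V : L.Splitting) (e : L.CharDualSpace hL) :
    Submodule ℝ (TangentSpace (I.prod 𝓘(ℝ, Fin k → ℝ)) e ×
      (TangentSpace (I.prod 𝓘(ℝ, Fin k → ℝ)) e →L[ℝ] ℝ)) :=
  diracGauge (V.pullbackForm hL e)
    (diracPullback (mfderiv (I.prod 𝓘(ℝ, Fin k → ℝ)) I
      (fun y : L.CharDualSpace hL => y.proj) e) (L.fiber e.proj))

/-- The set of points of `E*` at which `L_{E*}` is the graph of a bivector, i.e. meets the
tangent space trivially. Restricted to it, `L_{E*}` is the canonical Poisson manifold of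
`(N, L)` (for the splitting `V`). -/
def DiracStructure.Splitting.poissonLocus (V : L.Splitting) : Set (L.CharDualSpace hL) :=
  {e | ∀ w : TangentSpace (I.prod 𝓘(ℝ, Fin k → ℝ)) e, (w, 0) ∈ V.canonicalDirac hL e → w = 0}

/-- `Φ`, a diffeomorphism between open subsets `U = Φ.source` of the Poisson manifold `(P, Π)` and
`W = Φ.target` of `E*`, is a Poisson diffeomorphism onto an open subset of the canonical Poisson
manifold: `W` lies in the region where `L_{E*}` is Poisson, and `Φ` identifies the Poisson
structures, `Φ^* L_{E*} = L_Π` on `U`. -/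
structure IsPoissonDiffeoToCanonical {E' H' : Type*} [NormedAddCommGroup E'] [NormedSpace ℝ E']
    [TopologicalSpace H'] {I' : ModelWithCorners ℝ E' H'} {P : Type*} [TopologicalSpace P]
    [ChartedSpace H' P] [IsManifold I' ∞ P] (Pi : PoissonStructure I' P) (V : L.Splitting)
    (Φ : PartialDiffeomorph I' (I.prod 𝓘(ℝ, Fin k → ℝ)) P (L.CharDualSpace hL) ∞) : Prop where
  target_subset : Φ.target ⊆ V.poissonLocus hL
  pullback_eq : ∀ u ∈ Φ.source,
    diracPullback (mfderiv I' (I.prod 𝓘(ℝ, Fin k → ℝ)) Φ u) (V.canonicalDirac hL (Φ u)) =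
      Pi.graph u

end Canonical

end

/-! The canonical structure enters only through three properties along the zero section, which every
coisotropic embedding shares. Take a slice chart of `P` around `i x`, and the chart of `E*` given by
a chart of `M` and a local frame of `E`. Both Poisson structures become bivectors `S`, `S'` on `A ×
ℝ^k` near `(a₀, 0)`, with `M` given by `c = 0`. For both of them, sharp maps the conormal covectors
`κ ∘ snd` into the tangent space of `c = 0` and does so injectively, and the Dirac structure induced
on `c = 0` is that of `M` read in the chart. It remains to see that such a bivector is determined by
the induced Dirac structure, up to a local diffeomorphism that fixes `(a₀, 0)` and preserves `c = 0`
(`exists_poisson_diffeo`).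

The main tool is a splitting theorem along `c = 0` (`exists_normal_form`). One constructs commuting
functions `q₁, …, q_k` whose Hamiltonian fields are transverse to `c = 0`, and lets `pᵢ` be the time
needed to reach a point from `c = 0` along these commuting flows. Then `{qᵢ, pⱼ} = δᵢⱼ` and `p = 0`
cuts out `c = 0`. The brackets `{pᵢ, pⱼ}` are constant along the flows by the Jacobi identity, and
vanish on `c = 0` by coisotropy, so they vanish (`exists_canonical_pairs`). The `2k` Hamiltonian
fields of the `pᵢ` and `qᵢ` commute. Straightening them gives further coordinates `y`, constant
along all of them, whose mutual brackets depend on `y` only. Hence the bivector is the canonical one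
in `(p, q)` plus a bivector `Q` in `y`.

On `p = 0`, the map `ρ = y` is the quotient by the characteristic foliation, and the induced Dirac
structure is the pullback of the graph of `Q` along `ρ` (`IsNormalForm.inducedRel_iff`). So the
induced structure determines the fibres of `ρ`, hence the local quotient, and also `Q` on it. Two
bivectors with the same induced structure have quotients identified by a diffeomorphism carrying `Q`
to `Q'`. Together with the identity in `(p, q)` it gives the required diffeomorphism, which on `c =
0` need not be the identity.

For the canonical structure, the pullback of the Liouville form to `E*` is `θ = ∑ cⱼ Φⱼ`, where `Φ`
is the coframe dual to the frame of `E` and zero on `V`. In the chart the Dirac structure is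
therefore the gauge transformation by `dθ` of the pullback of `L`. At `c = 0` one has `dθ = ∑ dcⱼ ∧
Φⱼ`, which makes it transverse to the tangent space. It is then the graph of a bivector, with the
Jacobi identity following from integrability of `L` and `d(dθ) = 0` (`exists_sharp_of_frame`).

The analytic input is a smooth joint flow of commuting fields (`exists_jointFlow`), obtained from
the inverse function theorem on the Banach space of continuous curves. -/

set_option linter.unusedSectionVars false

noncomputable section

/-! ## Smooth local inverses and extensions -/

section LocalInverse

/-- The inverse function theorem, with smoothness on whole neighbourhoods. -/
theorem exists_smooth_openPartialHomeomorph {E F : Type*} [NormedAddCommGroup E]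
    [NormedSpace ℝ E] [NormedAddCommGroup F] [NormedSpace ℝ F] [CompleteSpace E] [CompleteSpace F]
    {f : E → F} {U : Set E} (hU : IsOpen U) (hf : ContDiffOn ℝ ∞ f U) {a : E} (ha : a ∈ U)
    (hinv : (fderiv ℝ f a).IsInvertible) :
    ∃ e : OpenPartialHomeomorph E F, a ∈ e.source ∧ e.source ⊆ U ∧ (∀ x, e x = f x) ∧
      ContDiffOn ℝ ∞ e.symm e.target ∧ ∀ x ∈ e.source, (fderiv ℝ f x).IsInvertible := by
  obtain ⟨f', hf'⟩ := hinv
  have hfa : ContDiffAt ℝ ∞ f a := hf.contDiffAt (hU.mem_nhds ha)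
  have hd : HasFDerivAt f (f' : E →L[ℝ] F) a := by
    rw [hf']; exact (hfa.differentiableAt (by simp)).hasFDerivAt
  let e₀ := hfa.toOpenPartialHomeomorph f hd (by simp)
  have hcont : ContinuousOn (fderiv ℝ f) U := hf.continuousOn_fderiv_of_isOpen hU (by simp)
  -- Invertibility of the derivative is an open condition. Restricting the source to it gives
  -- smoothness of the inverse at every point of the target, not only at `f a`.
  let W : Set E := U ∩ fderiv ℝ f ⁻¹' Set.range ((↑) : (E ≃L[ℝ] F) → E →L[ℝ] F)
  have hW : IsOpen W := hcont.isOpen_inter_preimage hU (ContinuousLinearEquiv.isOpen)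
  have haW : a ∈ W := ⟨ha, f', hf'⟩
  let e := e₀.restrOpen W hW
  have hs : e.source = e₀.source ∩ W := e₀.restrOpen_source W hW
  have hW' : ∀ x ∈ e.source, x ∈ W := fun x hx => (hs ▸ hx).2
  refine ⟨e, ?_, fun x hx => (hW' x hx).1, fun x => rfl, ?_, fun x hx => ?_⟩
  · rw [hs]; exact ⟨hfa.mem_toOpenPartialHomeomorph_source hd (by simp), haW⟩
  · intro y hy
    have hx := e.map_target hy
    obtain ⟨hxU, g, hg⟩ := hW' _ hx
    have hfx : ContDiffAt ℝ ∞ f (e.symm y) := hf.contDiffAt (hU.mem_nhds hxU)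
    refine (e.contDiffAt_symm (f₀' := g) hy ?_ hfx).contDiffWithinAt
    rw [hg]; exact (hfx.differentiableAt (by simp)).hasFDerivAt
  · obtain ⟨-, g, hg⟩ := hW' x hx
    exact ⟨g, hg⟩

/-- A smooth germ on a finite-dimensional space is the germ of a globally smooth function. -/
theorem exists_contDiff_eventuallyEq {E F : Type*} [NormedAddCommGroup E]
    [NormedSpace ℝ E] [FiniteDimensional ℝ E] [NormedAddCommGroup F] [NormedSpace ℝ F]
    {f : E → F} {U : Set E} (hU : IsOpen U) (hf : ContDiffOn ℝ ∞ f U) {a : E} (ha : a ∈ U) :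
    ∃ g : E → F, ContDiff ℝ ∞ g ∧ g =ᶠ[𝓝 a] f := by
  obtain ⟨r, hr, hrU⟩ := Metric.isOpen_iff.mp hU a ha
  -- The outer radius `r / 2` keeps the closed support inside `ball a r ⊆ U`, so that `b • f` is
  -- smooth everywhere; it equals `f` where the bump is one.
  let b : ContDiffBump a := ⟨r / 4, r / 2, by positivity, by linarith⟩
  refine ⟨fun x => b x • f x, ?_, ?_⟩
  · rw [contDiff_iff_contDiffAt]
    intro x
    by_cases hx : x ∈ U
    · exact b.contDiff.contDiffAt.smul (hf.contDiffAt (hU.mem_nhds hx))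
    · have hx' : x ∉ tsupport b := fun h => by
        rw [b.tsupport_eq] at h
        refine hx (hrU (lt_of_le_of_lt (Metric.mem_closedBall.mp h) ?_))
        change r / 2 < r
        linarith
      have : (fun x => b x • f x) =ᶠ[𝓝 x] fun _ => 0 := by
        filter_upwards [notMem_tsupport_iff_eventuallyEq.mp hx'] with y hy
        rw [hy]; simp
      exact contDiffAt_const.congr_of_eventuallyEq this
  · filter_upwards [b.eventuallyEq_one] with x hx
    simp [hx]

end LocalInverse

/-! ## Composition operators on continuous curves -/

section Nemytskii

open unitInterval

variable {F G H : Type*} [NormedAddCommGroup F] [NormedSpace ℝ F] [NormedAddCommGroup G]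
  [NormedSpace ℝ G] [NormedAddCommGroup H] [NormedSpace ℝ H]

/-- The space of continuous curves `[0, 1] → F`, with the supremum norm. -/
def Curve (F : Type*) [TopologicalSpace F] : Type _ := C(I, F)

instance {F : Type*} [NormedAddCommGroup F] : NormedAddCommGroup (Curve F) :=
  inferInstanceAs (NormedAddCommGroup C(I, F))

instance {F : Type*} [NormedAddCommGroup F] [NormedSpace ℝ F] : NormedSpace ℝ (Curve F) :=
  inferInstanceAs (NormedSpace ℝ C(I, F))

instance {F : Type*} [NormedAddCommGroup F] [CompleteSpace F] : CompleteSpace (Curve F) :=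
  inferInstanceAs (CompleteSpace C(I, F))

instance {F : Type*} [TopologicalSpace F] : FunLike (Curve F) I F :=
  inferInstanceAs (FunLike C(I, F) I F)

namespace Curve

/-- A continuous function on `[0, 1]`, as a curve. -/
def mk {F : Type*} [TopologicalSpace F] (f : I → F) (hf : Continuous f) : Curve F :=
  (⟨f, hf⟩ : C(I, F))

theorem mk_apply {F : Type*} [TopologicalSpace F] (f : I → F) (hf : Continuous f) (t : I) :
    mk f hf t = f t := rfl

theorem continuous {F : Type*} [TopologicalSpace F] (γ : Curve F) : Continuous γ :=
  ContinuousMap.continuous (show C(I, F) from γ)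

theorem ext {F : Type*} [TopologicalSpace F] {γ δ : Curve F} (h : ∀ t, γ t = δ t) : γ = δ :=
  ContinuousMap.ext h

theorem norm_apply_le (γ : Curve F) (t : I) : ‖γ t‖ ≤ ‖γ‖ :=
  ContinuousMap.norm_coe_le_norm (show C(I, F) from γ) t

theorem norm_le {γ : Curve F} {C : ℝ} (hC : 0 ≤ C) (h : ∀ t, ‖γ t‖ ≤ C) : ‖γ‖ ≤ C :=
  (ContinuousMap.norm_le (show C(I, F) from γ) hC).mpr h

theorem add_apply (γ δ : Curve F) (t : I) : (γ + δ) t = γ t + δ t := rfl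

theorem sub_apply (γ δ : Curve F) (t : I) : (γ - δ) t = γ t - δ t := rfl

theorem zero_apply (t : I) : (0 : Curve F) t = 0 := rfl

theorem smul_apply (c : ℝ) (γ : Curve F) (t : I) : (c • γ) t = c • γ t := rfl

/-- Evaluation at a time. -/
def eval (t : I) : Curve F →L[ℝ] F :=
  LinearMap.mkContinuous
    { toFun := fun γ => γ t
      map_add' := fun _ _ => rfl
      map_smul' := fun _ _ => rfl } 1 (fun γ => by rw [one_mul]; exact γ.norm_apply_le t)

theorem sum_apply {ι : Type*} (s : Finset ι) (γ : ι → Curve F) (t : I) :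
    (∑ i ∈ s, γ i) t = ∑ i ∈ s, γ i t :=
  map_sum (eval t) γ s

end Curve

/-- Pointwise application of a continuous bilinear map to two curves. -/
def curveBilin (B : H →L[ℝ] F →L[ℝ] G) : Curve H →L[ℝ] Curve F →L[ℝ] Curve G :=
  LinearMap.mkContinuous₂
    (LinearMap.mk₂ ℝ (fun (A : Curve H) (h : Curve F) =>
      Curve.mk (fun t => B (A t) (h t)) ((B.continuous.comp A.continuous).clm_apply h.continuous))
      (fun A A' h => Curve.ext fun t => by simp [Curve.mk_apply, Curve.add_apply])
      (fun c A h => Curve.ext fun t => by simp [Curve.mk_apply, Curve.smul_apply])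
      (fun A h k => Curve.ext fun t => by simp [Curve.mk_apply, Curve.add_apply])
      (fun c A h => Curve.ext fun t => by simp [Curve.mk_apply, Curve.smul_apply])) ‖B‖
    (fun A h => by
      refine Curve.norm_le (by positivity) fun t => ?_
      refine (B.le_opNorm₂ (A t) (h t)).trans ?_
      gcongr
      · exact A.norm_apply_le t
      · exact h.norm_apply_le t)

/-- The composition operator `γ ↦ f ∘ γ` on continuous curves. -/
def curveComp (f : F → G) (hf : Continuous f) (γ : Curve F) : Curve G :=
  Curve.mk (fun t => f (γ t)) (hf.comp γ.continuous)

/-- The derivative of `f` is uniformly continuous near the compact image of `γ`, so the mean value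
inequality bounds the remainder by `ε ‖h‖` uniformly in time. Writing the derivative as `B (f' x)`
presents the derivative of the operator as a fixed bilinear map applied to the composition operator
of `f'`, the form that induction on the order of smoothness needs. -/
theorem hasFDerivAt_curveComp {f : F → G} {f' : F → H} (B : H →L[ℝ] F →L[ℝ] G)
    (hf : ∀ x, HasFDerivAt f (B (f' x)) x) (hf' : Continuous f') (hfc : Continuous f)
    (γ : Curve F) :
    HasFDerivAt (curveComp f hfc) (curveBilin B (curveComp f' hf' γ)) γ := by
  rw [hasFDerivAt_iff_isLittleO_nhds_zero, Asymptotics.isLittleO_iff]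
  intro ε hε
  have hK : IsCompact (Set.range γ) := isCompact_range γ.continuous
  have hc : Continuous fun x => B (f' x) := B.continuous.comp hf'
  have hu := hK.uniformContinuousAt_of_continuousAt (fun x => B (f' x))
    (fun x _ => hc.continuousAt) (Metric.dist_mem_uniformity hε)
  obtain ⟨δ, hδ, hδ'⟩ := Metric.mem_uniformity_dist.mp hu
  filter_upwards [Metric.ball_mem_nhds (0 : Curve F) hδ] with h hh
  refine Curve.norm_le (by positivity) fun t => ?_
  have hht : ‖h t‖ ≤ ‖h‖ := h.norm_apply_le t
  have hlt : ‖h t‖ < δ := lt_of_le_of_lt hht (by simpa using hh)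
  have hmv := (convex_ball (γ t) δ).norm_image_sub_le_of_norm_hasFDerivWithin_le'
    (f := f) (f' := fun x => B (f' x)) (φ := B (f' (γ t))) (C := ε) (x := γ t) (y := γ t + h t)
    (fun x _ => (hf x).hasFDerivWithinAt)
    (fun x hx => by
      have := hδ' (a := γ t) (b := x) (by rw [dist_comm]; exact hx) ⟨t, rfl⟩
      simp only [Set.mem_ofPred_eq] at this
      rw [dist_comm, dist_eq_norm] at this
      exact this.le)
    (Metric.mem_ball_self hδ) (by simpa using hlt)
  simp only [add_sub_cancel_left] at hmv
  exact hmv.trans (mul_le_mul_of_nonneg_left hht hε.le)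

/-- The derivative of the composition operator of `f` is a continuous linear image of the
composition operator of `f'`, so one order of smoothness is gained. -/
theorem contDiff_succ_curveComp {n : ℕ} {f : F → G} {f' : F → H} (B : H →L[ℝ] F →L[ℝ] G)
    (hf : ∀ x, HasFDerivAt f (B (f' x)) x) (hf' : Continuous f') (hfc : Continuous f)
    (h : ContDiff ℝ n (curveComp f' hf')) : ContDiff ℝ (n + 1 : ℕ) (curveComp f hfc) := by
  have hd : fderiv ℝ (curveComp f hfc) = fun γ => curveBilin B (curveComp f' hf' γ) :=
    funext fun γ => (hasFDerivAt_curveComp B hf hf' hfc γ).fderiv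
  rw [Nat.cast_succ, contDiff_succ_iff_fderiv]
  refine ⟨fun γ => (hasFDerivAt_curveComp B hf hf' hfc γ).differentiableAt, by simp, ?_⟩
  rw [hd]
  exact (curveBilin B).contDiff.comp h

end Nemytskii

/-! ### Smoothness of composition operators, and primitives of curves -/

section Nemytskii

open unitInterval

universe u

variable {F G : Type u} [NormedAddCommGroup F] [NormedSpace ℝ F] [NormedAddCommGroup G]
  [NormedSpace ℝ G]

/-- The target space varies in the induction because the derivative takes values in `F →L[ℝ] G`; for
the same reason both spaces lie in one universe. -/
theorem contDiff_curveComp_nat (n : ℕ) : ∀ {G : Type u} [NormedAddCommGroup G] [NormedSpace ℝ G]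
    {f : F → G} (hf : ContDiff ℝ ∞ f), ContDiff ℝ n (curveComp f hf.continuous) := by
  induction n with
  | zero =>
    intro G _ _ f hf
    rw [Nat.cast_zero, contDiff_zero]
    exact (ContinuousMap.continuous_postcomp (⟨f, hf.continuous⟩ : C(F, G)) :
      Continuous fun γ : C(I, F) => (⟨f, hf.continuous⟩ : C(F, G)).comp γ)
  | succ n ih =>
    intro G _ _ f hf
    have hD : ContDiff ℝ ∞ (fderiv ℝ f) := hf.fderiv_right (by simp)
    exact contDiff_succ_curveComp (ContinuousLinearMap.id ℝ (F →L[ℝ] G))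
      (fun x => (hf.differentiable (by simp) x).hasFDerivAt) hD.continuous hf.continuous (ih hD)

theorem contDiff_curveComp {f : F → G} (hf : ContDiff ℝ ∞ f) :
    ContDiff ℝ ∞ (curveComp f hf.continuous) :=
  contDiff_infty.mpr fun n => contDiff_curveComp_nat n hf

/-- The primitive `t ↦ ∫₀ᵗ γ` of a curve. -/
def curvePrimitive (F : Type*) [NormedAddCommGroup F] [NormedSpace ℝ F] : Curve F →L[ℝ] Curve F :=
  LinearMap.mkContinuous
    { toFun := fun γ => Curve.mk (fun t => ∫ τ in (0 : ℝ)..t, Set.IccExtend zero_le_one γ τ) (by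
        have : Continuous fun t : ℝ => ∫ τ in (0 : ℝ)..t, Set.IccExtend zero_le_one γ τ :=
          intervalIntegral.continuous_primitive
            (fun a b => (γ.continuous.Icc_extend').intervalIntegrable a b) 0
        exact this.comp continuous_subtype_val)
      map_add' := fun γ δ => Curve.ext fun t =>
        intervalIntegral.integral_add ((γ.continuous.Icc_extend').intervalIntegrable _ _)
          ((δ.continuous.Icc_extend').intervalIntegrable _ _)
      map_smul' := fun c γ => Curve.ext fun t =>
        intervalIntegral.integral_smul c (Set.IccExtend zero_le_one γ) } 1
    (fun γ => by
      rw [one_mul]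
      refine Curve.norm_le (by positivity) fun t => ?_
      refine (intervalIntegral.norm_integral_le_of_norm_le_const (C := ‖γ‖) fun τ _ =>
        γ.norm_apply_le _).trans ?_
      rw [sub_zero, abs_of_nonneg t.2.1]
      exact mul_le_of_le_one_right (norm_nonneg _) t.2.2)

theorem curvePrimitive_apply (γ : Curve F) (t : I) :
    curvePrimitive F γ t = ∫ τ in (0 : ℝ)..t, Set.IccExtend zero_le_one γ τ := rfl

end Nemytskii

/-! ## Flows of commuting vector fields -/

section Flow

open unitInterval

universe u

variable {F : Type u} [NormedAddCommGroup F] [NormedSpace ℝ F]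

/-- The constant curves, as a continuous linear map. -/
def curveConst (F : Type*) [NormedAddCommGroup F] [NormedSpace ℝ F] : F →L[ℝ] Curve F :=
  LinearMap.mkContinuous
    { toFun := fun z => Curve.mk (fun _ => z) continuous_const
      map_add' := fun _ _ => rfl
      map_smul' := fun _ _ => rfl } 1
    (fun z => by
      rw [one_mul]
      exact Curve.norm_le (by positivity) fun t => le_rfl)

theorem curveConst_apply (z : F) (t : I) : curveConst F z t = z := rfl

/-- The derivative of the composition operator `γ ↦ X ∘ γ`. -/
def curveDeriv (X : F → F) (hX : ContDiff ℝ ∞ X) (γ : Curve F) : Curve F →L[ℝ] Curve F :=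
  curveBilin (ContinuousLinearMap.id ℝ (F →L[ℝ] F))
    (curveComp (fderiv ℝ X) (hX.continuous_fderiv (by simp)) γ)

theorem hasFDerivAt_curveComp_self {X : F → F} (hX : ContDiff ℝ ∞ X) (γ : Curve F) :
    HasFDerivAt (curveComp X hX.continuous) (curveDeriv X hX γ) γ :=
  hasFDerivAt_curveComp (ContinuousLinearMap.id ℝ (F →L[ℝ] F))
    (fun x => (hX.differentiable (by simp) x).hasFDerivAt) _ _ γ

variable {ι : Type} [Fintype ι] {X : ι → F → F} (hX : ∀ i, ContDiff ℝ ∞ (X i))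

/-- The map whose fibre over `((s, z), 0)` is the integral curve of `∑ sᵢ Xᵢ` starting at `z`. -/
def flowMap (u : ((ι → ℝ) × F) × Curve F) : ((ι → ℝ) × F) × Curve F :=
  (u.1, u.2 - curveConst F u.1.2 -
    ∑ i, u.1.1 i • curvePrimitive F (curveComp (X i) (hX i).continuous u.2))

theorem contDiff_flowMap : ContDiff ℝ ∞ (flowMap hX) := by
  refine contDiff_fst.prodMk ((contDiff_snd.sub
    ((curveConst F).contDiff.comp (contDiff_snd.comp contDiff_fst))).sub
    (ContDiff.sum fun i _ => ContDiff.fun_smul ?_ ?_))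
  · exact (contDiff_apply ℝ ℝ i).comp (contDiff_fst.comp contDiff_fst)
  · exact (curvePrimitive F).contDiff.comp ((contDiff_curveComp (hX i)).comp contDiff_snd)

theorem fderiv_flowMap (u v : ((ι → ℝ) × F) × Curve F) :
    fderiv ℝ (flowMap hX) u v = (v.1, v.2 - curveConst F v.1.2 -
      ∑ i, (u.1.1 i • curvePrimitive F (curveDeriv (X i) (hX i) u.2 v.2) +
        v.1.1 i • curvePrimitive F (curveComp (X i) (hX i).continuous u.2))) := by
  have h1 : HasFDerivAt (fun u : ((ι → ℝ) × F) × Curve F => curveConst F u.1.2) _ u :=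
    (curveConst F).hasFDerivAt.comp u (hasFDerivAt_snd.comp u hasFDerivAt_fst)
  have h2 : ∀ i ∈ Finset.univ, HasFDerivAt (fun u : ((ι → ℝ) × F) × Curve F =>
      u.1.1 i • curvePrimitive F (curveComp (X i) (hX i).continuous u.2)) _ u := fun i _ => by
    have ha : HasFDerivAt (fun u : ((ι → ℝ) × F) × Curve F => u.1.1 i)
        ((ContinuousLinearMap.proj (R := ℝ) (φ := fun _ : ι => ℝ) i).comp
          ((ContinuousLinearMap.fst ℝ (ι → ℝ) F).comp
            (ContinuousLinearMap.fst ℝ ((ι → ℝ) × F) (Curve F)))) u :=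
      ((ContinuousLinearMap.proj (R := ℝ) (φ := fun _ : ι => ℝ) i).comp
        ((ContinuousLinearMap.fst ℝ (ι → ℝ) F).comp
          (ContinuousLinearMap.fst ℝ ((ι → ℝ) × F) (Curve F)))).hasFDerivAt
    have hb : HasFDerivAt (fun u : ((ι → ℝ) × F) × Curve F =>
        curvePrimitive F (curveComp (X i) (hX i).continuous u.2))
        ((curvePrimitive F).comp ((curveDeriv (X i) (hX i) u.2).comp
          (ContinuousLinearMap.snd ℝ ((ι → ℝ) × F) (Curve F)))) u :=
      (curvePrimitive F).hasFDerivAt.comp u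
        ((hasFDerivAt_curveComp_self (hX i) u.2).comp u hasFDerivAt_snd)
    exact ha.fun_smul hb
  have h := (hasFDerivAt_fst (𝕜 := ℝ) (p := u)).prodMk
    (((hasFDerivAt_snd (𝕜 := ℝ) (p := u)).sub h1).sub (HasFDerivAt.fun_sum h2))
  have h' : fderiv ℝ (flowMap hX) u = _ := h.fderiv
  rw [h']
  simp

/-- `t ↦ t Xᵢ(γ(t))` solves the linearized equation along an integral curve `γ` of
`∑ sⱼ Xⱼ` if the fields commute along `γ`. -/
theorem variation_integralCurve [CompleteSpace F] {s : ι → ℝ} {z : F} {γ : Curve F}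
    (hγ : γ - curveConst F z -
      ∑ j, s j • curvePrimitive F (curveComp (X j) (hX j).continuous γ) = 0) (i : ι)
    (hcomm : ∀ t j, fderiv ℝ (X i) (γ t) (X j (γ t)) = fderiv ℝ (X j) (γ t) (X i (γ t)))
    {w : Curve F} (hw : ∀ t : I, w t = (t : ℝ) • X i (γ t)) :
    w = curvePrimitive F (curveComp (X i) (hX i).continuous γ) +
      ∑ j, s j • curvePrimitive F (curveDeriv (X j) (hX j) γ w) := by
  set g : ℝ → F := Set.IccExtend zero_le_one γ with hg
  have hgc : Continuous g := γ.continuous.Icc_extend'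
  have hgI : ∀ t : I, g t = γ t := fun t => Set.IccExtend_val _ _ t
  -- The right side of the integral equation for `γ` is differentiable on all of `ℝ` and agrees with
  -- `γ` on `[0, 1]`; this avoids one-sided derivatives at the endpoints.
  let Γ : ℝ → F := fun t => z + ∑ j, s j • ∫ τ in (0 : ℝ)..t, X j (g τ)
  have hXg : ∀ j, Continuous fun τ => X j (g τ) := fun j => (hX j).continuous.comp hgc
  have hΓd : ∀ t, HasDerivAt Γ (∑ j, s j • X j (g t)) t := fun t => by
    refine HasDerivAt.const_add z (HasDerivAt.fun_sum fun j _ => HasDerivAt.const_smul _ ?_)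
    exact intervalIntegral.integral_hasDerivAt_right ((hXg j).intervalIntegrable _ _)
      ((hXg j).stronglyMeasurableAtFilter _ _) (hXg j).continuousAt
  have hΓg : ∀ t : I, Γ t = g t := fun t => by
    have h : (γ - curveConst F z -
        ∑ j, s j • curvePrimitive F (curveComp (X j) (hX j).continuous γ)) t =
        (0 : Curve F) t := by rw [hγ]
    simp only [Curve.sub_apply, Curve.zero_apply, sub_sub, sub_eq_zero] at h
    rw [hgI, h]
    simp only [Curve.add_apply, Curve.sum_apply, Curve.smul_apply, curvePrimitive_apply, curveConst_apply]
    rfl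
  refine Curve.ext fun t => ?_
  have hΓc : Continuous Γ := continuous_iff_continuousAt.mpr fun t => (hΓd t).continuousAt
  have hd : ∀ τ : ℝ, HasDerivAt (fun τ => τ • X i (Γ τ))
      (τ • fderiv ℝ (X i) (Γ τ) (∑ j, s j • X j (g τ)) + (1 : ℝ) • X i (Γ τ)) τ := fun τ =>
    (hasDerivAt_id τ).smul
      ((((hX i).differentiable (by simp) (Γ τ)).hasFDerivAt).comp_hasDerivAt τ (hΓd τ))
  have hint := intervalIntegral.integral_eq_sub_of_hasDerivAt (a := 0) (b := (t : ℝ))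
    (fun τ _ => hd τ) (Continuous.intervalIntegrable (by
      have h1 : Continuous fun τ => fderiv ℝ (X i) (Γ τ) :=
        ((hX i).continuous_fderiv (by simp)).comp hΓc
      have h2 : Continuous fun τ => ∑ j, s j • X j (g τ) :=
        continuous_finsetSum _ fun j _ => (hXg j).const_smul (s j)
      exact (continuous_id.smul (h1.clm_apply h2)).add
        ((((hX i).continuous).comp hΓc).const_smul (1 : ℝ))) _ _)
  have hwe : Continuous (Set.IccExtend zero_le_one w : ℝ → F) := w.continuous.Icc_extend'
  have hDc : ∀ j, Continuous fun τ => fderiv ℝ (X j) (g τ) (Set.IccExtend zero_le_one w τ) :=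
    fun j => (((hX j).continuous_fderiv (by simp)).comp hgc).clm_apply hwe
  -- Commutation exchanges `DXᵢ(Xⱼ)` for `DXⱼ(Xᵢ)`, turning the derivative of `τ Xᵢ(Γ τ)` into the
  -- right side of the linearized equation for `w`.
  have hrew : ∫ τ in (0 : ℝ)..t,
      (τ • fderiv ℝ (X i) (Γ τ) (∑ j, s j • X j (g τ)) + (1 : ℝ) • X i (Γ τ)) =
      ∫ τ in (0 : ℝ)..t, (X i (g τ) +
        ∑ j, s j • fderiv ℝ (X j) (g τ) (Set.IccExtend zero_le_one w τ)) := by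
    refine intervalIntegral.integral_congr fun τ hτ => ?_
    rw [Set.uIcc_of_le t.2.1] at hτ
    have hτI : τ ∈ I := ⟨hτ.1, hτ.2.trans t.2.2⟩
    have h1 : Γ τ = g τ := hΓg ⟨τ, hτI⟩
    have h2 : g τ = γ ⟨τ, hτI⟩ := hgI ⟨τ, hτI⟩
    have h3 : (Set.IccExtend zero_le_one w : ℝ → F) τ = τ • X i (g τ) := by
      rw [h2, ← hw ⟨τ, hτI⟩]; exact Set.IccExtend_val _ _ (⟨τ, hτI⟩ : I)
    simp only [h1, h3, map_sum, map_smul, one_smul, Finset.smul_sum]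
    rw [add_comm]
    congr 1
    refine Finset.sum_congr rfl fun j _ => ?_
    rw [h2, hcomm, smul_comm]
  have hsum : Continuous fun τ => ∑ j, s j • fderiv ℝ (X j) (g τ) (Set.IccExtend zero_le_one w τ) :=
    continuous_finsetSum _ fun j _ => (hDc j).const_smul (s j)
  rw [hrew, intervalIntegral.integral_add ((hXg i).intervalIntegrable _ _)
    (hsum.intervalIntegrable _ _),
    intervalIntegral.integral_finsetSum (f := fun j τ =>
        s j • fderiv ℝ (X j) (g τ) (Set.IccExtend zero_le_one w τ))
      (fun j _ => ((hDc j).const_smul (s j)).intervalIntegrable _ _)] at hint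
  simp only [intervalIntegral.integral_smul, zero_smul, sub_zero] at hint
  rw [hw t, ← hgI t, ← hΓg t, ← hint]
  simp only [Curve.add_apply, Curve.sum_apply, Curve.smul_apply, curvePrimitive_apply]
  rfl

/-- Commuting smooth vector fields `Xᵢ` have a smooth local joint flow `Φ(s, z)`, the time-one flow
of `∑ sᵢ Xᵢ` starting at `z`. -/
theorem exists_jointFlow [CompleteSpace F] [DecidableEq ι] {X : ι → F → F}
    (hX : ∀ i, ContDiff ℝ ∞ (X i)) {x₀ : F}
    (hcomm : ∀ᶠ x in 𝓝 x₀, ∀ i j, fderiv ℝ (X i) x (X j x) = fderiv ℝ (X j) x (X i x)) :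
    ∃ (Φ : (ι → ℝ) × F → F) (W : Set ((ι → ℝ) × F)), IsOpen W ∧ (0, x₀) ∈ W ∧
      ContDiffOn ℝ ∞ Φ W ∧ (∀ z, (0, z) ∈ W → Φ (0, z) = z) ∧
      ∀ u ∈ W, ∀ i, fderiv ℝ Φ u (Pi.single i 1, 0) = X i (Φ u) := by
  have hzero : ∀ z : F, flowMap hX ((0, z), curveConst F z) = ((0, z), 0) := fun z => by
    simp [flowMap]
  -- At `s = 0` the terms containing the derivatives of the `Xᵢ` drop out, and the differential is
  -- the shear `(v₁, v₂ - R v₁)`; its inverse is obtained by changing the sign of `R`.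
  have hinv : (fderiv ℝ (flowMap hX) ((0, x₀), curveConst F x₀)).IsInvertible := by
    let C := curveConst F
    let R : ((ι → ℝ) × F) →L[ℝ] Curve F := C.comp (ContinuousLinearMap.snd ℝ (ι → ℝ) F) +
      ∑ i, ((ContinuousLinearMap.proj (R := ℝ) (φ := fun _ : ι => ℝ) i).comp
        (ContinuousLinearMap.fst ℝ (ι → ℝ) F)).smulRight
          (curvePrimitive F (curveComp (X i) (hX i).continuous (C x₀)))
    let p := ContinuousLinearMap.fst ℝ ((ι → ℝ) × F) (Curve F)
    let q := ContinuousLinearMap.snd ℝ ((ι → ℝ) × F) (Curve F)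
    refine ⟨ContinuousLinearEquiv.equivOfInverse (p.prod (q - R.comp p)) (p.prod (q + R.comp p))
      (fun v => Prod.ext rfl (by simp [p, q])) (fun v => Prod.ext rfl (by simp [p, q])), ?_⟩
    refine ContinuousLinearMap.ext fun v => ?_
    rw [fderiv_flowMap]
    refine Prod.ext rfl ?_
    simp [p, q, R, C, sub_sub]
  obtain ⟨e, hae, -, hef, hes, hei⟩ := exists_smooth_openPartialHomeomorph isOpen_univ
    (contDiff_flowMap hX).contDiffOn (Set.mem_univ ((0, x₀), curveConst F x₀)) hinv
  let inc : (ι → ℝ) × F → ((ι → ℝ) × F) × Curve F := fun u => (u, 0)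
  have hinc : ContDiff ℝ ∞ inc := contDiff_id.prodMk contDiff_const
  let ψ : (ι → ℝ) × F → Curve F := fun u => (e.symm (inc u)).2
  let W₀ := inc ⁻¹' e.target
  have hW₀ : IsOpen W₀ := e.open_target.preimage hinc.continuous
  have hψ : ContDiffOn ℝ ∞ ψ W₀ :=
    contDiff_snd.comp_contDiffOn (hes.comp hinc.contDiffOn fun u hu => hu)
  have he0 : ∀ z : F, ((0, z), curveConst F z) ∈ e.source →
      inc (0, z) ∈ e.target ∧ e.symm (inc (0, z)) = ((0, z), curveConst F z) := fun z hz => by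
    have h : e ((0, z), curveConst F z) = inc (0, z) := by rw [hef, hzero]
    exact ⟨h ▸ e.map_source hz, by rw [← h]; exact e.left_inv hz⟩
  have hx₀ : (0, x₀) ∈ W₀ := (he0 x₀ hae).1
  have hψ₀ : ψ (0, x₀) = curveConst F x₀ := congrArg Prod.snd (he0 x₀ hae).2
  have hsol : ∀ u ∈ W₀, e.symm (inc u) = (u, ψ u) ∧ ψ u - curveConst F u.2 -
      ∑ j, u.1 j • curvePrimitive F (curveComp (X j) (hX j).continuous (ψ u)) = 0 := fun u hu => by
    have h : flowMap hX (e.symm (inc u)) = inc u := by rw [← hef]; exact e.right_inv hu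
    have h1 : (e.symm (inc u)).1 = u := congrArg Prod.fst h
    have h2 : e.symm (inc u) = (u, ψ u) := Prod.ext h1 rfl
    rw [h2] at h
    exact ⟨h2, congrArg Prod.snd h⟩
  obtain ⟨r, hr, hball⟩ := Metric.eventually_nhds_iff.mp hcomm
  -- Integral curves uniformly close to the constant curve at `x₀` stay in the ball on which the
  -- fields commute.
  let W₁ := W₀ ∩ ψ ⁻¹' Metric.ball (curveConst F x₀) r
  have hW₁ : IsOpen W₁ := hψ.continuousOn.isOpen_inter_preimage hW₀ Metric.isOpen_ball
  -- Here the constant curve at `z` lies in the domain of the local inverse, so it is the solution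
  -- selected at `s = 0`.
  let W₂ : Set ((ι → ℝ) × F) := (fun u => (u, curveConst F u.2)) ⁻¹' e.source
  have hW₂ : IsOpen W₂ := e.open_source.preimage
    (continuous_id.prodMk ((curveConst F).continuous.comp continuous_snd))
  refine ⟨fun u => Curve.eval 1 (ψ u), W₁ ∩ W₂, hW₁.inter hW₂, ⟨⟨hx₀, ?_⟩, hae⟩, ?_, ?_, ?_⟩
  · change ψ (0, x₀) ∈ Metric.ball (curveConst F x₀) r
    rw [hψ₀]; exact Metric.mem_ball_self hr
  · exact (Curve.eval 1).contDiff.comp_contDiffOn (hψ.mono fun u hu => hu.1.1)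
  · intro z hz
    have h : ψ (0, z) = curveConst F z := congrArg Prod.snd (he0 z hz.2).2
    change Curve.eval 1 (ψ (0, z)) = z
    rw [h]; rfl
  · rintro u ⟨⟨hu, hur⟩, -⟩ i
    have hsd : DifferentiableAt ℝ e.symm (inc u) :=
      (hes.contDiffAt (e.open_target.mem_nhds hu)).differentiableAt (by simp)
    have hHd : DifferentiableAt ℝ (flowMap hX) (e.symm (inc u)) :=
      (contDiff_flowMap hX).differentiable (by simp) _
    have hid : (fderiv ℝ (flowMap hX) (e.symm (inc u))).comp (fderiv ℝ e.symm (inc u)) =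
        ContinuousLinearMap.id ℝ _ := by
      rw [← fderiv_comp _ hHd hsd]
      have : flowMap hX ∘ e.symm =ᶠ[𝓝 (inc u)] id := by
        filter_upwards [e.open_target.mem_nhds hu] with v hv
        change flowMap hX (e.symm v) = v
        rw [← hef]; exact e.right_inv hv
      rw [this.fderiv_eq, fderiv_id]
    have hnear : ∀ t, dist (ψ u t) x₀ < r := fun t => by
      rw [dist_eq_norm]
      refine lt_of_le_of_lt ((ψ u - curveConst F x₀).norm_apply_le t) ?_
      rw [← dist_eq_norm]; exact hur
    let w : Curve F := Curve.mk (fun t => (t : ℝ) • X i (ψ u t))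
      (continuous_subtype_val.smul ((hX i).continuous.comp (ψ u).continuous))
    have hw := variation_integralCurve hX (hsol u hu).2 i (fun t j => hball (hnear t) i j)
      (w := w) (fun t => rfl)
    -- Implicit differentiation: as the differential of `flowMap` is injective, this identifies the
    -- derivative of the solution curve in the direction `sᵢ` with `w(t) = t Xᵢ(ψ u t)`. At time one
    -- it is `Xᵢ`.
    have hval : fderiv ℝ (flowMap hX) (e.symm (inc u)) ((Pi.single i 1, 0), w) =
        ((Pi.single i 1, 0), 0) := by
      rw [(hsol u hu).1, fderiv_flowMap]
      refine Prod.ext rfl ?_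
      simp only [map_zero, sub_zero, Finset.sum_add_distrib]
      rw [sub_eq_zero]
      refine hw.trans ?_
      rw [add_comm]
      congr 1
      simp [Pi.single_apply]
    have hinj : Function.Injective (fderiv ℝ (flowMap hX) (e.symm (inc u))) := by
      obtain ⟨g, hg⟩ := hei _ (e.map_target hu)
      rw [← hg]; exact g.injective
    have hkey : fderiv ℝ e.symm (inc u) ((Pi.single i 1, 0), 0) = ((Pi.single i 1, 0), w) := by
      apply hinj
      rw [hval]
      exact congrArg (fun A => A ((Pi.single i 1, 0), (0 : Curve F))) hid
    have hincd : HasFDerivAt inc (ContinuousLinearMap.inl ℝ ((ι → ℝ) × F) (Curve F)) u :=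
      (ContinuousLinearMap.inl ℝ ((ι → ℝ) × F) (Curve F)).hasFDerivAt
    have hΦd := ((Curve.eval (F := F) 1).hasFDerivAt.comp (inc u)
      (hasFDerivAt_snd.comp (inc u) hsd.hasFDerivAt)).comp u hincd
    have hΦd' : fderiv ℝ (fun u => Curve.eval 1 (ψ u)) u = _ := hΦd.fderiv
    rw [hΦd']
    simp only [ContinuousLinearMap.comp_apply, ContinuousLinearMap.inl_apply]
    rw [hkey]
    change (1 : ℝ) • X i (ψ u 1) = X i (ψ u 1)
    rw [one_smul]

/-- Commuting smooth vector fields can be straightened simultaneously, with a prescribed affine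
transversal `x₀ + J g`. -/
theorem exists_straightening [FiniteDimensional ℝ F] [DecidableEq ι] {X : ι → F → F}
    (hX : ∀ i, ContDiff ℝ ∞ (X i)) {x₀ : F}
    (hcomm : ∀ᶠ x in 𝓝 x₀, ∀ i j, fderiv ℝ (X i) x (X j x) = fderiv ℝ (X j) x (X i x))
    {G : Type*} [NormedAddCommGroup G] [NormedSpace ℝ G] [FiniteDimensional ℝ G] (J : G →L[ℝ] F)
    (hJ : Function.Bijective fun u : (ι → ℝ) × G => ∑ i, u.1 i • X i x₀ + J u.2) :
    ∃ (Θ : F → (ι → ℝ) × G) (Ψ : (ι → ℝ) × G → F), ContDiff ℝ ∞ Θ ∧ ContDiff ℝ ∞ Ψ ∧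
      Θ x₀ = 0 ∧ (∀ᶠ x in 𝓝 x₀, Ψ (Θ x) = x) ∧ (∀ᶠ u in 𝓝 0, Θ (Ψ u) = u) ∧
      (∀ᶠ x in 𝓝 x₀, ∀ i, fderiv ℝ Θ x (X i x) = (Pi.single i 1, 0)) ∧
      (∀ᶠ u in 𝓝 0, ∀ i, fderiv ℝ Ψ u (Pi.single i 1, 0) = X i (Ψ u)) ∧
      (∀ᶠ g in 𝓝 0, Ψ (0, g) = x₀ + J g) := by
  have : CompleteSpace F := FiniteDimensional.complete ℝ F
  have : CompleteSpace G := FiniteDimensional.complete ℝ G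
  obtain ⟨Φ, W, hW, hxW, hΦ, hΦ0, hΦX⟩ := exists_jointFlow hX hcomm
  -- The straightening coordinates `(s, g)` describe the point reached from `x₀ + J g` on the
  -- transversal by the joint flow with times `s`.
  let S : (ι → ℝ) × G → (ι → ℝ) × F := fun u => (u.1, x₀ + J u.2)
  have hS : ContDiff ℝ ∞ S :=
    contDiff_fst.prodMk (contDiff_const.add (J.contDiff.comp contDiff_snd))
  have hS' : ∀ u, HasFDerivAt S ((ContinuousLinearMap.fst ℝ (ι → ℝ) G).prod
      (J.comp (ContinuousLinearMap.snd ℝ (ι → ℝ) G))) u := fun u =>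
    hasFDerivAt_fst.prodMk ((J.hasFDerivAt.comp u hasFDerivAt_snd).const_add x₀)
  have hS0 : S 0 = (0, x₀) := by simp [S]
  have hVo : IsOpen (S ⁻¹' W) := hW.preimage hS.continuous
  have h0V : (0 : (ι → ℝ) × G) ∈ S ⁻¹' W := by change S 0 ∈ W; rw [hS0]; exact hxW
  have hΦS : ContDiffOn ℝ ∞ (Φ ∘ S) (S ⁻¹' W) := hΦ.comp hS.contDiffOn fun u hu => hu
  have hΦd : ∀ u ∈ S ⁻¹' W, ∀ i, fderiv ℝ (Φ ∘ S) u (Pi.single i 1, 0) = X i (Φ (S u)) := by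
    intro u hu i
    have h1 : DifferentiableAt ℝ Φ (S u) :=
      (hΦ.contDiffAt (hW.mem_nhds hu)).differentiableAt (by simp)
    rw [(h1.hasFDerivAt.comp u (hS' u)).fderiv, ← hΦX (S u) hu i]
    simp
  have hΦg : ∀ g, fderiv ℝ (Φ ∘ S) 0 (0, g) = J g := by
    intro g
    have h1 : DifferentiableAt ℝ (Φ ∘ S) 0 :=
      (hΦS.contDiffAt (hVo.mem_nhds h0V)).differentiableAt (by simp)
    have h2 : HasFDerivAt (fun g : G => (Φ ∘ S) (0, g)) ((fderiv ℝ (Φ ∘ S) 0).comp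
        (ContinuousLinearMap.inr ℝ (ι → ℝ) G)) 0 :=
      HasFDerivAt.comp (0 : G) (g := Φ ∘ S) h1.hasFDerivAt
        (ContinuousLinearMap.inr ℝ (ι → ℝ) G).hasFDerivAt
    have h3 : HasFDerivAt (fun g : G => (Φ ∘ S) (0, g)) J 0 := by
      have h4 : HasFDerivAt (fun g : G => x₀ + J g) J 0 := J.hasFDerivAt.const_add x₀
      refine h4.congr_of_eventuallyEq ?_
      have hc : ContinuousAt (fun g : G => ((0, g) : (ι → ℝ) × G)) 0 := by fun_prop
      filter_upwards [hc.preimage_mem_nhds (hVo.mem_nhds h0V)] with g hg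
      exact hΦ0 _ hg
    exact congrArg (fun A => A g) (h2.unique h3)
  have hinv : (fderiv ℝ (Φ ∘ S) 0).IsInvertible := by
    have hΨ : ∀ u : (ι → ℝ) × G, fderiv ℝ (Φ ∘ S) 0 u = ∑ i, u.1 i • X i x₀ + J u.2 := by
      rintro ⟨s, g⟩
      have h1 : ((s, g) : (ι → ℝ) × G) =
          ∑ i, s i • ((Pi.single i 1, 0) : (ι → ℝ) × G) + (0, g) := by
        refine Prod.ext ?_ ?_
        · funext j; simp [Prod.fst_sum, Finset.sum_apply, Pi.single_apply]
        · simp [Prod.snd_sum]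
      rw [h1, map_add, map_sum, hΦg]
      simp only [map_smul, hΦd 0 h0V]
      have h2 : Φ (S 0) = x₀ := by rw [hS0]; exact hΦ0 _ hxW
      rw [h2, ← h1]
    let A : ((ι → ℝ) × G) ≃ₗ[ℝ] F := LinearEquiv.ofBijective (fderiv ℝ (Φ ∘ S) 0).toLinearMap (by
      have : ⇑(fderiv ℝ (Φ ∘ S) 0).toLinearMap =
        fun u : (ι → ℝ) × G => ∑ i, u.1 i • X i x₀ + J u.2 := funext hΨ
      rw [this]; exact hJ)
    exact ⟨A.toContinuousLinearEquiv, rfl⟩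
  obtain ⟨e, h0e, heV, hef, hes, hei⟩ :=
    exists_smooth_openPartialHomeomorph hVo hΦS h0V hinv
  have hΦS0 : Φ (S 0) = x₀ := by rw [hS0]; exact hΦ0 _ hxW
  have he0 : e 0 = x₀ := by rw [hef]; exact hΦS0
  have hxt : x₀ ∈ e.target := he0 ▸ e.map_source h0e
  have hes0 : e.symm x₀ = 0 := by rw [← he0]; exact e.left_inv h0e
  -- Both coordinate maps are replaced by globally smooth maps with the same germs, so that all
  -- remaining properties hold only eventually near the base points.
  obtain ⟨Θ, hΘ, hΘe⟩ := exists_contDiff_eventuallyEq e.open_target hes hxt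
  obtain ⟨Ψ, hΨ, hΨe⟩ := exists_contDiff_eventuallyEq hVo hΦS h0V
  have hΘ0 : Θ x₀ = 0 := by rw [hΘe.self_of_nhds, hes0]
  have hΨ0 : Ψ 0 = x₀ := by rw [hΨe.self_of_nhds]; exact hΦS0
  refine ⟨Θ, Ψ, hΘ, hΨ, hΘ0, ?_, ?_, ?_, ?_, ?_⟩
  · have hc : Filter.Tendsto Θ (𝓝 x₀) (𝓝 0) := hΘ0 ▸ hΘ.continuous.tendsto x₀
    filter_upwards [hΘe, hc.eventually hΨe, e.open_target.mem_nhds hxt] with x h1 h2 h3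
    rw [h2, h1, ← hef]; exact e.right_inv h3
  · have hc : Filter.Tendsto Ψ (𝓝 0) (𝓝 x₀) := hΨ0 ▸ hΨ.continuous.tendsto 0
    filter_upwards [hΨe, hc.eventually hΘe, e.open_source.mem_nhds h0e] with u h1 h2 h3
    rw [h2, h1, ← hef]; exact e.left_inv h3
  · filter_upwards [hΘe.eventuallyEq_nhds, e.open_target.mem_nhds hxt] with x h1 h2 i
    rw [h1.fderiv_eq]
    have hu := e.map_target h2
    have hd : DifferentiableAt ℝ (Φ ∘ S) (e.symm x) :=
      (hΦS.contDiffAt (hVo.mem_nhds (heV hu))).differentiableAt (by simp)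
    have hds : DifferentiableAt ℝ e.symm x :=
      (hes.contDiffAt (e.open_target.mem_nhds h2)).differentiableAt (by simp)
    have hxe : (Φ ∘ S) (e.symm x) = x := by rw [← hef]; exact e.right_inv h2
    have hXi : X i x = fderiv ℝ (Φ ∘ S) (e.symm x) (Pi.single i 1, 0) := by
      rw [hΦd _ (heV hu) i]; exact congrArg (X i) hxe.symm
    have hid : (fderiv ℝ e.symm x).comp (fderiv ℝ (Φ ∘ S) (e.symm x)) =
        ContinuousLinearMap.id ℝ _ := by
      have h3 : e.symm ∘ (Φ ∘ S) =ᶠ[𝓝 (e.symm x)] id := by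
        filter_upwards [e.open_source.mem_nhds hu] with v hv
        change e.symm ((Φ ∘ S) v) = v
        rw [← hef]; exact e.left_inv hv
      rw [← fderiv_id (𝕜 := ℝ) (x := e.symm x), ← h3.fderiv_eq,
        fderiv_comp (e.symm x) (by rw [hxe]; exact hds) hd, hxe]
    rw [hXi]
    exact congrArg (fun A => A (Pi.single i 1, 0)) hid
  · filter_upwards [hΨe.eventuallyEq_nhds, hVo.mem_nhds h0V] with u h1 h2 i
    rw [h1.fderiv_eq, hΦd u h2, h1.self_of_nhds]
    rfl
  · have hc : Filter.Tendsto (fun g : G => ((0, g) : (ι → ℝ) × G)) (𝓝 0) (𝓝 0) := by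
      have : Continuous (fun g : G => ((0, g) : (ι → ℝ) × G)) := by fun_prop
      exact this.tendsto 0
    filter_upwards [hc.eventually hΨe, hc.eventually (hVo.mem_nhds h0V)] with g h1 h2
    rw [h1]; exact hΦ0 _ h2

end Flow

/-! ## Poisson bivectors on a vector space -/

section LocalPoisson

variable {F : Type*} [NormedAddCommGroup F] [NormedSpace ℝ F]

/-- `S` is the sharp map of a bivector field on `F` which is Poisson near `x₀`. -/
structure IsPoissonNear (S : F → (F →L[ℝ] ℝ) →L[ℝ] F) (x₀ : F) : Prop where
  smooth : ContDiff ℝ ∞ S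
  skew : ∀ᶠ x in 𝓝 x₀, ∀ ξ η : F →L[ℝ] ℝ, η (S x ξ) = -ξ (S x η)
  jacobi : ∀ᶠ x in 𝓝 x₀, ∀ ξ η ζ : F →L[ℝ] ℝ, ζ (fderiv ℝ S x (S x ξ) η) +
    ξ (fderiv ℝ S x (S x η) ζ) + η (fderiv ℝ S x (S x ζ) ξ) = 0

/-- The Hamiltonian vector field `♯ df`. -/
def hamVec (S : F → (F →L[ℝ] ℝ) →L[ℝ] F) (f : F → ℝ) (x : F) : F := S x (fderiv ℝ f x)

variable {S : F → (F →L[ℝ] ℝ) →L[ℝ] F} {x₀ : F} {f g h : F → ℝ}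

theorem IsPoissonNear.eventually (hS : IsPoissonNear S x₀) : ∀ᶠ x in 𝓝 x₀, IsPoissonNear S x := by
  filter_upwards [hS.skew.eventually_nhds, hS.jacobi.eventually_nhds] with x h1 h2
  exact ⟨hS.smooth, h1, h2⟩

theorem IsPoissonNear.skew_fderiv (hS : IsPoissonNear S x₀) (v : F) (ξ η : F →L[ℝ] ℝ) :
    η (fderiv ℝ S x₀ v ξ) = -ξ (fderiv ℝ S x₀ v η) := by
  have hd : ∀ ξ η : F →L[ℝ] ℝ, HasFDerivAt (fun x => η (S x ξ))
      (η.comp ((fderiv ℝ S x₀).flip ξ)) x₀ := fun ξ η => by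
    have h1 := ((hS.smooth.differentiable (by simp) x₀).hasFDerivAt).clm_apply
      (hasFDerivAt_const ξ x₀)
    have h2 := η.hasFDerivAt.comp x₀ h1
    refine h2.congr_fderiv ?_
    ext v
    simp
  have h1 : (fun x => η (S x ξ)) =ᶠ[𝓝 x₀] fun x => -ξ (S x η) := by
    filter_upwards [hS.skew] with x hx using hx ξ η
  exact congrArg (fun A => A v) (((hd ξ η).congr_of_eventuallyEq h1.symm).unique (hd η ξ).neg)

theorem contDiff_hamVec (hS : ContDiff ℝ ∞ S) (hf : ContDiff ℝ ∞ f) :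
    ContDiff ℝ ∞ (hamVec S f) :=
  hS.clm_apply (hf.fderiv_right (by simp))

theorem fderiv_hamVec (hS : ContDiff ℝ ∞ S) (hf : ContDiff ℝ ∞ f) (x v : F) :
    fderiv ℝ (hamVec S f) x v =
      fderiv ℝ S x v (fderiv ℝ f x) + S x (fderiv ℝ (fderiv ℝ f) x v) := by
  have hf' : ContDiff ℝ ∞ (fderiv ℝ f) := hf.fderiv_right (by simp)
  have h := ((hS.differentiable (by simp) x).hasFDerivAt).clm_apply
    ((hf'.differentiable (by simp) x).hasFDerivAt)
  have h' : fderiv ℝ (hamVec S f) x = _ := h.fderiv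
  rw [h']
  simp [add_comm]

theorem fderiv_fderiv_symm (hf : ContDiff ℝ ∞ f) (x v w : F) :
    fderiv ℝ (fderiv ℝ f) x v w = fderiv ℝ (fderiv ℝ f) x w v :=
  (hf.contDiffAt.isSymmSndFDerivAt (by
    simp only [minSmoothness_of_isRCLikeNormedField]
    exact WithTop.coe_le_coe.mpr (le_top : (2 : ℕ∞) ≤ ⊤))) v w

theorem hasFDerivAt_apply_vec {X : F → F} (hf : ContDiff ℝ ∞ f) (hX : ContDiff ℝ ∞ X) (x : F) :
    HasFDerivAt (fun x => fderiv ℝ f x (X x))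
      ((fderiv ℝ f x).comp (fderiv ℝ X x) + (fderiv ℝ (fderiv ℝ f) x).flip (X x)) x := by
  have hf' : ContDiff ℝ ∞ (fderiv ℝ f) := hf.fderiv_right (by simp)
  exact ((hf'.differentiable (by simp) x).hasFDerivAt).clm_apply
    ((hX.differentiable (by simp) x).hasFDerivAt)

/-- `[X_f, X_g] = X_{{f,g}}` for a Poisson bivector. -/
theorem IsPoissonNear.lieBracket_hamVec (hS : IsPoissonNear S x₀) (hf : ContDiff ℝ ∞ f)
    (hg : ContDiff ℝ ∞ g) :
    fderiv ℝ (hamVec S g) x₀ (hamVec S f x₀) - fderiv ℝ (hamVec S f) x₀ (hamVec S g x₀) =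
      hamVec S (fun x => fderiv ℝ g x (hamVec S f x)) x₀ := by
  have hsk := hS.skew.self_of_nhds
  -- Paired with `ζ`, the first-order terms are the Jacobi identity for `df`, `dg`, `ζ`; the second
  -- derivatives of `f` and `g` match by skewness of the bivector and symmetry of the Hessians.
  refine (SeparatingDual.eq_iff_forall_dual_eq (R := ℝ)).mpr fun ζ => ?_
  have h1 := hS.jacobi.self_of_nhds (fderiv ℝ f x₀) (fderiv ℝ g x₀) ζ
  have h2 := hS.skew_fderiv (S x₀ (fderiv ℝ g x₀)) (fderiv ℝ f x₀) ζ
  have h3 := (hasFDerivAt_apply_vec hg (contDiff_hamVec hS.smooth hf) x₀).fderiv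
  have h4 := hsk (fderiv ℝ (fderiv ℝ g) x₀ (hamVec S f x₀)) ζ
  have h5 := hsk (fderiv ℝ (fderiv ℝ f) x₀ (hamVec S g x₀)) ζ
  have h6 := hsk (fderiv ℝ (fderiv ℝ f) x₀ (S x₀ ζ)) (fderiv ℝ g x₀)
  have h7 := fderiv_fderiv_symm hg x₀ (hamVec S f x₀) (S x₀ ζ)
  have h8 := fderiv_fderiv_symm hf x₀ (hamVec S g x₀) (S x₀ ζ)
  have h9 := hsk (fderiv ℝ (fun x => fderiv ℝ g x (hamVec S f x)) x₀) ζ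
  rw [h3] at h9
  simp only [add_apply, ContinuousLinearMap.comp_apply,
    ContinuousLinearMap.flip_apply, fderiv_hamVec hS.smooth hf, map_add] at h9
  rw [map_sub, fderiv_hamVec hS.smooth hf, fderiv_hamVec hS.smooth hg, map_add, map_add]
  change _ = ζ (S x₀ (fderiv ℝ (fun x => fderiv ℝ g x (hamVec S f x)) x₀))
  rw [h3, map_add, map_add, h9]
  simp only [hamVec] at *
  linarith

/-- Hamiltonian vector fields of functions with constant bracket commute. -/
theorem IsPoissonNear.hamVec_comm (hS : IsPoissonNear S x₀) (hf : ContDiff ℝ ∞ f)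
    (hg : ContDiff ℝ ∞ g) {c : ℝ} (h : ∀ᶠ x in 𝓝 x₀, fderiv ℝ g x (hamVec S f x) = c) :
    fderiv ℝ (hamVec S g) x₀ (hamVec S f x₀) = fderiv ℝ (hamVec S f) x₀ (hamVec S g x₀) := by
  rw [← sub_eq_zero, hS.lieBracket_hamVec hf hg]
  have h1 : (fun x => fderiv ℝ g x (hamVec S f x)) =ᶠ[𝓝 x₀] fun _ => c := h
  rw [hamVec, h1.fderiv_eq]
  simp

theorem IsPoissonNear.bracket_skew (hS : IsPoissonNear S x₀) :
    fderiv ℝ g x₀ (hamVec S f x₀) = -fderiv ℝ f x₀ (hamVec S g x₀) :=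
  hS.skew.self_of_nhds _ _

theorem IsPoissonNear.bracket_self (hS : IsPoissonNear S x₀) :
    fderiv ℝ f x₀ (hamVec S f x₀) = 0 := by
  have := hS.bracket_skew (f := f) (g := f)
  linarith

/-- If `{q, f}` and `{q, g}` are constant then `{q, {f, g}} = 0`. -/
theorem IsPoissonNear.bracket_bracket_eq_zero {q : F → ℝ} (hS : IsPoissonNear S x₀)
    (hq : ContDiff ℝ ∞ q) (hf : ContDiff ℝ ∞ f) (hg : ContDiff ℝ ∞ g) {c d : ℝ}
    (hqf : ∀ᶠ x in 𝓝 x₀, fderiv ℝ f x (hamVec S q x) = c)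
    (hqg : ∀ᶠ x in 𝓝 x₀, fderiv ℝ g x (hamVec S q x) = d) :
    fderiv ℝ (fun x => fderiv ℝ g x (hamVec S f x)) x₀ (hamVec S q x₀) = 0 := by
  have h1 : (fun x => fderiv ℝ g x (hamVec S q x)) =ᶠ[𝓝 x₀] fun _ => d := hqg
  have h2 := h1.fderiv_eq (𝕜 := ℝ)
  rw [(hasFDerivAt_apply_vec hg (contDiff_hamVec hS.smooth hq) x₀).fderiv] at h2
  -- The derivative along `X_f` of the constant `{q, g}` vanishes. Since `X_q` and `X_f` commute and
  -- the Hessian of `g` is symmetric, it equals the derivative of `{f, g}` along `X_q`.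
  have h3 := congrArg (fun A => A (hamVec S f x₀)) h2
  rw [(hasFDerivAt_apply_vec hg (contDiff_hamVec hS.smooth hf) x₀).fderiv]
  simp only [add_apply, ContinuousLinearMap.comp_apply,
    ContinuousLinearMap.flip_apply, fderiv_fun_const] at h3 ⊢
  rw [hS.hamVec_comm hq hf hqf, fderiv_fderiv_symm hg]
  simpa using h3

end LocalPoisson

/-! ## Canonical coordinates along a coisotropic subspace -/

section Canonical

/-- A function whose partial derivatives in the first variables vanish near the origin does not
depend on them near the origin. -/
theorem eventually_eq_of_fderiv_single_eq_zero {ι : Type*} [Fintype ι] [DecidableEq ι]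
    {G Y : Type*} [NormedAddCommGroup G] [NormedSpace ℝ G] [NormedAddCommGroup Y]
    [NormedSpace ℝ Y] {f : (ι → ℝ) × G → Y} (hf : ContDiff ℝ ∞ f)
    (h : ∀ᶠ u in 𝓝 (0 : (ι → ℝ) × G), ∀ i, fderiv ℝ f u (Pi.single i 1, 0) = 0) :
    ∀ᶠ u in 𝓝 (0 : (ι → ℝ) × G), f u = f (0, u.2) := by
  obtain ⟨r, hr, hball⟩ := Metric.eventually_nhds_iff_ball.mp h
  filter_upwards [Metric.ball_mem_nhds _ hr] with u hu
  -- In the supremum norm the ball is a product of balls, so the slice through `u` in the first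
  -- variables is convex and contains `(0, u.2)`.
  have hu' : ‖u.1‖ < r ∧ ‖u.2‖ < r := by
    rw [mem_ball_zero_iff, Prod.norm_def, max_lt_iff] at hu; exact hu
  let φ : (ι → ℝ) → Y := fun s => f (s, u.2)
  have hd : ∀ s, HasFDerivAt φ ((fderiv ℝ f (s, u.2)).comp (ContinuousLinearMap.inl ℝ (ι → ℝ) G))
      s := fun s => by
    have h1 : HasFDerivAt (fun s : ι → ℝ => (s, u.2)) (ContinuousLinearMap.inl ℝ (ι → ℝ) G) s :=
      hasFDerivAt_prodMk_left s u.2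
    exact ((hf.differentiable (by simp) (s, u.2)).hasFDerivAt).comp s h1
  have := Metric.isOpen_ball.is_const_of_fderiv_eq_zero (𝕜 := ℝ) (f := φ)
    (convex_ball (0 : ι → ℝ) r).isPreconnected
    (fun s _ => (hd s).differentiableAt.differentiableWithinAt) (fun s hs => by
      rw [(hd s).fderiv]
      have hmem : (s, u.2) ∈ Metric.ball (0 : (ι → ℝ) × G) r := by
        rw [mem_ball_zero_iff, Prod.norm_def, max_lt_iff]
        exact ⟨by simpa using hs, hu'.2⟩
      refine ContinuousLinearMap.coe_injective (LinearMap.pi_ext' fun i => LinearMap.ext_ring ?_)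
      exact hball _ hmem i) (x := u.1) (y := 0) (by simpa using hu'.1) (Metric.mem_ball_self hr)
  exact this

/-- A function constant along straightened vector fields is determined by its values on the
transversal. -/
theorem eventually_eq_on_transversal {ι : Type*} [Fintype ι] [DecidableEq ι]
    {F G Y : Type*} [NormedAddCommGroup F] [NormedSpace ℝ F] [NormedAddCommGroup G]
    [NormedSpace ℝ G] [NormedAddCommGroup Y] [NormedSpace ℝ Y] {X : ι → F → F} {x₀ : F}
    {Θ : F → (ι → ℝ) × G} {Ψ : (ι → ℝ) × G → F} (hΘ : ContDiff ℝ ∞ Θ) (hΨ : ContDiff ℝ ∞ Ψ)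
    (hΘ0 : Θ x₀ = 0) (hΨΘ : ∀ᶠ x in 𝓝 x₀, Ψ (Θ x) = x)
    (hΨX : ∀ᶠ u in 𝓝 0, ∀ i, fderiv ℝ Ψ u (Pi.single i 1, 0) = X i (Ψ u))
    {h : F → Y} (hh : ContDiff ℝ ∞ h) (hX : ∀ᶠ x in 𝓝 x₀, ∀ i, fderiv ℝ h x (X i x) = 0) :
    ∀ᶠ x in 𝓝 x₀, h x = h (Ψ (0, (Θ x).2)) := by
  have hΨ0 : Ψ 0 = x₀ := by rw [← hΘ0]; exact hΨΘ.self_of_nhds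
  have hc : Filter.Tendsto Θ (𝓝 x₀) (𝓝 0) := hΘ0 ▸ hΘ.continuous.tendsto x₀
  have hc' : Filter.Tendsto Ψ (𝓝 0) (𝓝 x₀) := hΨ0 ▸ hΨ.continuous.tendsto 0
  have h1 : ∀ᶠ u in 𝓝 (0 : (ι → ℝ) × G), ∀ i, fderiv ℝ (h ∘ Ψ) u (Pi.single i 1, 0) = 0 := by
    filter_upwards [hΨX, hc'.eventually hX] with u h1 h2 i
    rw [fderiv_comp u (hh.differentiable (by simp) _) (hΨ.differentiable (by simp) _)]
    change fderiv ℝ h (Ψ u) (fderiv ℝ Ψ u (Pi.single i 1, 0)) = 0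
    rw [h1, h2]
  filter_upwards [hΨΘ, hc.eventually (eventually_eq_of_fderiv_single_eq_zero (hh.comp hΨ) h1)]
    with x h2 h3
  change h (Ψ (Θ x)) = h (Ψ (0, (Θ x).2)) at h3
  rwa [h2] at h3

variable {F : Type*} [NormedAddCommGroup F] [NormedSpace ℝ F] [FiniteDimensional ℝ F]
  {S : F → (F →L[ℝ] ℝ) →L[ℝ] F} {x₀ : F} {k : ℕ}

theorem sum_smul_apply_single {ι Y : Type*} [Fintype ι] [DecidableEq ι] [AddCommGroup Y]
    [Module ℝ Y] {v : ι → Y} (f : Y →ₗ[ℝ] (ι → ℝ)) (h : ∀ i, f (v i) = Pi.single i 1)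
    (s : ι → ℝ) : f (∑ i, s i • v i) = s := by
  rw [map_sum]
  funext j
  simp [h, Finset.sum_apply, Pi.single_apply]

/-- Given commuting functions whose Hamiltonian vectors are independent modulo `ker T`, there is a
covector vanishing on these vectors whose sharp has prescribed image under `T`. -/
theorem exists_covector {T : F →L[ℝ] (Fin k → ℝ)}
    (hskew : ∀ ξ η : F →L[ℝ] ℝ, η (S x₀ ξ) = -ξ (S x₀ η))
    (hco : ∀ κ : (Fin k → ℝ) →L[ℝ] ℝ, T (S x₀ (κ.comp T)) = 0)
    (hinj : ∀ κ : (Fin k → ℝ) →L[ℝ] ℝ, S x₀ (κ.comp T) = 0 → κ = 0)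
    {p : Fin k → Prop} [DecidablePred p] {v : {i // p i} → F}
    (hv : ∀ i, T (v i) = Pi.single i.1 1) (c : Fin k → ℝ) :
    ∃ ξ : F →L[ℝ] ℝ, (∀ i, ξ (v i) = 0) ∧ T (S x₀ ξ) = c := by
  let Λ : (F →L[ℝ] ℝ) →ₗ[ℝ] ({i // p i} → ℝ) × (Fin k → ℝ) :=
    (LinearMap.pi fun i => (ContinuousLinearMap.apply ℝ ℝ (v i)).toLinearMap).prod
      (T.comp (S x₀)).toLinearMap
  have hsurj : LinearMap.range Λ = ⊤ := by
    -- A functional `(s, κ)` vanishing on the range says, by skewness, that `∑ sᵢ vᵢ = ♯(κ ∘ T)`.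
    -- Applying `T` kills the right side by `hco` and gives `s = 0`; then `hinj` gives `κ = 0`.
    by_contra hne
    obtain ⟨f, hf, hle⟩ := Submodule.exists_le_ker_of_lt_top _ (lt_top_iff_ne_top.mpr hne)
    let s : {i // p i} → ℝ := fun i => f (Pi.single i 1, 0)
    let κ : (Fin k → ℝ) →L[ℝ] ℝ :=
      LinearMap.toContinuousLinearMap (f ∘ₗ LinearMap.inr ℝ ({i // p i} → ℝ) (Fin k → ℝ))
    have hfs : ∀ u : ({i // p i} → ℝ) × (Fin k → ℝ), f u = ∑ i, u.1 i * s i + κ u.2 := by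
      rintro ⟨a, b⟩
      have h1 : ((a, b) : ({i // p i} → ℝ) × (Fin k → ℝ)) =
          ∑ i, a i • ((Pi.single i 1, 0) : ({i // p i} → ℝ) × (Fin k → ℝ)) + (0, b) := by
        refine Prod.ext ?_ ?_
        · funext j; simp [Prod.fst_sum, Finset.sum_apply, Pi.single_apply]
        · simp [Prod.snd_sum]
      rw [h1, map_add, map_sum]
      simp only [map_smul, smul_eq_mul, ← h1]
      rfl
    have hzero : ∑ i, s i • v i - S x₀ (κ.comp T) = 0 := by
      refine (SeparatingDual.eq_zero_iff_forall_dual_eq_zero (R := ℝ) _).mpr fun ξ => ?_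
      have h1 : f (Λ ξ) = 0 := hle (LinearMap.mem_range_self Λ ξ)
      rw [hfs] at h1
      have h2 := hskew ξ (κ.comp T)
      have h3 : κ (T (S x₀ ξ)) = -ξ (S x₀ (κ.comp T)) := h2
      have h4 : ∑ i, ξ (v i) * s i + κ (T (S x₀ ξ)) = 0 := h1
      rw [map_sub, map_sum]
      simp only [map_smul, smul_eq_mul]
      rw [h3] at h4
      rw [← h4, sub_eq_add_neg]
      congr 1
      exact Finset.sum_congr rfl fun i _ => mul_comm _ _
    have hs : s = 0 := by
      have h1 := congrArg T hzero
      rw [map_sub, hco, sub_zero, map_zero, map_sum] at h1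
      funext i
      have h2 := congrFun h1 i.1
      simp only [map_smul, hv, Finset.sum_apply, Pi.smul_apply, Pi.single_apply,
        smul_eq_mul, mul_ite, mul_one, mul_zero, Subtype.coe_inj, Pi.zero_apply] at h2
      simpa using h2
    have hκ : κ = 0 := hinj κ (by simpa [hs] using hzero)
    apply hf
    refine LinearMap.ext fun u => ?_
    rw [hfs, hs, hκ]
    simp
  obtain ⟨ξ, hξ⟩ : ((0, c) : ({i // p i} → ℝ) × (Fin k → ℝ)) ∈ LinearMap.range Λ := by
    rw [hsurj]; trivial
  exact ⟨ξ, fun i => congrFun (congrArg Prod.fst hξ) i, congrArg Prod.snd hξ⟩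

/-- A linear complement to the span of independent vectors. -/
theorem exists_complement {ι : Type*} [Fintype ι] {v : ι → F} (hv : LinearIndependent ℝ v) :
    ∃ G : Submodule ℝ F,
      Function.Bijective fun u : (ι → ℝ) × G => ∑ i, u.1 i • v i + G.subtypeL u.2 := by
  obtain ⟨G, hG⟩ := Submodule.exists_isCompl (Submodule.span ℝ (Set.range v))
  have hmem : ∀ s : ι → ℝ, ∑ i, s i • v i ∈ Submodule.span ℝ (Set.range v) := fun s =>
    Submodule.sum_mem _ fun i _ => Submodule.smul_mem _ _ (Submodule.subset_span ⟨i, rfl⟩)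
  refine ⟨G, fun u w huw => ?_, fun x => ?_⟩
  · have h1 : ∑ i, (u.1 i - w.1 i) • v i = ((w.2 - u.2 : G) : F) := by
      have h2 : ∑ i, u.1 i • v i + (u.2 : F) = ∑ i, w.1 i • v i + (w.2 : F) := huw
      simp only [sub_smul, Finset.sum_sub_distrib, Submodule.coe_sub]
      rw [sub_eq_sub_iff_add_eq_add, h2, add_comm]
    have h3 : ((w.2 - u.2 : G) : F) = 0 := by
      have := Submodule.disjoint_def.mp hG.disjoint _ (h1 ▸ hmem fun i => u.1 i - w.1 i)
      exact this (w.2 - u.2).2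
    rw [h3] at h1
    refine Prod.ext (funext fun i => ?_) ?_
    · exact sub_eq_zero.mp (Fintype.linearIndependent_iff.mp hv _ h1 i)
    · exact (sub_eq_zero.mp (Subtype.ext h3)).symm
  · have : x ∈ Submodule.span ℝ (Set.range v) ⊔ G := by rw [hG.sup_eq_top]; trivial
    obtain ⟨a, ha, b, hb, rfl⟩ := Submodule.mem_sup.mp this
    obtain ⟨s, rfl⟩ := (Submodule.mem_span_range_iff_exists_fun ℝ).mp ha
    exact ⟨(s, ⟨b, hb⟩), rfl⟩

end Canonical

/-! ### Commuting functions with Hamiltonian vectors transverse to a coisotropic subspace -/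

section Canonical

variable {F : Type*} [NormedAddCommGroup F] [NormedSpace ℝ F] [FiniteDimensional ℝ F]
  {S : F → (F →L[ℝ] ℝ) →L[ℝ] F} {x₀ : F} {k : ℕ}

/-- Induction on the number of functions. The Hamiltonian fields already found commute and can be
straightened; a linear function of the straightened coordinates killing these directions is in
involution with the previous ones, and its differential at `x₀` can be any covector vanishing on
their Hamiltonian vectors. Functions with index at least `n` are irrelevant placeholders. -/
theorem exists_commuting_functions_lt (hS : IsPoissonNear S x₀) {T : F →L[ℝ] (Fin k → ℝ)}
    (hco : ∀ κ : (Fin k → ℝ) →L[ℝ] ℝ, T (S x₀ (κ.comp T)) = 0)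
    (hinj : ∀ κ : (Fin k → ℝ) →L[ℝ] ℝ, S x₀ (κ.comp T) = 0 → κ = 0) (n : ℕ) :
    ∃ q : Fin k → F → ℝ, (∀ i, ContDiff ℝ ∞ (q i)) ∧
      (∀ᶠ x in 𝓝 x₀, ∀ i j : Fin k, i.val < n → j.val < n →
        fderiv ℝ (q j) x (hamVec S (q i) x) = 0) ∧
      ∀ i : Fin k, i.val < n → T (hamVec S (q i) x₀) = Pi.single i 1 := by
  induction n with
  | zero => exact ⟨fun _ _ => 0, fun _ => contDiff_const, by simp, by simp⟩
  | succ n ih =>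
    obtain ⟨q, hq, hqq, hqT⟩ := ih
    by_cases hn : n < k
    swap
    · refine ⟨q, hq, ?_, fun i hi => hqT i (by omega)⟩
      filter_upwards [hqq] with x hx i j hi hj
      exact hx i j (by omega) (by omega)
    let X : {i : Fin k // i.val < n} → F → F := fun i => hamVec S (q i)
    have hX : ∀ i, ContDiff ℝ ∞ (X i) := fun i => contDiff_hamVec hS.smooth (hq i)
    have hcomm : ∀ᶠ x in 𝓝 x₀, ∀ i j, fderiv ℝ (X i) x (X j x) = fderiv ℝ (X j) x (X i x) := by
      filter_upwards [hS.eventually, hqq.eventually_nhds] with x h1 h2 i j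
      exact h1.hamVec_comm (c := 0) (hq j) (hq i) (by
        filter_upwards [h2] with y hy using hy _ _ j.2 i.2)
    have hXT : ∀ i, T (X i x₀) = Pi.single i.1 1 := fun i => hqT i.1 i.2
    have hind : LinearIndependent ℝ (fun i => X i x₀) := by
      refine LinearIndependent.of_comp T.toLinearMap ?_
      have h1 : (T.toLinearMap ∘ fun i => X i x₀) =
          (fun i : Fin k => (Pi.single i 1 : Fin k → ℝ)) ∘ Subtype.val := funext hXT
      rw [h1]
      exact (Pi.linearIndependent_single_one (Fin k) ℝ).comp _ Subtype.val_injective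
    obtain ⟨G, hG⟩ := exists_complement hind
    obtain ⟨Θ, Ψ, hΘ, hΨ, hΘ0, hΨΘ, hΘΨ, hΘX, hΨX, -⟩ :=
      exists_straightening hX hcomm G.subtypeL hG
    obtain ⟨ξ, hξX, hξT⟩ := exists_covector hS.skew.self_of_nhds hco hinj
      (p := fun i : Fin k => i.val < n) hXT (Pi.single ⟨n, hn⟩ 1)
    have hΨ0 : Ψ 0 = x₀ := by rw [← hΘ0]; exact hΨΘ.self_of_nhds
    -- `ξ` read in straightened coordinates. The function `ℓ ∘ Θ` has differential `ξ` at `x₀`, and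
    -- is constant along the fields at all nearby points because `ℓ` kills the coordinate
    -- directions.
    let ℓ := ξ.comp (fderiv ℝ Ψ 0)
    let qn : F → ℝ := fun x => ℓ (Θ x)
    have hqn : ContDiff ℝ ∞ qn := ℓ.contDiff.comp hΘ
    have hqnd : ∀ x, fderiv ℝ qn x = ℓ.comp (fderiv ℝ Θ x) := fun x =>
      (ℓ.hasFDerivAt.comp x (hΘ.differentiable (by simp) x).hasFDerivAt).fderiv
    have hqnX : ∀ᶠ x in 𝓝 x₀, ∀ i : Fin k, i.val < n →
        fderiv ℝ qn x (hamVec S (q i) x) = 0 := by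
      filter_upwards [hΘX] with x hx i hi
      have h1 : fderiv ℝ Θ x (hamVec S (q i) x) = (Pi.single ⟨i, hi⟩ 1, 0) := hx ⟨i, hi⟩
      rw [hqnd, ContinuousLinearMap.comp_apply, h1]
      change ξ (fderiv ℝ Ψ 0 (Pi.single ⟨i, hi⟩ 1, 0)) = 0
      rw [hΨX.self_of_nhds, hΨ0]
      exact hξX _
    have hqn0 : fderiv ℝ qn x₀ = ξ := by
      rw [hqnd]
      have h1 : Ψ ∘ Θ =ᶠ[𝓝 x₀] id := hΨΘ
      have h2 := h1.fderiv_eq (𝕜 := ℝ)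
      rw [fderiv_comp x₀ (hΨ.differentiable (by simp) _) (hΘ.differentiable (by simp) _),
        hΘ0, fderiv_id] at h2
      change ξ.comp ((fderiv ℝ Ψ 0).comp (fderiv ℝ Θ x₀)) = ξ
      rw [h2, ContinuousLinearMap.comp_id]
    have hupd : ∀ i : Fin k, i.val < n → Function.update q ⟨n, hn⟩ qn i = q i := fun i hi =>
      Function.update_of_ne (fun h => by rw [h] at hi; exact lt_irrefl _ hi) _ _
    have hcases : ∀ i : Fin k, i.val < n + 1 → i.val < n ∨ i = ⟨n, hn⟩ := fun i hi => by
      rcases Nat.lt_succ_iff_lt_or_eq.mp hi with h | h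
      · exact Or.inl h
      · exact Or.inr (Fin.ext h)
    refine ⟨Function.update q ⟨n, hn⟩ qn, fun i => ?_, ?_, fun i hi => ?_⟩
    · by_cases h : i = ⟨n, hn⟩
      · rw [h, Function.update_self]; exact hqn
      · rw [Function.update_of_ne h]; exact hq i
    · filter_upwards [hqq, hqnX, hS.eventually] with x h1 h2 h3 i j hi hj
      rcases hcases i hi with hi | rfl <;> rcases hcases j hj with hj | rfl
      · rw [hupd i hi, hupd j hj]; exact h1 i j hi hj
      · rw [hupd i hi, Function.update_self]; exact h2 i hi
      · rw [hupd j hj, Function.update_self, h3.bracket_skew, h2 j hj, neg_zero]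
      · rw [Function.update_self]; exact h3.bracket_self
    · rcases hcases i hi with hi | rfl
      · rw [hupd i hi]; exact hqT i hi
      · rw [Function.update_self, hamVec, hqn0]; exact hξT

theorem exists_commuting_functions (hS : IsPoissonNear S x₀) {T : F →L[ℝ] (Fin k → ℝ)}
    (hco : ∀ κ : (Fin k → ℝ) →L[ℝ] ℝ, T (S x₀ (κ.comp T)) = 0)
    (hinj : ∀ κ : (Fin k → ℝ) →L[ℝ] ℝ, S x₀ (κ.comp T) = 0 → κ = 0) :
    ∃ q : Fin k → F → ℝ, (∀ i, ContDiff ℝ ∞ (q i)) ∧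
      (∀ᶠ x in 𝓝 x₀, ∀ i j, fderiv ℝ (q j) x (hamVec S (q i) x) = 0) ∧
      ∀ i, T (hamVec S (q i) x₀) = Pi.single i 1 := by
  obtain ⟨q, h1, h2, h3⟩ := exists_commuting_functions_lt hS hco hinj k
  refine ⟨q, h1, ?_, fun i => h3 i i.2⟩
  filter_upwards [h2] with x hx i j using hx i j i.2 j.2

end Canonical

/-! ### Canonical pairs adapted to a coisotropic subspace -/

section CanonicalPairs

variable {A : Type*} [NormedAddCommGroup A] [NormedSpace ℝ A] [FiniteDimensional ℝ A] {k : ℕ}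
  {S : A × (Fin k → ℝ) → (A × (Fin k → ℝ) →L[ℝ] ℝ) →L[ℝ] A × (Fin k → ℝ)} {a₀ : A}

/-- The subspace `c = 0` is coisotropic near `a₀`, with characteristic distribution of rank `k`. -/
structure IsCoisotropicNear
    (S : A × (Fin k → ℝ) → (A × (Fin k → ℝ) →L[ℝ] ℝ) →L[ℝ] A × (Fin k → ℝ)) (a₀ : A) : Prop where
  sharp_snd : ∀ᶠ a in 𝓝 a₀, ∀ κ : (Fin k → ℝ) →L[ℝ] ℝ,
    (S (a, 0) (κ.comp (ContinuousLinearMap.snd ℝ A (Fin k → ℝ)))).2 = 0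
  injective : ∀ κ : (Fin k → ℝ) →L[ℝ] ℝ,
    S (a₀, 0) (κ.comp (ContinuousLinearMap.snd ℝ A (Fin k → ℝ))) = 0 → κ = 0

/-- Functions `pᵢ`, `qᵢ` in involution with `{qᵢ, pⱼ} = δᵢⱼ`, where `p = 0` cuts out `c = 0`. -/
theorem exists_canonical_pairs (hS : IsPoissonNear S (a₀, 0)) (hC : IsCoisotropicNear S a₀) :
    ∃ q p : Fin k → A × (Fin k → ℝ) → ℝ, (∀ i, ContDiff ℝ ∞ (q i)) ∧ (∀ i, ContDiff ℝ ∞ (p i)) ∧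
      (∀ᶠ x in 𝓝 (a₀, 0), ∀ i j, fderiv ℝ (q j) x (hamVec S (q i) x) = 0) ∧
      (∀ᶠ x in 𝓝 (a₀, 0), ∀ i j, fderiv ℝ (p j) x (hamVec S (q i) x) =
        (Pi.single i 1 : Fin k → ℝ) j) ∧
      (∀ᶠ x in 𝓝 (a₀, 0), ∀ i j, fderiv ℝ (p j) x (hamVec S (p i) x) = 0) ∧
      ∀ᶠ x in 𝓝 (a₀, 0), x.2 = 0 ↔ ∀ i, p i x = 0 := by
  let T := ContinuousLinearMap.snd ℝ A (Fin k → ℝ)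
  obtain ⟨q, hq, hqq, hqT⟩ := exists_commuting_functions hS (T := T)
    hC.sharp_snd.self_of_nhds hC.injective
  let X : Fin k → A × (Fin k → ℝ) → A × (Fin k → ℝ) := fun i => hamVec S (q i)
  have hX : ∀ i, ContDiff ℝ ∞ (X i) := fun i => contDiff_hamVec hS.smooth (hq i)
  have hcomm : ∀ᶠ x in 𝓝 (a₀, 0), ∀ i j,
      fderiv ℝ (X i) x (X j x) = fderiv ℝ (X j) x (X i x) := by
    filter_upwards [hS.eventually, hqq.eventually_nhds] with x h1 h2 i j
    exact h1.hamVec_comm (c := 0) (hq j) (hq i) (by filter_upwards [h2] with y hy using hy _ _)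
  -- The transversal is the subspace `c = 0` itself: the Hamiltonian vectors of the `qᵢ` project to
  -- the standard basis of `ℝ^k`.
  let J := ContinuousLinearMap.inl ℝ A (Fin k → ℝ)
  have hsum : ∀ s : Fin k → ℝ, T (∑ i, s i • X i (a₀, 0)) = s := fun s =>
    sum_smul_apply_single T.toLinearMap hqT s
  have hTJ : ∀ a, T (J a) = 0 := fun a => rfl
  have hJ : Function.Bijective fun u : (Fin k → ℝ) × A => ∑ i, u.1 i • X i (a₀, 0) + J u.2 := by
    refine ⟨fun u w huw => ?_, fun x => ⟨(T x, (x - ∑ i, T x i • X i (a₀, 0)).1), ?_⟩⟩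
    · have h1 : ∑ i, u.1 i • X i (a₀, 0) + J u.2 = ∑ i, w.1 i • X i (a₀, 0) + J w.2 := huw
      have h2 := congrArg T h1
      simp only [map_add, hsum, hTJ, add_zero] at h2
      rw [h2] at h1
      exact Prod.ext h2 (congrArg Prod.fst (add_left_cancel h1))
    · have h1 : J (x - ∑ i, T x i • X i (a₀, 0)).1 = x - ∑ i, T x i • X i (a₀, 0) := by
        refine Prod.ext rfl ?_
        have h2 : T (x - ∑ i, T x i • X i (a₀, 0)) = 0 := by rw [map_sub, hsum, sub_self]
        exact h2.symm
      change ∑ i, T x i • X i (a₀, 0) + J (x - ∑ i, T x i • X i (a₀, 0)).1 = x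
      rw [h1]; abel
  obtain ⟨Θ, Ψ, hΘ, hΨ, hΘ0, hΨΘ, hΘΨ, hΘX, hΨX, hΨJ⟩ := exists_straightening hX hcomm J hJ
  -- The flow times from `c = 0`. They vanish on `c = 0`, and have derivative `δᵢⱼ` along the field
  -- of `qᵢ`.
  let p : Fin k → A × (Fin k → ℝ) → ℝ := fun i x => (Θ x).1 i
  have hp : ∀ i, ContDiff ℝ ∞ (p i) := fun i =>
    (contDiff_apply ℝ ℝ i).comp (contDiff_fst.comp hΘ)
  have hpd : ∀ i x v, fderiv ℝ (p i) x v = (fderiv ℝ Θ x v).1 i := fun i x v => by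
    have h1 := ((ContinuousLinearMap.proj (R := ℝ) (φ := fun _ : Fin k => ℝ) i).comp
      (ContinuousLinearMap.fst ℝ (Fin k → ℝ) A)).hasFDerivAt.comp x
      (hΘ.differentiable (by simp) x).hasFDerivAt
    have h2 : fderiv ℝ (p i) x = _ := h1.fderiv
    rw [h2]; rfl
  have hc : Filter.Tendsto Θ (𝓝 (a₀, 0)) (𝓝 0) := hΘ0 ▸ hΘ.continuous.tendsto _
  have hqp : ∀ᶠ x in 𝓝 (a₀, (0 : Fin k → ℝ)), ∀ i j, fderiv ℝ (p j) x (hamVec S (q i) x) =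
      (Pi.single i 1 : Fin k → ℝ) j := by
    filter_upwards [hΘX] with x hx i j
    rw [hpd]; exact congrArg (fun u : (Fin k → ℝ) × A => u.1 j) (hx i)
  -- the functions `p` vanish on `c = 0`
  have hp0 : ∀ᶠ a in 𝓝 a₀, ∀ i, p i (a, 0) = 0 := by
    have h1 : Filter.Tendsto (fun a => a - a₀) (𝓝 a₀) (𝓝 0) := by
      have : Continuous fun a : A => a - a₀ := by fun_prop
      simpa using this.tendsto a₀
    have h2 : Filter.Tendsto (fun a : A => ((0, a - a₀) : (Fin k → ℝ) × A)) (𝓝 a₀) (𝓝 0) := by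
      have : Continuous fun a : A => ((0, a - a₀) : (Fin k → ℝ) × A) := by fun_prop
      have h := this.tendsto a₀
      simp only [sub_self] at h
      exact h
    filter_upwards [h1.eventually hΨJ, h2.eventually hΘΨ] with a h3 h4 i
    rw [h3] at h4
    have h5 : ((a₀, 0) : A × (Fin k → ℝ)) + J (a - a₀) = (a, 0) := by simp [J]
    rw [h5] at h4
    exact congrArg (fun u : (Fin k → ℝ) × A => u.1 i) h4
  have hsnd : ∀ᶠ x in 𝓝 (a₀, (0 : Fin k → ℝ)), (Ψ (0, (Θ x).2)).2 = 0 := by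
    have h1 : Filter.Tendsto (fun x => (Θ x).2) (𝓝 (a₀, 0)) (𝓝 0) :=
      (continuous_snd.tendsto 0).comp hc
    filter_upwards [h1.eventually hΨJ] with x hx
    rw [hx]; simp [J]
  refine ⟨q, p, hq, hp, hqq, hqp, ?_, ?_⟩
  -- By the Jacobi identity `{pᵢ, pⱼ}` is constant along the fields of the `q`, so its values on the
  -- transversal `c = 0` decide. There `X_{pᵢ}` is tangent to `c = 0` by coisotropy, and `pⱼ` is
  -- zero along it.
  · have key : ∀ i j, ∀ᶠ x in 𝓝 (a₀, (0 : Fin k → ℝ)),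
        fderiv ℝ (p j) x (hamVec S (p i) x) = 0 := by
      intro i j
      have hconst := eventually_eq_on_transversal hΘ hΨ hΘ0 hΨΘ hΨX
        (h := fun x => fderiv ℝ (p j) x (hamVec S (p i) x))
        (((hp j).fderiv_right (by simp)).clm_apply (contDiff_hamVec hS.smooth (hp i))) (by
          filter_upwards [hS.eventually, hqp.eventually_nhds] with x h1 h2 l
          exact h1.bracket_bracket_eq_zero (hq l) (hp i) (hp j)
            (by filter_upwards [h2] with y hy using hy l i)
            (by filter_upwards [h2] with y hy using hy l j))
      -- the bracket vanishes on `c = 0`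
      have hzero : ∀ᶠ a in 𝓝 a₀, fderiv ℝ (p j) (a, 0) (hamVec S (p i) (a, 0)) = 0 := by
        filter_upwards [hp0.eventually_nhds, hC.sharp_snd] with a h1 h2
        have hd : ∀ l v, fderiv ℝ (p l) (a, 0) (v, 0) = 0 := fun l v => by
          have h3 : (fun b => p l (b, 0)) =ᶠ[𝓝 a] fun _ => 0 := by
            filter_upwards [h1] with b hb using hb l
          have h4 : HasFDerivAt (fun b => p l (b, (0 : Fin k → ℝ)))
              ((fderiv ℝ (p l) (a, 0)).comp (ContinuousLinearMap.inl ℝ A (Fin k → ℝ))) a :=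
            ((hp l).differentiable (by simp) _).hasFDerivAt.comp a (hasFDerivAt_prodMk_left a 0)
          have h5 := h4.unique ((hasFDerivAt_const (0 : ℝ) a).congr_of_eventuallyEq h3)
          exact congrArg (fun B => B v) h5
        -- As `pᵢ` vanishes on `c = 0`, its differential there is conormal, which is what the
        -- coisotropy hypothesis applies to.
        have h6 : fderiv ℝ (p i) (a, 0) = ((fderiv ℝ (p i) (a, 0)).comp
            (ContinuousLinearMap.inr ℝ A (Fin k → ℝ))).comp
            (ContinuousLinearMap.snd ℝ A (Fin k → ℝ)) := by
          refine ContinuousLinearMap.ext fun w => ?_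
          have h7 : w = (w.1, 0) + (0, w.2) := by simp
          conv_lhs => rw [h7, map_add, hd, zero_add]
          rfl
        have h8 := h2 ((fderiv ℝ (p i) (a, 0)).comp (ContinuousLinearMap.inr ℝ A (Fin k → ℝ)))
        rw [← h6] at h8
        have h9 : hamVec S (p i) (a, 0) = ((hamVec S (p i) (a, 0)).1, 0) := Prod.ext rfl h8
        rw [h9, hd]
      have hΨt : Filter.Tendsto (fun x => (Ψ (0, (Θ x).2)).1) (𝓝 (a₀, 0)) (𝓝 a₀) := by
        have h1 : Continuous fun x => (Ψ (0, (Θ x).2)).1 := by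
          have := hΘ.continuous; have := hΨ.continuous; fun_prop
        have h2 : (Ψ (0, (Θ (a₀, 0)).2)).1 = a₀ := by
          have h3 : Ψ (Θ (a₀, 0)) = (a₀, 0) := hΨΘ.self_of_nhds
          rw [hΘ0] at h3 ⊢
          exact congrArg Prod.fst h3
        have h3 := h1.tendsto (a₀, 0)
        rwa [h2] at h3
      filter_upwards [hconst, hΨt.eventually hzero, hsnd] with x h1 h2 h3
      rw [h1]
      have h4 : Ψ (0, (Θ x).2) = ((Ψ (0, (Θ x).2)).1, 0) := Prod.ext rfl h3
      rw [h4]; exact h2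
    filter_upwards [Filter.eventually_all.mpr fun i => Filter.eventually_all.mpr (key i)]
      with x hx using hx
  · have h1 : ∀ᶠ x : A × (Fin k → ℝ) in 𝓝 (a₀, 0), ∀ i, p i (x.1, 0) = 0 :=
      (continuous_fst.tendsto (a₀, (0 : Fin k → ℝ))).eventually hp0
    filter_upwards [h1, hΨΘ, hsnd] with x h2 h3 h4
    constructor
    · intro h5
      have h6 : x = (x.1, 0) := Prod.ext rfl h5
      rw [h6]; exact h2
    · intro h5
      have h6 : Θ x = (0, (Θ x).2) := Prod.ext (funext h5) rfl
      rw [← h6, h3] at h4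
      exact h4

end CanonicalPairs

/-! ### The splitting normal form along a coisotropic subspace -/

section NormalForm

variable {A : Type*} [NormedAddCommGroup A] [NormedSpace ℝ A] [FiniteDimensional ℝ A] {k : ℕ}
  {S : A × (Fin k → ℝ) → (A × (Fin k → ℝ) →L[ℝ] ℝ) →L[ℝ] A × (Fin k → ℝ)} {a₀ : A}

theorem pi_eq_sum_single {κ : Type*} [Fintype κ] [DecidableEq κ] (s : κ → ℝ) :
    ∑ i, s i • (Pi.single i 1 : κ → ℝ) = s := by
  funext j; simp [Finset.sum_apply, Pi.single_apply]

/-- The bracket of the components of a map `y`, as a function with values in bilinear maps. -/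
def pushSharp {F Y : Type*} [NormedAddCommGroup F] [NormedSpace ℝ F] [NormedAddCommGroup Y]
    [NormedSpace ℝ Y] (S : F → (F →L[ℝ] ℝ) →L[ℝ] F) (y : F → Y) (x : F) : (Y →L[ℝ] ℝ) →L[ℝ] Y :=
  (fderiv ℝ y x).comp ((S x).comp ((ContinuousLinearMap.compL ℝ F Y ℝ).flip (fderiv ℝ y x)))

section Push

variable {F Y : Type*} [NormedAddCommGroup F] [NormedSpace ℝ F] [NormedAddCommGroup Y]
  [NormedSpace ℝ Y] {S : F → (F →L[ℝ] ℝ) →L[ℝ] F} {y : F → Y}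

theorem pushSharp_apply (x : F) (η : Y →L[ℝ] ℝ) :
    pushSharp S y x η = fderiv ℝ y x (S x (η.comp (fderiv ℝ y x))) := rfl

set_option synthInstance.maxHeartbeats 200000 in
theorem contDiff_precomp {T Z : Type*} [NormedAddCommGroup T] [NormedSpace ℝ T]
    [NormedAddCommGroup Z] [NormedSpace ℝ Z] {A : T → F →L[ℝ] Y} (hA : ContDiff ℝ ∞ A) :
    ContDiff ℝ ∞ fun x => (ContinuousLinearMap.compL ℝ F Y Z).flip (A x) := by
  let : NormedAddCommGroup ((Y →L[ℝ] Z) →L[ℝ] F →L[ℝ] Z) :=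
    ContinuousLinearMap.toNormedAddCommGroup
  exact (ContinuousLinearMap.isBoundedLinearMap _).contDiff.comp hA

set_option synthInstance.maxHeartbeats 200000 in
theorem contDiff_pushSharp (hS : ContDiff ℝ ∞ S) (hy : ContDiff ℝ ∞ y) :
    ContDiff ℝ ∞ (pushSharp S y) := by
  have hyd' : ContDiff ℝ ∞ (fderiv ℝ y) := hy.fderiv_right (by simp)
  exact hyd'.clm_comp (hS.clm_comp (contDiff_precomp hyd'))

/-- The bracket of the components of `y` is constant along Hamiltonian vector fields along which
`y` is constant. -/
theorem IsPoissonNear.fderiv_pushSharp_hamVec {x : F} (hS : IsPoissonNear S x)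
    (hy : ContDiff ℝ ∞ y) {q : F → ℝ} (hq : ContDiff ℝ ∞ q)
    (h : ∀ᶠ z in 𝓝 x, fderiv ℝ y z (hamVec S q z) = 0) :
    fderiv ℝ (pushSharp S y) x (hamVec S q x) = 0 := by
  have hηd : ∀ (η : Y →L[ℝ] ℝ) x, fderiv ℝ (fun x => η (y x)) x = η.comp (fderiv ℝ y x) :=
    fun η x => (η.hasFDerivAt.comp x (hy.differentiable (by simp) x).hasFDerivAt).fderiv
  refine ContinuousLinearMap.ext fun η => ?_
  refine (SeparatingDual.eq_iff_forall_dual_eq (R := ℝ)).mpr fun ζ => ?_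
  have hy' : ∀ η : Y →L[ℝ] ℝ, ContDiff ℝ ∞ fun x => η (y x) := fun η => η.contDiff.comp hy
  have hη : ∀ η : Y →L[ℝ] ℝ, ∀ᶠ z in 𝓝 x,
      fderiv ℝ (fun x => η (y x)) z (hamVec S q z) = 0 := fun η => by
    filter_upwards [h] with z hz
    rw [hηd, ContinuousLinearMap.comp_apply, hz, map_zero]
  have h3 := hS.bracket_bracket_eq_zero hq (hy' η) (hy' ζ) (hη η) (hη ζ)
  have h4 : (fun x => fderiv ℝ (fun x => ζ (y x)) x (hamVec S (fun x => η (y x)) x)) =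
      fun x => ζ (pushSharp S y x η) := by
    funext z
    rw [pushSharp_apply, hamVec, hηd, hηd]; rfl
  have h5 : HasFDerivAt (fun x => ζ (pushSharp S y x η))
      (ζ.comp ((fderiv ℝ (pushSharp S y) x).flip η)) x := by
    have h6 := (((contDiff_pushSharp hS.smooth hy).differentiable (by simp) x).hasFDerivAt).clm_apply
      (hasFDerivAt_const η x)
    refine (ζ.hasFDerivAt.comp x h6).congr_fderiv ?_
    ext v
    simp
  rw [h4, h5.fderiv] at h3
  simpa using h3

end Push

/-- The splitting theorem: along `c = 0` the Poisson bivector is, in suitable coordinates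
`(p, q, y)` with `c = 0` given by `p = 0`, the sum of the canonical bivector in `(p, q)` and of a
bivector `Q` in `y`. -/
theorem exists_normal_form (hS : IsPoissonNear S (a₀, 0)) (hC : IsCoisotropicNear S a₀) :
    ∃ (r : ℕ) (e : OpenPartialHomeomorph (A × (Fin k → ℝ))
        (((Fin k → ℝ) × (Fin k → ℝ)) × (Fin r → ℝ)))
      (Q : (Fin r → ℝ) → ((Fin r → ℝ) →L[ℝ] ℝ) → (Fin r → ℝ)),
      (a₀, 0) ∈ e.source ∧ e (a₀, 0) = 0 ∧ ContDiffOn ℝ ∞ e e.source ∧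
      ContDiffOn ℝ ∞ e.symm e.target ∧ (∀ x ∈ e.source, x.2 = 0 ↔ (e x).1.1 = 0) ∧
      ∀ x ∈ e.source, ∀ ξ : ((Fin k → ℝ) × (Fin k → ℝ)) × (Fin r → ℝ) →L[ℝ] ℝ,
        fderiv ℝ e x (S x (ξ.comp (fderiv ℝ e x))) =
          ((fun i => ξ ((0, Pi.single i 1), 0), fun i => -ξ ((Pi.single i 1, 0), 0)),
            Q (e x).2 (ξ.comp
              (ContinuousLinearMap.inr ℝ ((Fin k → ℝ) × (Fin k → ℝ)) (Fin r → ℝ)))) := by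
  obtain ⟨q, p, hq, hp, hqq, hqp, hpp, hp0⟩ := exists_canonical_pairs hS hC
  set x₀ : A × (Fin k → ℝ) := (a₀, 0) with hx₀
  have hpq : ∀ᶠ x in 𝓝 x₀, ∀ i j, fderiv ℝ (q j) x (hamVec S (p i) x) =
      -(Pi.single i 1 : Fin k → ℝ) j := by
    filter_upwards [hqp, hS.eventually] with x h1 h2 i j
    rw [h2.bracket_skew, h1, Pi.single_apply, Pi.single_apply]
    simp only [eq_comm]
  let f : Fin k ⊕ Fin k → A × (Fin k → ℝ) → ℝ := Sum.elim q p
  have hf : ∀ i, ContDiff ℝ ∞ (f i) := by rintro (i | i); exacts [hq i, hp i]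
  let X : Fin k ⊕ Fin k → A × (Fin k → ℝ) → A × (Fin k → ℝ) := fun i => hamVec S (f i)
  have hX : ∀ i, ContDiff ℝ ∞ (X i) := fun i => contDiff_hamVec hS.smooth (hf i)
  have hff : ∀ i j, ∃ c : ℝ, ∀ᶠ x in 𝓝 x₀, fderiv ℝ (f j) x (hamVec S (f i) x) = c := by
    rintro (i | i) (j | j)
    · exact ⟨_, hqq.mono fun x hx => hx i j⟩
    · exact ⟨_, hqp.mono fun x hx => hx i j⟩
    · exact ⟨_, hpq.mono fun x hx => hx i j⟩
    · exact ⟨_, hpp.mono fun x hx => hx i j⟩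
  have hcomm : ∀ᶠ x in 𝓝 x₀, ∀ i j, fderiv ℝ (X i) x (X j x) = fderiv ℝ (X j) x (X i x) := by
    refine Filter.eventually_all.mpr fun i => Filter.eventually_all.mpr fun j => ?_
    obtain ⟨c, hc⟩ := hff j i
    filter_upwards [hS.eventually, hc.eventually_nhds] with x h1 h2
    exact h1.hamVec_comm (hf j) (hf i) h2
  -- the differential of `(p, q)` and its kernel
  let Dp : ∀ _x : A × (Fin k → ℝ), A × (Fin k → ℝ) →L[ℝ] (Fin k → ℝ) := fun x =>
    ContinuousLinearMap.pi fun i => fderiv ℝ (p i) x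
  let Dq : ∀ _x : A × (Fin k → ℝ), A × (Fin k → ℝ) →L[ℝ] (Fin k → ℝ) := fun x =>
    ContinuousLinearMap.pi fun i => fderiv ℝ (q i) x
  have hvals : ∀ᶠ x in 𝓝 x₀, (∀ i, Dp x (hamVec S (q i) x) = Pi.single i 1) ∧
      (∀ i, Dq x (hamVec S (q i) x) = 0) ∧ (∀ i, Dp x (hamVec S (p i) x) = 0) ∧
      ∀ i, Dq x (hamVec S (p i) x) = -Pi.single i 1 := by
    filter_upwards [hqq, hqp, hpp, hpq] with x h1 h2 h3 h4
    exact ⟨fun i => funext fun j => h2 i j, fun i => funext fun j => h1 i j,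
      fun i => funext fun j => h3 i j, fun i => funext fun j => h4 i j⟩
  have hDp : ∀ᶠ x in 𝓝 x₀, ∀ s t : Fin k → ℝ,
      Dp x (∑ i, s i • hamVec S (q i) x + ∑ i, t i • hamVec S (p i) x) = s ∧
      Dq x (∑ i, s i • hamVec S (q i) x + ∑ i, t i • hamVec S (p i) x) = -t := by
    filter_upwards [hvals] with x hx s t
    simp only [map_add, map_sum, map_smul, hx.1, hx.2.1, hx.2.2.1, hx.2.2.2, smul_zero,
      Finset.sum_const_zero, add_zero, zero_add, smul_neg, Finset.sum_neg_distrib,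
      pi_eq_sum_single, and_self]
  -- The common kernel of `dp` and `dq` at `x₀` is a complement of the `2k` Hamiltonian vectors. It
  -- is parametrized by `ℝ^r`, so that `y` takes values in a coordinate space.
  obtain ⟨r, J, hJinj, hJmem⟩ : ∃ (r : ℕ) (J : (Fin r → ℝ) →L[ℝ] A × (Fin k → ℝ)),
      Function.Injective J ∧ ∀ v, (∃ b, J b = v) ↔ Dp x₀ v = 0 ∧ Dq x₀ v = 0 := by
    let B : Submodule ℝ (A × (Fin k → ℝ)) := LinearMap.ker ((Dp x₀).prod (Dq x₀)).toLinearMap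
    let E := (Module.finBasis ℝ B).equivFun
    refine ⟨_, LinearMap.toContinuousLinearMap (B.subtype ∘ₗ E.symm.toLinearMap),
      B.injective_subtype.comp E.symm.injective, fun v => ⟨?_, fun hv => ?_⟩⟩
    · rintro ⟨b, rfl⟩
      exact Prod.ext_iff.mp (LinearMap.mem_ker.mp (E.symm b).2)
    · have hv' : v ∈ B := LinearMap.mem_ker.mpr (Prod.ext hv.1 hv.2)
      exact ⟨E ⟨v, hv'⟩, congrArg Subtype.val (E.symm_apply_apply ⟨v, hv'⟩)⟩
  have hJker : ∀ b, Dp x₀ (J b) = 0 ∧ Dq x₀ (J b) = 0 := fun b => (hJmem _).mp ⟨b, rfl⟩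
  have hXsum : ∀ s : Fin k ⊕ Fin k → ℝ, ∑ i, s i • X i x₀ =
      ∑ i, s (Sum.inl i) • hamVec S (q i) x₀ + ∑ i, s (Sum.inr i) • hamVec S (p i) x₀ :=
    fun s => Fintype.sum_sum_type _
  have hJ : Function.Bijective fun u : (Fin k ⊕ Fin k → ℝ) × (Fin r → ℝ) =>
      ∑ i, u.1 i • X i x₀ + J u.2 := by
    have hval : ∀ u : (Fin k ⊕ Fin k → ℝ) × (Fin r → ℝ),
        Dp x₀ (∑ i, u.1 i • X i x₀ + J u.2) = (fun i => u.1 (Sum.inl i)) ∧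
        Dq x₀ (∑ i, u.1 i • X i x₀ + J u.2) = -(fun i => u.1 (Sum.inr i)) := fun u => by
      have h1 := hDp.self_of_nhds (fun i => u.1 (Sum.inl i)) (fun i => u.1 (Sum.inr i))
      have h2 := hJker u.2
      rw [map_add, map_add, hXsum, h1.1, h1.2, h2.1, h2.2, add_zero, add_zero]
      exact ⟨rfl, rfl⟩
    refine ⟨fun u w huw => ?_, fun v => ?_⟩
    · have h0 : ∑ i, u.1 i • X i x₀ + J u.2 = ∑ i, w.1 i • X i x₀ + J w.2 := huw
      have h1 := hval u
      have h2 := hval w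
      rw [h0] at h1
      have h3 : u.1 = w.1 := by
        funext i
        rcases i with i | i
        · exact congrFun (h1.1.symm.trans h2.1) i
        · exact congrFun (neg_injective (h1.2.symm.trans h2.2)) i
      rw [h3] at h0
      exact Prod.ext h3 (hJinj (add_left_cancel h0))
    · let s : Fin k ⊕ Fin k → ℝ := Sum.elim (Dp x₀ v) (-Dq x₀ v)
      have h1 := hDp.self_of_nhds (Dp x₀ v) (-Dq x₀ v)
      obtain ⟨b, hb⟩ : ∃ b, J b = v - ∑ i, s i • X i x₀ := by
        rw [hJmem, map_sub, map_sub, hXsum]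
        refine ⟨sub_eq_zero.mpr h1.1.symm, sub_eq_zero.mpr ?_⟩
        rw [neg_neg] at h1
        exact h1.2.symm
      exact ⟨(s, b), (congrArg (∑ i, s i • X i x₀ + ·) hb).trans (add_sub_cancel _ _)⟩
  obtain ⟨Θ, Ψ, hΘ, hΨ, hΘ0, hΨΘ, hΘΨ, hΘX, hΨX, hΨJ⟩ :=
    exists_straightening hX hcomm J hJ
  let y : A × (Fin k → ℝ) → (Fin r → ℝ) := fun x => (Θ x).2
  have hy : ContDiff ℝ ∞ y := contDiff_snd.comp hΘ
  have hyd : ∀ x v, fderiv ℝ y x v = (fderiv ℝ Θ x v).2 := fun x v => by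
    have h1 : HasFDerivAt y _ x :=
      hasFDerivAt_snd.comp x (hΘ.differentiable (by simp) x).hasFDerivAt
    rw [h1.fderiv]; rfl
  have hyX : ∀ᶠ x in 𝓝 x₀, ∀ i, fderiv ℝ y x (X i x) = 0 := by
    filter_upwards [hΘX] with x hx i
    rw [hyd, hx]
  have hyB : ∀ b, fderiv ℝ y x₀ (J b) = b := fun b => by
    have h1 : (fun g => y (x₀ + J g)) =ᶠ[𝓝 0] fun g => g := by
      have h2 : Filter.Tendsto (fun g : Fin r → ℝ => ((0, g) : (Fin k ⊕ Fin k → ℝ) × (Fin r → ℝ))) (𝓝 0) (𝓝 0) := by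
        have : Continuous (fun g : Fin r → ℝ => ((0, g) : (Fin k ⊕ Fin k → ℝ) × (Fin r → ℝ))) := by fun_prop
        exact this.tendsto 0
      filter_upwards [hΨJ, h2.eventually hΘΨ] with g h3 h4
      rw [← h3]
      exact congrArg Prod.snd h4
    have h5 : HasFDerivAt (fun g => y (x₀ + J g))
        ((fderiv ℝ y x₀).comp J) 0 := by
      have h6 : HasFDerivAt (fun g => x₀ + J g) J 0 :=
        J.hasFDerivAt.const_add x₀
      have h7 : HasFDerivAt y (fderiv ℝ y x₀) (x₀ + J 0) := by
        rw [map_zero, add_zero]; exact (hy.differentiable (by simp) _).hasFDerivAt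
      exact HasFDerivAt.comp (f := fun g => x₀ + J g) 0 h7 h6
    have h6 := h5.unique ((hasFDerivAt_id (0 : Fin r → ℝ)).congr_of_eventuallyEq h1)
    exact congrArg (fun A => A b) h6
  have hy0 : y x₀ = 0 := by change (Θ x₀).2 = 0; rw [hΘ0]; rfl
  -- the brackets of the components of `y` are functions of `y`
  have hRX : ∀ᶠ x in 𝓝 x₀, ∀ i, fderiv ℝ (pushSharp S y) x (X i x) = 0 := by
    filter_upwards [hS.eventually, hyX.eventually_nhds] with x h1 h2 i
    exact h1.fderiv_pushSharp_hamVec hy (hf i) (by filter_upwards [h2] with z hz using hz i)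
  have hRπ := eventually_eq_on_transversal hΘ hΨ hΘ0 hΨΘ hΨX
    (contDiff_pushSharp hS.smooth hy) hRX
  -- the coordinate map
  let φ : A × (Fin k → ℝ) → ((Fin k → ℝ) × (Fin k → ℝ)) × (Fin r → ℝ) := fun x =>
    ((fun i => p i x, fun i => q i x - q i x₀), y x)
  have hφ : ContDiff ℝ ∞ φ := ((contDiff_pi.mpr hp).prodMk
    (contDiff_pi.mpr fun i => (hq i).sub contDiff_const)).prodMk hy
  have hφd : ∀ x v, fderiv ℝ φ x v = ((Dp x v, Dq x v), fderiv ℝ y x v) := fun x v => by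
    have h1 : HasFDerivAt (fun x => fun i => p i x) (Dp x) x :=
      hasFDerivAt_pi.mpr fun i => ((hp i).differentiable (by simp) x).hasFDerivAt
    have h2 : HasFDerivAt (fun x => fun i => q i x - q i x₀) (Dq x) x :=
      hasFDerivAt_pi.mpr fun i => ((hq i).differentiable (by simp) x).hasFDerivAt.sub_const _
    have h3 : HasFDerivAt φ _ x :=
      (h1.prodMk h2).prodMk (hy.differentiable (by simp) x).hasFDerivAt
    rw [h3.fderiv]; rfl
  have hp00 : ∀ i, p i x₀ = 0 := hp0.self_of_nhds.mp rfl
  have hφ0 : φ x₀ = 0 := by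
    refine Prod.ext (Prod.ext (funext hp00) (funext fun i => sub_self _)) hy0
  have hbij : Function.Bijective (fderiv ℝ φ x₀) := by
    constructor
    · refine (injective_iff_map_eq_zero _).mpr fun v hv => ?_
      rw [hφd] at hv
      have h1 : Dp x₀ v = 0 := congrArg (fun u => u.1.1) hv
      have h2 : Dq x₀ v = 0 := congrArg (fun u => u.1.2) hv
      have h3 : fderiv ℝ y x₀ v = 0 := congrArg Prod.snd hv
      obtain ⟨b, rfl⟩ := (hJmem v).mpr ⟨h1, h2⟩
      rw [← hyB b, h3, map_zero]
    · rintro ⟨⟨s, t⟩, b⟩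
      let s' : Fin k ⊕ Fin k → ℝ := Sum.elim s (-t)
      have h1 := hDp.self_of_nhds s (-t)
      refine ⟨∑ i, s' i • X i x₀ + J b, ?_⟩
      have h2 := hJker b
      have h3 : fderiv ℝ y x₀ (∑ i, s' i • X i x₀) = 0 := by
        rw [map_sum]
        exact Finset.sum_eq_zero fun i _ => by rw [map_smul, hyX.self_of_nhds, smul_zero]
      rw [hφd, map_add, map_add, map_add, h2.1, h2.2, h3, hyB, hXsum, add_zero, add_zero, zero_add]
      refine Prod.ext (Prod.ext h1.1 ?_) rfl
      rw [neg_neg] at h1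
      exact h1.2
  have hinv : (fderiv ℝ φ x₀).IsInvertible :=
    ⟨(LinearEquiv.ofBijective (fderiv ℝ φ x₀).toLinearMap hbij).toContinuousLinearEquiv, rfl⟩
  have hgood : ∀ᶠ x in 𝓝 x₀, (x.2 = 0 ↔ ∀ i, p i x = 0) ∧ pushSharp S y x = pushSharp S y (Ψ (0, y x)) ∧
      (∀ s t : Fin k → ℝ,
        Dp x (∑ i, s i • hamVec S (q i) x + ∑ i, t i • hamVec S (p i) x) = s ∧
        Dq x (∑ i, s i • hamVec S (q i) x + ∑ i, t i • hamVec S (p i) x) = -t) ∧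
      (∀ i, fderiv ℝ y x (X i x) = 0) ∧ ∀ ξ η : A × (Fin k → ℝ) →L[ℝ] ℝ,
        η (S x ξ) = -ξ (S x η) := by
    filter_upwards [hp0, hRπ, hDp, hyX, hS.skew] with x h1 h2 h3 h4 h5
    exact ⟨h1, h2, h3, h4, h5⟩
  obtain ⟨U, hUgood, hUo, hxU⟩ := eventually_nhds_iff.mp hgood
  have : CompleteSpace A := FiniteDimensional.complete ℝ A
  obtain ⟨e, hxe, heU, hee, hes, -⟩ :=
    exists_smooth_openPartialHomeomorph hUo hφ.contDiffOn hxU hinv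
  have hee' : (e : A × (Fin k → ℝ) → ((Fin k → ℝ) × (Fin k → ℝ)) × (Fin r → ℝ)) = φ := funext hee
  -- The transverse bivector at `b` is the bracket of the components of `y` at the point `Ψ (0, b)`
  -- of the transversal; at any other point with `y = b` the bracket is the same.
  refine ⟨r, e, fun b η => pushSharp S y (Ψ (0, b)) η, hxe, by rw [hee, hφ0], by rw [hee']; exact hφ.contDiffOn,
    hes, fun x hx => ?_, fun x hx ξ => ?_⟩
  · rw [(hUgood x (heU hx)).1, hee]
    exact ⟨fun h => funext h, fun h i => congrFun h i⟩
  · obtain ⟨-, h2, h3, h4, h5⟩ := hUgood x (heU hx)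
    rw [hee']
    let η := ξ.comp (ContinuousLinearMap.inr ℝ ((Fin k → ℝ) × (Fin k → ℝ)) (Fin r → ℝ))
    let α : Fin k → ℝ := fun i => ξ ((Pi.single i 1, 0), 0)
    let β : Fin k → ℝ := fun i => ξ ((0, Pi.single i 1), 0)
    -- The pulled-back covector is expanded in `dq`, `dp` and `dy`. Sharp sends the first two parts
    -- to Hamiltonian fields with known components; the mixed brackets with `y` vanish because `y`
    -- is constant along those fields.
    have hξ : ξ.comp (fderiv ℝ φ x) = ∑ i, β i • fderiv ℝ (q i) x + ∑ i, α i • fderiv ℝ (p i) x +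
        η.comp (fderiv ℝ y x) := by
      refine ContinuousLinearMap.ext fun v => ?_
      have h6 : ((Dp x v, Dq x v), fderiv ℝ y x v) =
          ∑ i, Dq x v i • (((0, Pi.single i 1), 0) : ((Fin k → ℝ) × (Fin k → ℝ)) × (Fin r → ℝ)) +
          ∑ i, Dp x v i • (((Pi.single i 1, 0), 0) : ((Fin k → ℝ) × (Fin k → ℝ)) × (Fin r → ℝ)) +
          (0, fderiv ℝ y x v) := by
        refine Prod.ext (Prod.ext ?_ ?_) ?_
        · simp [Prod.fst_sum, pi_eq_sum_single]
        · simp [Prod.fst_sum, Prod.snd_sum, pi_eq_sum_single]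
        · simp [Prod.snd_sum]
      rw [ContinuousLinearMap.comp_apply, hφd, h6, map_add, map_add, map_sum, map_sum]
      simp only [map_smul, add_apply, smul_apply, sum_apply, smul_eq_mul]
      congr 1
      congr 1
      · exact Finset.sum_congr rfl fun i _ => mul_comm _ _
      · exact Finset.sum_congr rfl fun i _ => mul_comm _ _
    have hSξ : S x (ξ.comp (fderiv ℝ φ x)) =
        (∑ i, β i • hamVec S (q i) x + ∑ i, α i • hamVec S (p i) x) +
          S x (η.comp (fderiv ℝ y x)) := by
      rw [hξ, map_add, map_add, map_sum, map_sum]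
      simp only [map_smul]
      rfl
    have hp1 : Dp x (S x (η.comp (fderiv ℝ y x))) = 0 := funext fun i => by
      have h6 := h5 (η.comp (fderiv ℝ y x)) (fderiv ℝ (p i) x)
      rw [ContinuousLinearMap.comp_apply] at h6
      exact h6.trans (by
        have h7 : fderiv ℝ y x (S x (fderiv ℝ (p i) x)) = 0 := h4 (Sum.inr i)
        rw [h7, map_zero, neg_zero]; rfl)
    have hq1 : Dq x (S x (η.comp (fderiv ℝ y x))) = 0 := funext fun i => by
      have h6 := h5 (η.comp (fderiv ℝ y x)) (fderiv ℝ (q i) x)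
      rw [ContinuousLinearMap.comp_apply] at h6
      exact h6.trans (by
        have h7 : fderiv ℝ y x (S x (fderiv ℝ (q i) x)) = 0 := h4 (Sum.inl i)
        rw [h7, map_zero, neg_zero]; rfl)
    have hy1 : fderiv ℝ y x (∑ i, β i • hamVec S (q i) x + ∑ i, α i • hamVec S (p i) x) = 0 := by
      rw [map_add, map_sum, map_sum]
      have h7 : ∀ i, fderiv ℝ y x (hamVec S (q i) x) = 0 := fun i => h4 (Sum.inl i)
      have h8 : ∀ i, fderiv ℝ y x (hamVec S (p i) x) = 0 := fun i => h4 (Sum.inr i)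
      simp [h7, h8]
    obtain ⟨h9, h10⟩ := h3 β α
    generalize ∑ i, β i • hamVec S (q i) x + ∑ i, α i • hamVec S (p i) x = w at h9 h10 hSξ hy1
    rw [hφd, hSξ, map_add, map_add, map_add, h9, h10, hp1, hq1, hy1, add_zero, add_zero, zero_add]
    refine Prod.ext (Prod.ext rfl rfl) ?_
    change fderiv ℝ y x (S x (η.comp (fderiv ℝ y x))) =
      pushSharp S y (Ψ (0, (φ x).2)) η
    rw [← pushSharp_apply, h2]

end NormalForm

/-! ### Comparison of two bivectors with the same induced Dirac structure -/

section Comparison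

theorem isInvertible_fderiv_of_contDiffOn {E F : Type*} [NormedAddCommGroup E] [NormedSpace ℝ E]
    [NormedAddCommGroup F] [NormedSpace ℝ F] (e : OpenPartialHomeomorph E F)
    (he : ContDiffOn ℝ ∞ e e.source) (he' : ContDiffOn ℝ ∞ e.symm e.target) {x : E}
    (hx : x ∈ e.source) : (fderiv ℝ e x).IsInvertible := by
  have h1 : HasFDerivAt e (fderiv ℝ e x) x :=
    ((he.contDiffAt (e.open_source.mem_nhds hx)).differentiableAt (by simp)).hasFDerivAt
  have h2 : HasFDerivAt e.symm (fderiv ℝ e.symm (e x)) (e x) :=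
    ((he'.contDiffAt (e.open_target.mem_nhds (e.map_source hx))).differentiableAt
      (by simp)).hasFDerivAt
  have h3 := (h2.comp x h1).unique ((hasFDerivAt_id x).congr_of_eventuallyEq
    (by filter_upwards [e.open_source.mem_nhds hx] with z hz using e.left_inv hz))
  have h1' : HasFDerivAt e (fderiv ℝ e x) (e.symm (e x)) := by rwa [e.left_inv hx]
  have h4 := (h1'.comp (e x) h2).unique ((hasFDerivAt_id (e x)).congr_of_eventuallyEq
    (by filter_upwards [e.open_target.mem_nhds (e.map_source hx)] with z hz using e.right_inv hz))
  exact ⟨ContinuousLinearEquiv.equivOfInverse _ _ (fun v => congrArg (fun A => A v) h3)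
    fun v => congrArg (fun A => A v) h4, rfl⟩

variable {A : Type*} [NormedAddCommGroup A] [NormedSpace ℝ A] [FiniteDimensional ℝ A] {k r : ℕ}

/-- The covector `η ∘ inl` at `(v, 0) = ♯ η`: the pullback to `c = 0` of the graph of `S`. -/
def InducedRel (S : A × (Fin k → ℝ) → (A × (Fin k → ℝ) →L[ℝ] ℝ) →L[ℝ] A × (Fin k → ℝ)) (a v : A)
    (ξ : A →L[ℝ] ℝ) : Prop :=
  ∃ η : A × (Fin k → ℝ) →L[ℝ] ℝ, S (a, 0) η = (v, 0) ∧
    η.comp (ContinuousLinearMap.inl ℝ A (Fin k → ℝ)) = ξ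

variable {S : A × (Fin k → ℝ) → (A × (Fin k → ℝ) →L[ℝ] ℝ) →L[ℝ] A × (Fin k → ℝ)}
  {e : OpenPartialHomeomorph (A × (Fin k → ℝ)) (((Fin k → ℝ) × (Fin k → ℝ)) × (Fin r → ℝ))}
  {Q : (Fin r → ℝ) → ((Fin r → ℝ) →L[ℝ] ℝ) → (Fin r → ℝ)} {a₀ : A}

/-- `e` puts `S` in normal form. -/
structure IsNormalForm
    (S : A × (Fin k → ℝ) → (A × (Fin k → ℝ) →L[ℝ] ℝ) →L[ℝ] A × (Fin k → ℝ)) (a₀ : A)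
    (e : OpenPartialHomeomorph (A × (Fin k → ℝ)) (((Fin k → ℝ) × (Fin k → ℝ)) × (Fin r → ℝ)))
    (Q : (Fin r → ℝ) → ((Fin r → ℝ) →L[ℝ] ℝ) → (Fin r → ℝ)) : Prop where
  mem_source : (a₀, 0) ∈ e.source
  map_base : e (a₀, 0) = 0
  contDiffOn : ContDiffOn ℝ ∞ e e.source
  contDiffOn_symm : ContDiffOn ℝ ∞ e.symm e.target
  snd_eq_zero_iff : ∀ x ∈ e.source, x.2 = 0 ↔ (e x).1.1 = 0
  push : ∀ x ∈ e.source, ∀ ξ : ((Fin k → ℝ) × (Fin k → ℝ)) × (Fin r → ℝ) →L[ℝ] ℝ,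
    fderiv ℝ e x (S x (ξ.comp (fderiv ℝ e x))) =
      ((fun i => ξ ((0, Pi.single i 1), 0), fun i => -ξ ((Pi.single i 1, 0), 0)),
        Q (e x).2 (ξ.comp
          (ContinuousLinearMap.inr ℝ ((Fin k → ℝ) × (Fin k → ℝ)) (Fin r → ℝ))))

namespace IsNormalForm

/-- In normal form `♯η` is tangent to `p = 0` exactly when `η` has no `dq` component. The
restriction of `η` to `p = 0` is then its `dy` part, and the `y` component of `♯η` is `Q` of that
part. So the induced Dirac structure is the pullback of the graph of `Q` along `ρ`. -/
theorem inducedRel_iff (h : IsNormalForm S a₀ e Q) {ρ : A → Fin r → ℝ} {a : A}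
    (ha : (a, 0) ∈ e.source) (hρ : (fun a : A => (e (a, 0)).2) =ᶠ[𝓝 a] ρ) (v : A)
    (ξ : A →L[ℝ] ℝ) :
    InducedRel S a v ξ ↔ ∃ ζ : (Fin r → ℝ) →L[ℝ] ℝ, fderiv ℝ ρ a v = Q (ρ a) ζ ∧
      ξ = ζ.comp (fderiv ℝ ρ a) := by
  set D := fderiv ℝ e (a, 0) with hD
  have hDe : HasFDerivAt e D (a, (0 : Fin k → ℝ)) :=
    ((h.contDiffOn.contDiffAt (e.open_source.mem_nhds ha)).differentiableAt (by simp)).hasFDerivAt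
  have h1 : HasFDerivAt (fun a : A => e (a, 0)) (D.comp (ContinuousLinearMap.inl ℝ A (Fin k → ℝ))) a :=
    hDe.comp (f := fun a : A => (a, (0 : Fin k → ℝ))) a (hasFDerivAt_prodMk_left a 0)
  have hnear : ∀ᶠ a' in 𝓝 a, (a', (0 : Fin k → ℝ)) ∈ e.source :=
    (Continuous.tendsto (f := fun a' : A => (a', (0 : Fin k → ℝ))) (by fun_prop) a).eventually
      (e.open_source.mem_nhds ha)
  have h2 : ∀ v, (D (v, 0)).1.1 = 0 := fun v => by
    have h3 : HasFDerivAt (fun a : A => (e (a, 0)).1.1) _ a :=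
      hasFDerivAt_fst.comp a (hasFDerivAt_fst.comp a h1)
    have h4 := h3.unique ((hasFDerivAt_const (0 : Fin k → ℝ) a).congr_of_eventuallyEq
      (by filter_upwards [hnear] with z hz using (h.snd_eq_zero_iff _ hz).mp rfl))
    exact congrArg (fun A => A v) h4
  have h5 : ∀ v, (D (v, 0)).2 = fderiv ℝ ρ a v := fun v => by
    have h3 : HasFDerivAt (fun a : A => (e (a, 0)).2) _ a := hasFDerivAt_snd.comp a h1
    rw [(h3.congr_of_eventuallyEq hρ.symm).fderiv]; rfl
  have hbase : (e (a, 0)).2 = ρ a := hρ.self_of_nhds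
  obtain ⟨D', hD'⟩ := isInvertible_fderiv_of_contDiffOn e h.contDiffOn h.contDiffOn_symm ha
  have hD'v : ∀ v, D' v = D v := fun v => by rw [hD, ← hD']; rfl
  constructor
  · rintro ⟨η, hη, rfl⟩
    let θ := η.comp (D'.symm : ((Fin k → ℝ) × (Fin k → ℝ)) × (Fin r → ℝ) →L[ℝ] _)
    have hθ : θ.comp D = η := by
      refine ContinuousLinearMap.ext fun v => ?_
      change η (D'.symm (D v)) = η v
      rw [← hD'v, D'.symm_apply_apply]
    have h6 := h.push _ ha θ
    rw [← hD, hθ, hη] at h6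
    have h7 : ∀ i, θ ((0, Pi.single i 1), 0) = 0 := fun i => by
      have := congrArg (fun u => u.1.1 i) h6
      exact this.symm.trans (congrFun (h2 v) i)
    refine ⟨θ.comp (ContinuousLinearMap.inr ℝ _ _), ?_, ?_⟩
    rotate_left
    · refine ContinuousLinearMap.ext fun w => ?_
      change η (w, 0) = θ ((0, 0), fderiv ℝ ρ a w)
      rw [← hθ, ContinuousLinearMap.comp_apply]
      have h8 : D (w, 0) = ∑ i, (D (w, 0)).1.2 i • (((0, Pi.single i 1), 0) :
          ((Fin k → ℝ) × (Fin k → ℝ)) × (Fin r → ℝ)) + ((0, 0), fderiv ℝ ρ a w) := by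
        refine Prod.ext (Prod.ext ?_ ?_) ?_
        · simp [Prod.fst_sum, h2]
        · simp [Prod.fst_sum, Prod.snd_sum, pi_eq_sum_single]
        · simp [Prod.snd_sum, h5]
      rw [h8, map_add, map_sum, Finset.sum_eq_zero fun i _ => by rw [map_smul, h7, smul_zero],
        zero_add]
    · rw [← h5, h6, hbase]
  · rintro ⟨ζ, hζ, rfl⟩
    -- The `dp` coefficients are forced: the `q` component of a sharp is minus the `dp` coefficient,
    -- and it must equal the `q` component of `v`.
    let θ : ((Fin k → ℝ) × (Fin k → ℝ)) × (Fin r → ℝ) →L[ℝ] ℝ :=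
      ζ.comp (ContinuousLinearMap.snd ℝ _ _) -
        (∑ i, (D (v, 0)).1.2 i • (ContinuousLinearMap.proj i : (Fin k → ℝ) →L[ℝ] ℝ)).comp
          ((ContinuousLinearMap.fst ℝ _ _).comp (ContinuousLinearMap.fst ℝ _ _))
    have hθ : ∀ u, θ u = ζ u.2 - ∑ i, (D (v, 0)).1.2 i * u.1.1 i := fun u => by
      simp [θ, sum_apply]
    refine ⟨θ.comp D, D'.injective ?_, ?_⟩
    · rw [hD'v, hD'v, h.push _ ha]
      refine Prod.ext (Prod.ext ?_ ?_) ?_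
      · rw [h2]; funext i; simp [hθ]
      · funext i; simp [hθ, Pi.single_apply]
      · change Q _ _ = (D (v, 0)).2
        rw [h5, hζ, hbase]
        congr 1
        ext1 w
        simp [hθ]
    · ext1 w
      change θ (D (w, 0)) = ζ (fderiv ℝ ρ a w)
      rw [hθ, h2, h5]
      simp

/-- `Q` is not assumed linear; this value is what the description of the kernel of `dρ` needs. -/
theorem apply_zero (h : IsNormalForm S a₀ e Q) {x : A × (Fin k → ℝ)} (hx : x ∈ e.source) :
    Q (e x).2 0 = 0 := by
  have := h.push x hx 0
  rw [ContinuousLinearMap.zero_comp, map_zero, map_zero] at this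
  exact (congrArg Prod.snd this).symm

/-- The quotient of `c = 0` by its characteristic distribution, in normal form coordinates. -/
theorem exists_quotient (h : IsNormalForm S a₀ e Q) :
    ∃ (ρ : A → Fin r → ℝ) (α : A → Fin k → ℝ) (β : (Fin k → ℝ) × (Fin r → ℝ) → A),
      ContDiff ℝ ∞ ρ ∧ ContDiff ℝ ∞ α ∧ ContDiff ℝ ∞ β ∧ ρ a₀ = 0 ∧ α a₀ = 0 ∧ β 0 = a₀ ∧
      (∀ᶠ a in 𝓝 a₀, β (α a, ρ a) = a) ∧ (∀ᶠ u in 𝓝 0, ρ (β u) = u.2) ∧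
      (∀ᶠ a in 𝓝 a₀, Q (ρ a) 0 = 0) ∧
      ∀ᶠ a in 𝓝 a₀, ∀ v ξ, InducedRel S a v ξ ↔ ∃ ζ : (Fin r → ℝ) →L[ℝ] ℝ,
        fderiv ℝ ρ a v = Q (ρ a) ζ ∧ ξ = ζ.comp (fderiv ℝ ρ a) := by
  let j : A → A × (Fin k → ℝ) := fun a => (a, 0)
  have hj : ContDiff ℝ ∞ j := contDiff_id.prodMk contDiff_const
  let j' : (Fin k → ℝ) × (Fin r → ℝ) → ((Fin k → ℝ) × (Fin k → ℝ)) × (Fin r → ℝ) :=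
    fun u => ((0, u.1), u.2)
  have hj' : ContDiff ℝ ∞ j' := (contDiff_const.prodMk contDiff_fst).prodMk contDiff_snd
  have hU : IsOpen (j ⁻¹' e.source) := e.open_source.preimage hj.continuous
  have ha : a₀ ∈ j ⁻¹' e.source := h.mem_source
  have hU' : IsOpen (j' ⁻¹' e.target) := e.open_target.preimage hj'.continuous
  have h0 : (0 : (Fin k → ℝ) × (Fin r → ℝ)) ∈ j' ⁻¹' e.target := by
    have := e.map_source h.mem_source
    rw [h.map_base] at this
    exact this
  have he : ContDiffOn ℝ ∞ (e ∘ j) (j ⁻¹' e.source) :=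
    h.contDiffOn.comp hj.contDiffOn fun a ha => ha
  have he' : ContDiffOn ℝ ∞ (e.symm ∘ j') (j' ⁻¹' e.target) :=
    h.contDiffOn_symm.comp hj'.contDiffOn fun a ha => ha
  -- `ρ` and `α` are the coordinates `y` and `q` restricted to `c = 0`, and `β` is the inverse
  -- coordinate map, each as a global map with the correct germ.
  obtain ⟨ρ, hρ, hρe⟩ := exists_contDiff_eventuallyEq hU (contDiff_snd.comp_contDiffOn he) ha
  obtain ⟨α, hα, hαe⟩ := exists_contDiff_eventuallyEq hU
    ((contDiff_snd.comp contDiff_fst).comp_contDiffOn he) ha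
  obtain ⟨β, hβ, hβe⟩ := exists_contDiff_eventuallyEq hU' (contDiff_fst.comp_contDiffOn he') h0
  have hρ0 : ρ a₀ = 0 := by
    rw [hρe.self_of_nhds]; change (e (a₀, 0)).2 = 0; rw [h.map_base]; rfl
  have hα0 : α a₀ = 0 := by
    rw [hαe.self_of_nhds]; change (e (a₀, 0)).1.2 = 0; rw [h.map_base]; rfl
  have hβ0 : β 0 = a₀ := by
    rw [hβe.self_of_nhds]
    change (e.symm 0).1 = a₀
    rw [← h.map_base, e.left_inv h.mem_source]
  have hαρ : Filter.Tendsto (fun a => (α a, ρ a)) (𝓝 a₀) (𝓝 0) := by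
    have := (hα.continuous.prodMk hρ.continuous).tendsto a₀
    rwa [hα0, hρ0] at this
  have hβt : Filter.Tendsto β (𝓝 0) (𝓝 a₀) := by
    have := hβ.continuous.tendsto 0
    rwa [hβ0] at this
  refine ⟨ρ, α, β, hρ, hα, hβ, hρ0, hα0, hβ0, ?_, ?_, ?_, ?_⟩
  · filter_upwards [hρe, hαe, hαρ.eventually hβe, hU.mem_nhds ha] with a h1 h2 h3 h4
    rw [h3, h1, h2]
    have h5 : j' ((e (j a)).1.2, (e (j a)).2) = e (j a) :=
      Prod.ext (Prod.ext ((h.snd_eq_zero_iff _ h4).mp rfl).symm rfl) rfl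
    change (e.symm (j' ((e (j a)).1.2, (e (j a)).2))).1 = a
    rw [h5, e.left_inv h4]
  · filter_upwards [hβe, hβt.eventually hρe, hU'.mem_nhds h0] with u h1 h2 h3
    rw [h2, h1]
    have h4 : (e.symm (j' u)).2 = 0 := by
      rw [h.snd_eq_zero_iff _ (e.map_target h3), e.right_inv h3]
    change (e ((e.symm (j' u)).1, 0)).2 = u.2
    rw [← h4, Prod.mk.eta, e.right_inv h3]
  · filter_upwards [hρe, hU.mem_nhds ha] with a h1 h2
    rw [h1]; exact h.apply_zero h2
  · filter_upwards [hρe.eventually_nhds, hU.mem_nhds ha] with a h1 h2 v ξ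
    exact h.inducedRel_iff h2 (Filter.EventuallyEq.symm h1) v ξ

end IsNormalForm

theorem surjective_fderiv_of_rightInverse {E F : Type*} [NormedAddCommGroup E] [NormedSpace ℝ E]
    [NormedAddCommGroup F] [NormedSpace ℝ F] {f : E → F} (hf : ContDiff ℝ ∞ f)
    {G : Type*} [NormedAddCommGroup G] [NormedSpace ℝ G] {β : G × F → E} (hβ : ContDiff ℝ ∞ β)
    {u : G × F} (h : ∀ᶠ u in 𝓝 u, f (β u) = u.2) (w : G × F) :
    fderiv ℝ f (β u) (fderiv ℝ β u w) = w.2 := by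
  have h1 := ((hf.differentiable (by simp) (β u)).hasFDerivAt.comp u
    (hβ.differentiable (by simp) u).hasFDerivAt).unique
    (hasFDerivAt_snd.congr_of_eventuallyEq h)
  exact congrArg (fun A => A w) h1

/-- Poisson structures for which `c = 0` is coisotropic, with characteristic distribution of rank
`k`, and which induce the same Dirac structure on `c = 0` are locally isomorphic. -/
theorem exists_poisson_diffeo
    {S' : A × (Fin k → ℝ) → (A × (Fin k → ℝ) →L[ℝ] ℝ) →L[ℝ] A × (Fin k → ℝ)}
    (hS : IsPoissonNear S (a₀, 0)) (hC : IsCoisotropicNear S a₀)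
    (hS' : IsPoissonNear S' (a₀, 0)) (hC' : IsCoisotropicNear S' a₀)
    (hL : ∀ᶠ a in 𝓝 a₀, ∀ v ξ, InducedRel S a v ξ ↔ InducedRel S' a v ξ) :
    ∃ G : OpenPartialHomeomorph (A × (Fin k → ℝ)) (A × (Fin k → ℝ)),
      (a₀, 0) ∈ G.source ∧ G (a₀, 0) = (a₀, 0) ∧ ContDiffOn ℝ ∞ G G.source ∧
      ContDiffOn ℝ ∞ G.symm G.target ∧ (∀ x ∈ G.source, x.2 = 0 ↔ (G x).2 = 0) ∧
      ∀ x ∈ G.source, ∀ ξ : A × (Fin k → ℝ) →L[ℝ] ℝ,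
        fderiv ℝ G x (S x (ξ.comp (fderiv ℝ G x))) = S' (G x) ξ := by
  obtain ⟨r, e, Q, hN⟩ : ∃ r e Q, IsNormalForm (r := r) S a₀ e Q := by
    obtain ⟨r, e, Q, h1, h2, h3, h4, h5, h6⟩ := exists_normal_form hS hC
    exact ⟨r, e, Q, h1, h2, h3, h4, h5, h6⟩
  obtain ⟨r', e', Q', hN'⟩ : ∃ r e Q, IsNormalForm (r := r) S' a₀ e Q := by
    obtain ⟨r, e, Q, h1, h2, h3, h4, h5, h6⟩ := exists_normal_form hS' hC'
    exact ⟨r, e, Q, h1, h2, h3, h4, h5, h6⟩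
  obtain ⟨ρ, α, β, hρ, hα, hβ, hρ0, hα0, hβ0, hβα, hρβ, hQ0, hR⟩ := hN.exists_quotient
  obtain ⟨ρ', α', β', hρ', hα', hβ', hρ0', hα0', hβ0', hβα', hρβ', hQ0', hR'⟩ :=
    hN'.exists_quotient
  have hβt : Filter.Tendsto β (𝓝 0) (𝓝 a₀) := by
    have := hβ.continuous.tendsto 0
    rwa [hβ0] at this
  have hαρ : Filter.Tendsto (fun a => (α a, ρ a)) (𝓝 a₀) (𝓝 0) := by
    have := (hα.continuous.prodMk hρ.continuous).tendsto a₀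
    rwa [hα0, hρ0] at this
  have hαρ' : Filter.Tendsto (fun a => (α' a, ρ' a)) (𝓝 a₀) (𝓝 0) := by
    have := (hα'.continuous.prodMk hρ'.continuous).tendsto a₀
    rwa [hα0', hρ0'] at this
  have hsurj : ∀ᶠ a in 𝓝 a₀, Function.Surjective (fderiv ℝ ρ a) := by
    filter_upwards [hαρ.eventually hρβ.eventually_nhds, hβα] with a h1 h2 w
    have := surjective_fderiv_of_rightInverse hρ hβ h1 (0, w)
    rw [h2] at this
    exact ⟨_, this⟩
  have hsurj' : ∀ᶠ a in 𝓝 a₀, Function.Surjective (fderiv ℝ ρ' a) := by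
    filter_upwards [hαρ'.eventually hρβ'.eventually_nhds, hβα'] with a h1 h2 w
    have := surjective_fderiv_of_rightInverse hρ' hβ' h1 (0, w)
    rw [h2] at this
    exact ⟨_, this⟩
  have hcancel : ∀ {r : ℕ} {T : A →L[ℝ] (Fin r → ℝ)}, Function.Surjective T →
      ∀ {ζ η : (Fin r → ℝ) →L[ℝ] ℝ}, ζ.comp T = η.comp T → ζ = η := fun hT ζ η h => by
    ext1 w
    obtain ⟨v, rfl⟩ := hT w
    exact congrArg (fun A => A v) h
  -- A vector `v` is characteristic when `(v, 0)` lies in the induced structure. Since `dρ` is onto,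
  -- the covector `ζ` must then be zero, so `ker dρ` is the characteristic space; the same holds for
  -- `ρ'`, and the induced structures agree.
  have hker : ∀ᶠ a in 𝓝 a₀, ∀ v, fderiv ℝ ρ a v = 0 ↔ fderiv ℝ ρ' a v = 0 := by
    filter_upwards [hR, hR', hL, hQ0, hQ0', hsurj, hsurj'] with a h1 h2 h3 h4 h5 h6 h7 v
    have h8 : ∀ {r : ℕ} {T : A →L[ℝ] (Fin r → ℝ)} {q : ((Fin r → ℝ) →L[ℝ] ℝ) → (Fin r → ℝ)},
        q 0 = 0 → Function.Surjective T →
        (T v = 0 ↔ ∃ ζ : (Fin r → ℝ) →L[ℝ] ℝ, T v = q ζ ∧ 0 = ζ.comp T) := fun {r T q} hq hT => by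
      refine ⟨fun h => ⟨0, by rw [hq, h], by rw [ContinuousLinearMap.zero_comp]⟩, ?_⟩
      rintro ⟨ζ, h9, h10⟩
      have : ζ = 0 := hcancel hT (by rw [← h10, ContinuousLinearMap.zero_comp])
      rw [h9, this, hq]
    rw [h8 h4 h6, h8 h5 h7, ← h1, ← h2, h3]
  -- the induced map between the quotients
  let y : (Fin r → ℝ) → (Fin r' → ℝ) := fun b => ρ' (β (0, b))
  have hιd : ContDiff ℝ ∞ fun b : Fin r → ℝ => ((0, b) : (Fin k → ℝ) × (Fin r → ℝ)) :=
    contDiff_const.prodMk contDiff_id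
  have hι : Filter.Tendsto (fun b : Fin r → ℝ => ((0, b) : (Fin k → ℝ) × (Fin r → ℝ))) (𝓝 0)
      (𝓝 0) := hιd.continuous.tendsto 0
  have hy : ContDiff ℝ ∞ y := hρ'.comp (hβ.comp hιd)
  have hy0 : y 0 = 0 := by
    change ρ' (β 0) = 0
    rw [hβ0, hρ0']
  -- The `q` directions lie in `ker dρ`, hence in `ker dρ'`, so in the coordinates `(q, y)` the map
  -- `ρ'` does not depend on `q`.
  have hρ'β : ∀ᶠ u in 𝓝 (0 : (Fin k → ℝ) × (Fin r → ℝ)), ρ' (β u) = y u.2 := by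
    refine eventually_eq_of_fderiv_single_eq_zero (hρ'.comp hβ) ?_
    filter_upwards [hρβ.eventually_nhds, hβt.eventually hker] with u h1 h2 i
    rw [fderiv_fun_comp u (hρ'.differentiable (by simp) _) (hβ.differentiable (by simp) _)]
    change fderiv ℝ ρ' (β u) (fderiv ℝ β u (Pi.single i 1, 0)) = 0
    rw [← h2, surjective_fderiv_of_rightInverse hρ hβ h1]
  have hρy : ∀ᶠ a in 𝓝 a₀, ρ' a = y (ρ a) := by
    filter_upwards [hβα, hαρ.eventually hρ'β] with a h1 h2
    rwa [h1] at h2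
  have hDy : ∀ᶠ a in 𝓝 a₀, ∀ v, fderiv ℝ ρ' a v = fderiv ℝ y (ρ a) (fderiv ℝ ρ a v) := by
    filter_upwards [hρy.eventually_nhds] with a h1 v
    have h2 : ρ' =ᶠ[𝓝 a] y ∘ ρ := h1
    rw [h2.fderiv_eq, fderiv_comp a (hy.differentiable (by simp) _)
      (hρ.differentiable (by simp) _)]
    rfl
  -- Injective because `dρ` and `dρ'` have the same kernel, surjective because `dρ'` is onto; the
  -- equality of `r` and `r'` need not be known in advance.
  have hbij : Function.Bijective (fderiv ℝ y 0) := by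
    have h1 := hDy.self_of_nhds
    rw [hρ0] at h1
    constructor
    · refine (injective_iff_map_eq_zero _).mpr fun w hw => ?_
      obtain ⟨v, rfl⟩ := hsurj.self_of_nhds w
      rw [← h1] at hw
      exact (hker.self_of_nhds v).mpr hw
    · intro w
      obtain ⟨v, rfl⟩ := hsurj'.self_of_nhds w
      exact ⟨_, (h1 v).symm⟩
  -- Lift `Q(y^*η)` through the submersion `ρ` to a vector `v`. The pair formed by `v` and the
  -- pullback of `η` lies in the common induced structure, so its description through `ρ'` yields a
  -- covector `ζ`, equal to `η` because `dρ'` is onto.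
  have hyQ : ∀ᶠ b in 𝓝 (0 : Fin r → ℝ), ∀ η : (Fin r' → ℝ) →L[ℝ] ℝ,
      fderiv ℝ y b (Q b (η.comp (fderiv ℝ y b))) = Q' (y b) η := by
    filter_upwards [hι.eventually (hβt.eventually hR), hι.eventually (hβt.eventually hR'),
      hι.eventually (hβt.eventually hL), hι.eventually (hβt.eventually hsurj),
      hι.eventually (hβt.eventually hsurj'), hι.eventually (hβt.eventually hDy),
      hι.eventually (hβt.eventually hρy), hι.eventually hρβ] with b h1 h2 h3 h4 h5 h6 h7 h8 η
    change ρ (β (0, b)) = b at h8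
    rw [h8] at h1 h6 h7
    rw [h7] at h2
    obtain ⟨v, hv⟩ := h4 (Q b (η.comp (fderiv ℝ y b)))
    have h9 : η.comp (fderiv ℝ ρ' (β (0, b))) =
        (η.comp (fderiv ℝ y b)).comp (fderiv ℝ ρ (β (0, b))) := by
      ext1 w
      exact congrArg η (h6 w)
    obtain ⟨ζ, h10, h11⟩ := (h2 v _).mp ((h3 v _).mp ((h1 v _).mpr ⟨_, hv, h9⟩))
    rw [← hv, ← h6, h10, hcancel h5 h11]
  -- the diffeomorphism
  let g : ((Fin k → ℝ) × (Fin k → ℝ)) × (Fin r → ℝ) → ((Fin k → ℝ) × (Fin k → ℝ)) × (Fin r' → ℝ) :=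
    fun u => (u.1, y u.2)
  have hg : ContDiff ℝ ∞ g := contDiff_fst.prodMk (hy.comp contDiff_snd)
  have hg0 : g 0 = 0 := Prod.ext rfl hy0
  have hgd : ∀ u w, fderiv ℝ g u w = (w.1, fderiv ℝ y u.2 w.2) := fun u w => by
    have h1 : HasFDerivAt g _ u :=
      hasFDerivAt_fst.prodMk ((hy.differentiable (by simp) u.2).hasFDerivAt.comp u hasFDerivAt_snd)
    rw [h1.fderiv]; rfl
  obtain ⟨W, hW, hWo, h0W⟩ := eventually_nhds_iff.mp hyQ
  let U : Set (A × (Fin k → ℝ)) :=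
    e.source ∩ e ⁻¹' (g ⁻¹' e'.target ∩ Prod.snd ⁻¹' W)
  have hUo : IsOpen U := e.continuousOn.isOpen_inter_preimage e.open_source
    ((e'.open_target.preimage hg.continuous).inter (hWo.preimage continuous_snd))
  have h0' : (0 : ((Fin k → ℝ) × (Fin k → ℝ)) × (Fin r' → ℝ)) ∈ e'.target := by
    have := e'.map_source hN'.mem_source
    rwa [hN'.map_base] at this
  have hxU : (a₀, 0) ∈ U := by
    refine ⟨hN.mem_source, ?_, ?_⟩
    · change g (e (a₀, 0)) ∈ e'.target
      rw [hN.map_base, hg0]; exact h0'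
    · change (e (a₀, 0)).2 ∈ W
      rw [hN.map_base]; exact h0W
  let f : A × (Fin k → ℝ) → A × (Fin k → ℝ) := fun x => e'.symm (g (e x))
  have hf : ContDiffOn ℝ ∞ f U := hN'.contDiffOn_symm.comp
    (hg.comp_contDiffOn (hN.contDiffOn.mono Set.inter_subset_left)) fun x hx => hx.2.1
  have hfx : f (a₀, 0) = (a₀, 0) := by
    change e'.symm (g (e (a₀, 0))) = _
    rw [hN.map_base, hg0, ← hN'.map_base, e'.left_inv hN'.mem_source]
  have hfs : ∀ x ∈ U, f x ∈ e'.source := fun x hx => e'.map_target hx.2.1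
  have hef : ∀ x ∈ U, e' (f x) = g (e x) := fun x hx => e'.right_inv hx.2.1
  have hfd : ∀ x ∈ U, ∀ v, fderiv ℝ e' (f x) (fderiv ℝ f x v) =
      fderiv ℝ g (e x) (fderiv ℝ e x v) := fun x hx v => by
    have h1 : HasFDerivAt f (fderiv ℝ f x) x :=
      ((hf.contDiffAt (hUo.mem_nhds hx)).differentiableAt (by simp)).hasFDerivAt
    have h2 : HasFDerivAt e' (fderiv ℝ e' (f x)) (f x) :=
      ((hN'.contDiffOn.contDiffAt (e'.open_source.mem_nhds (hfs x hx))).differentiableAt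
        (by simp)).hasFDerivAt
    have h3 : HasFDerivAt e (fderiv ℝ e x) x :=
      ((hN.contDiffOn.contDiffAt (e.open_source.mem_nhds hx.1)).differentiableAt
        (by simp)).hasFDerivAt
    have h4 : HasFDerivAt g (fderiv ℝ g (e x)) (e x) :=
      (hg.differentiable (by simp) _).hasFDerivAt
    have h5 := (h2.comp x h1).unique ((h4.comp x h3).congr_of_eventuallyEq
      (by filter_upwards [hUo.mem_nhds hx] with z hz using hef z hz))
    exact congrArg (fun A => A v) h5
  have hbijf : Function.Bijective (fderiv ℝ f (a₀, 0)) := by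
    obtain ⟨D, hD⟩ := isInvertible_fderiv_of_contDiffOn e hN.contDiffOn hN.contDiffOn_symm
      hN.mem_source
    obtain ⟨D', hD'⟩ := isInvertible_fderiv_of_contDiffOn e' hN'.contDiffOn hN'.contDiffOn_symm
      hN'.mem_source
    have h1 := hfd _ hxU
    rw [hfx, hN.map_base, ← hD, ← hD'] at h1
    have h2 : ⇑(fderiv ℝ f (a₀, 0)) = D'.symm ∘ fderiv ℝ g 0 ∘ D := by
      funext v
      exact D'.injective ((h1 v).trans (D'.apply_symm_apply _).symm)
    rw [h2]
    refine D'.symm.bijective.comp (Function.Bijective.comp ?_ D.bijective)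
    have h3 : ⇑(fderiv ℝ g 0) = Prod.map id (fderiv ℝ y 0) := funext fun w => hgd 0 w
    rw [h3]
    exact Function.bijective_id.prodMap hbij
  have hinv : (fderiv ℝ f (a₀, 0)).IsInvertible :=
    ⟨(LinearEquiv.ofBijective (fderiv ℝ f (a₀, 0)).toLinearMap hbijf).toContinuousLinearEquiv, rfl⟩
  have : CompleteSpace A := FiniteDimensional.complete ℝ A
  obtain ⟨G, hxG, hGU, hGf, hGs, -⟩ := exists_smooth_openPartialHomeomorph hUo hf hxU hinv
  have hGf' : (G : A × (Fin k → ℝ) → A × (Fin k → ℝ)) = f := funext hGf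
  refine ⟨G, hxG, by rw [hGf, hfx], by rw [hGf']; exact hf.mono hGU, hGs, fun x hx => ?_,
    fun x hx ξ => ?_⟩
  · rw [hGf, hN.snd_eq_zero_iff x (hGU hx).1, hN'.snd_eq_zero_iff _ (hfs x (hGU hx)),
      hef x (hGU hx)]
  · rw [hGf']
    obtain ⟨D', hD'⟩ := isInvertible_fderiv_of_contDiffOn e' hN'.contDiffOn hN'.contDiffOn_symm
      (hfs x (hGU hx))
    have hD'v : ∀ v, D' v = fderiv ℝ e' (f x) v := fun v => by rw [← hD']; rfl
    -- Both push-forward formulas are evaluated on this covector in normal form coordinates. The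
    -- `(p, q)` parts agree because `dg` is the identity there, the `y` parts by `hyQ`.
    let θ := ξ.comp (D'.symm : ((Fin k → ℝ) × (Fin k → ℝ)) × (Fin r' → ℝ) →L[ℝ] _)
    have hθ : ξ = θ.comp (fderiv ℝ e' (f x)) := by
      refine ContinuousLinearMap.ext fun v => ?_
      change ξ v = ξ (D'.symm (fderiv ℝ e' (f x) v))
      rw [← hD'v, D'.symm_apply_apply]
    have h1 : ξ.comp (fderiv ℝ f x) = (θ.comp (fderiv ℝ g (e x))).comp (fderiv ℝ e x) := by
      refine ContinuousLinearMap.ext fun v => ?_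
      rw [hθ]
      change θ (fderiv ℝ e' (f x) (fderiv ℝ f x v)) = θ (fderiv ℝ g (e x) (fderiv ℝ e x v))
      rw [hfd x (hGU hx)]
    refine D'.injective ?_
    rw [hD'v, hD'v, hfd x (hGU hx), h1, hN.push x (hGU hx).1, hgd]
    conv_rhs => rw [hθ, hN'.push _ (hfs x (hGU hx)), hef x (hGU hx)]
    refine Prod.ext (Prod.ext ?_ ?_) ?_
    · funext i
      simp only [ContinuousLinearMap.comp_apply, hgd, map_zero]
    · funext i
      simp only [ContinuousLinearMap.comp_apply, hgd, map_zero]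
    · change fderiv ℝ y (e x).2 (Q (e x).2 _) = Q' (y (e x).2) _
      rw [← hW _ (hGU hx).2.2]
      congr 2
      ext1 w
      simp only [ContinuousLinearMap.comp_apply, hgd, ContinuousLinearMap.inr_apply]

end Comparison

/-! ## Bivectors given by frames of their graphs -/

section Frame

set_option synthInstance.maxHeartbeats 200000

variable {F : Type*} [NormedAddCommGroup F] [NormedSpace ℝ F] [FiniteDimensional ℝ F]
  {ι : Type*} [Fintype ι]

/-- The exterior derivative of the one-form `θ`. -/
def curl (θ : F → F →L[ℝ] ℝ) (u : F) : F →L[ℝ] F →L[ℝ] ℝ :=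
  fderiv ℝ θ u - (fderiv ℝ θ u).flip

theorem curl_apply (θ : F → F →L[ℝ] ℝ) (u v w : F) :
    curl θ u v w = fderiv ℝ θ u v w - fderiv ℝ θ u w v := rfl

theorem curl_skew (θ : F → F →L[ℝ] ℝ) (u v w : F) : curl θ u v w = -curl θ u w v := by
  rw [curl_apply, curl_apply]; ring

theorem contDiff_curl {θ : F → F →L[ℝ] ℝ} (hθ : ContDiff ℝ ∞ θ) : ContDiff ℝ ∞ (curl θ) := by
  have h : ContDiff ℝ ∞ (fderiv ℝ θ) := hθ.fderiv_right (by simp)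
  have h2 : ∀ v w, ContDiff ℝ ∞ fun u => fderiv ℝ θ u v w := fun v w =>
    (h.clm_apply contDiff_const).clm_apply contDiff_const
  refine contDiff_clm_apply_iff.mpr fun v => contDiff_clm_apply_iff.mpr fun w => ?_
  exact (h2 v w).sub (h2 w v)

/-- The exterior derivative of an exact form vanishes. -/
theorem fderiv_curl_cyclic {θ : F → F →L[ℝ] ℝ} (hθ : ContDiff ℝ ∞ θ) (u a b c : F) :
    fderiv ℝ (curl θ) u a b c + fderiv ℝ (curl θ) u b c a + fderiv ℝ (curl θ) u c a b = 0 := by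
  have h : ContDiff ℝ ∞ (fderiv ℝ θ) := hθ.fderiv_right (by simp)
  have h1 := (h.differentiable (by simp) u).hasFDerivAt
  have h2 := ((contDiff_curl hθ).differentiable (by simp) u).hasFDerivAt
  have h3 : ∀ a b c, fderiv ℝ (curl θ) u a b c = fderiv ℝ (fderiv ℝ θ) u a b c -
      fderiv ℝ (fderiv ℝ θ) u a c b := fun a b c => by
    have h4 : ∀ b c, HasFDerivAt (fun u => fderiv ℝ θ u b c) _ u := fun b c =>
      (h1.clm_apply (hasFDerivAt_const b u)).clm_apply (hasFDerivAt_const c u)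
    have h5 : HasFDerivAt (fun u => curl θ u b c) _ u :=
      (h2.clm_apply (hasFDerivAt_const b u)).clm_apply (hasFDerivAt_const c u)
    have h6 := congrArg (fun A => A a) (h5.unique ((h4 b c).sub (h4 c b)))
    simpa using h6
  have h4 : ∀ a b, fderiv ℝ (fderiv ℝ θ) u a b = fderiv ℝ (fderiv ℝ θ) u b a := fun a b =>
    (hθ.contDiffAt.isSymmSndFDerivAt (by
      simp only [minSmoothness_of_isRCLikeNormedField]
      exact WithTop.coe_le_coe.mpr (le_top : (2 : ℕ∞) ≤ ⊤))) a b
  rw [h3, h3, h3, h4 a b, h4 c a, h4 b c]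
  ring

theorem contDiff_frameMap {V : Type*} [NormedAddCommGroup V] [NormedSpace ℝ V] {σ : ι → F → V}
    (h : ∀ i, ContDiff ℝ ∞ (σ i)) : ContDiff ℝ ∞ fun u => ∑ i,
      (ContinuousLinearMap.proj i : (ι → ℝ) →L[ℝ] ℝ).smulRight (σ i u) :=
  ContDiff.sum fun i _ => contDiff_const.smulRight (h i)

variable {Y : ι → F → F} {ξ : ι → F → F →L[ℝ] ℝ} {θ : F → F →L[ℝ] ℝ}
  {u₀ : F}

/-- The gauge transformation by `dθ` of an involutive isotropic family is, where it is
transversal, the graph of a Poisson bivector. -/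
theorem exists_sharp_of_frame (hY : ∀ i, ContDiff ℝ ∞ (Y i)) (hξ : ∀ i, ContDiff ℝ ∞ (ξ i))
    (hθ : ContDiff ℝ ∞ θ) (hiso : ∀ᶠ u in 𝓝 u₀, ∀ i j, ξ i u (Y j u) + ξ j u (Y i u) = 0)
    (hT : ∀ᶠ u in 𝓝 u₀, ∀ i j l,
      ξ l u (fderiv ℝ (Y j) u (Y i u)) + fderiv ℝ (ξ j) u (Y i u) (Y l u) +
      (ξ i u (fderiv ℝ (Y l) u (Y j u)) + fderiv ℝ (ξ l) u (Y j u) (Y i u)) +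
      (ξ j u (fderiv ℝ (Y i) u (Y l u)) + fderiv ℝ (ξ i) u (Y l u) (Y j u)) = 0)
    (hcard : Fintype.card ι = Module.finrank ℝ F)
    (hinj : ∀ t : ι → ℝ, ∑ i, t i • (ξ i u₀ + curl θ u₀ (Y i u₀)) = 0 → t = 0) :
    ∃ S : F → (F →L[ℝ] ℝ) →L[ℝ] F, IsPoissonNear S u₀ ∧ ∀ᶠ u in 𝓝 u₀, ∀ v η, S u η = v ↔
      ∃ t : ι → ℝ, v = ∑ i, t i • Y i u ∧ η = ∑ i, t i • (ξ i u + curl θ u (Y i u)) := by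
  let β : ι → F → F →L[ℝ] ℝ := fun i u => ξ i u + curl θ u (Y i u)
  have hβ : ∀ i, ContDiff ℝ ∞ (β i) := fun i => (hξ i).add ((contDiff_curl hθ).clm_apply (hY i))
  -- The gauged family spans the image of `(S₁, S₂)` in vectors and covectors. Where `S₂` is
  -- invertible this is the graph of `S₁ ∘ S₂⁻¹`.
  let S₁ : F → (ι → ℝ) →L[ℝ] F := fun u => ∑ i,
    (ContinuousLinearMap.proj i : (ι → ℝ) →L[ℝ] ℝ).smulRight (Y i u)
  let S₂ : F → (ι → ℝ) →L[ℝ] (F →L[ℝ] ℝ) := fun u => ∑ i,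
    (ContinuousLinearMap.proj i : (ι → ℝ) →L[ℝ] ℝ).smulRight (β i u)
  have hS₁ : ContDiff ℝ ∞ S₁ := contDiff_frameMap hY
  have hS₂ : ContDiff ℝ ∞ S₂ := contDiff_frameMap hβ
  have hS₁a : ∀ u t, S₁ u t = ∑ i, t i • Y i u := fun u t => by simp [S₁, sum_apply]
  have hS₂a : ∀ u t, S₂ u t = ∑ i, t i • β i u := fun u t => by
    simp only [S₂, sum_apply, ContinuousLinearMap.smulRight_apply, ContinuousLinearMap.proj_apply]
  have hfin : Module.finrank ℝ (ι → ℝ) = Module.finrank ℝ (F →L[ℝ] ℝ) := by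
    rw [Module.finrank_fintype_fun_eq_card, hcard,
      ← (LinearMap.toContinuousLinearMap (𝕜 := ℝ) (E := F) (F' := ℝ)).finrank_eq]
    exact Subspace.dual_finrank_eq.symm
  have : CompleteSpace F := FiniteDimensional.complete ℝ F
  obtain ⟨e₀, he₀⟩ : ∃ e₀ : (ι → ℝ) ≃L[ℝ] (F →L[ℝ] ℝ), (e₀ : (ι → ℝ) →L[ℝ] _) = S₂ u₀ := by
    have h1 : Function.Injective (S₂ u₀) := (injective_iff_map_eq_zero _).mpr fun t ht => by
      rw [hS₂a] at ht; exact hinj t ht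
    exact ⟨(LinearEquiv.ofInjectiveOfFinrankEq (S₂ u₀).toLinearMap h1 hfin).toContinuousLinearEquiv,
      rfl⟩
  let U : Set F := S₂ ⁻¹' Set.range ((↑) : ((ι → ℝ) ≃L[ℝ] (F →L[ℝ] ℝ)) → _)
  have hU : IsOpen U := (ContinuousLinearEquiv.isOpen).preimage hS₂.continuous
  have hu₀ : u₀ ∈ U := ⟨e₀, he₀⟩
  have hsm : ContDiffOn ℝ ∞ (fun u => (S₁ u).comp (S₂ u).inverse) U := fun u hu => by
    obtain ⟨e, he⟩ := hu
    have h1 : ContDiffAt ℝ ∞ ContinuousLinearMap.inverse (S₂ u) := by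
      rw [← he]; exact contDiffAt_map_inverse e
    exact (hS₁.contDiffAt.clm_comp (h1.comp u hS₂.contDiffAt)).contDiffWithinAt
  obtain ⟨S, hS, hSe⟩ := exists_contDiff_eventuallyEq hU hsm hu₀
  have hgraph : ∀ᶠ u in 𝓝 u₀, ∀ v η, S u η = v ↔
      ∃ t : ι → ℝ, v = ∑ i, t i • Y i u ∧ η = ∑ i, t i • β i u := by
    filter_upwards [hSe, hU.mem_nhds hu₀] with u h1 ⟨e, he⟩ v η
    have h2 : ∀ t, e t = ∑ i, t i • β i u := fun t => by rw [← hS₂a, ← he]; rfl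
    rw [h1]
    change S₁ u ((S₂ u).inverse η) = v ↔ _
    rw [← he, ContinuousLinearMap.inverse_equiv]
    constructor
    · rintro rfl
      exact ⟨e.symm η, hS₁a _ _, by rw [← h2, e.apply_symm_apply]⟩
    · rintro ⟨t, rfl, rfl⟩
      rw [← h2, ← hS₁a]
      exact congrArg (S₁ u) (e.symm_apply_apply t)
  have hSβ : ∀ᶠ u in 𝓝 u₀, ∀ i, S u (β i u) = Y i u := by
    classical
    filter_upwards [hgraph] with u h1 i
    refine (h1 _ _).mpr ⟨Pi.single i 1, ?_, ?_⟩ <;> simp [Pi.single_apply, ite_smul]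
  have hspan : ∀ᶠ u in 𝓝 u₀, ∀ η, ∃ t : ι → ℝ, η = ∑ i, t i • β i u := by
    filter_upwards [hgraph] with u h1 η
    obtain ⟨t, -, ht⟩ := (h1 _ η).mp rfl
    exact ⟨t, ht⟩
  have hβiso : ∀ᶠ u in 𝓝 u₀, ∀ i j, β i u (Y j u) = -β j u (Y i u) := by
    filter_upwards [hiso] with u h1 i j
    have h2 := h1 i j
    have h3 := curl_skew θ u (Y i u) (Y j u)
    change ξ i u (Y j u) + curl θ u (Y i u) (Y j u) = -(ξ j u (Y i u) + curl θ u (Y j u) (Y i u))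
    linarith
  have hskew : ∀ᶠ u in 𝓝 u₀, ∀ η ζ : F →L[ℝ] ℝ, ζ (S u η) = -η (S u ζ) := by
    filter_upwards [hSβ, hspan, hβiso] with u h1 h2 h3 η ζ
    obtain ⟨t, rfl⟩ := h2 η
    obtain ⟨s, rfl⟩ := h2 ζ
    simp only [map_sum, map_smul, h1, sum_apply, smul_apply, smul_eq_mul, Finset.mul_sum,
      ← Finset.sum_neg_distrib]
    rw [Finset.sum_comm]
    refine Finset.sum_congr rfl fun i _ => Finset.sum_congr rfl fun j _ => ?_
    rw [h3 i j]; ring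
  refine ⟨S, ⟨hS, hskew, ?_⟩, hgraph⟩
  -- Differentiate `S βⱼ = Yⱼ` along `Yᵢ` and pair with `β_l`. By skewness the terms in which `dθ`
  -- meets a derivative of `Yⱼ` cancel, leaving the Courant term of the ungauged family and the
  -- derivative of `dθ`. In the cyclic sum these vanish by `hT` and by `d(dθ) = 0`.
  have hJ : ∀ᶠ u in 𝓝 u₀, ∀ i j l, β l u (fderiv ℝ S u (Y i u) (β j u)) =
      ξ l u (fderiv ℝ (Y j) u (Y i u)) + fderiv ℝ (ξ j) u (Y i u) (Y l u) +
        fderiv ℝ (curl θ) u (Y i u) (Y j u) (Y l u) := by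
    filter_upwards [hSβ.eventually_nhds, hskew] with u h1 h2 i j l
    have hd : ∀ {V : Type _} [NormedAddCommGroup V] [NormedSpace ℝ V] {f : F → V},
        ContDiff ℝ ∞ f → HasFDerivAt f (fderiv ℝ f u) u := fun hf =>
      (hf.differentiable (by simp) u).hasFDerivAt
    have h3 : HasFDerivAt (fun u => S u (β j u)) _ u := (hd hS).clm_apply (hd (hβ j))
    have h4 := h3.unique ((hd (hY j)).congr_of_eventuallyEq
      (by filter_upwards [h1] with z hz using hz j))
    have h5 : S u (fderiv ℝ (β j) u (Y i u)) + fderiv ℝ S u (Y i u) (β j u) =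
        fderiv ℝ (Y j) u (Y i u) := by
      have := congrArg (fun A => A (Y i u)) h4
      simpa using this
    have h6 : HasFDerivAt (β j) _ u := (hd (hξ j)).add ((hd (contDiff_curl hθ)).clm_apply (hd (hY j)))
    have h7 : fderiv ℝ (β j) u (Y i u) (Y l u) = fderiv ℝ (ξ j) u (Y i u) (Y l u) +
        (curl θ u (fderiv ℝ (Y j) u (Y i u)) (Y l u) +
          fderiv ℝ (curl θ) u (Y i u) (Y j u) (Y l u)) := by
      rw [h6.fderiv]; simp
    have h8 : β l u (S u (fderiv ℝ (β j) u (Y i u))) = -fderiv ℝ (β j) u (Y i u) (Y l u) := by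
      rw [h2, h1.self_of_nhds]
    have h9 := congrArg (β l u) h5
    rw [map_add, h8, h7] at h9
    have h10 : β l u (fderiv ℝ (Y j) u (Y i u)) = ξ l u (fderiv ℝ (Y j) u (Y i u)) -
        curl θ u (fderiv ℝ (Y j) u (Y i u)) (Y l u) := by
      have := curl_skew θ u (Y l u) (fderiv ℝ (Y j) u (Y i u))
      change ξ l u _ + curl θ u (Y l u) _ = _
      rw [this]; ring
    rw [h10] at h9
    linarith
  filter_upwards [hSβ, hspan, hJ, hT] with u h1 h2 h3 h4 η₁ η₂ η₃
  obtain ⟨r, rfl⟩ := h2 η₁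
  obtain ⟨s, rfl⟩ := h2 η₂
  obtain ⟨t, rfl⟩ := h2 η₃
  have h5 : ∀ i j l, β l u (fderiv ℝ S u (Y i u) (β j u)) + β i u (fderiv ℝ S u (Y j u) (β l u)) +
      β j u (fderiv ℝ S u (Y l u) (β i u)) = 0 := fun i j l => by
    rw [h3, h3, h3]
    have h6 := h4 i j l
    have h7 := fderiv_curl_cyclic hθ u (Y i u) (Y j u) (Y l u)
    linarith
  have h6 : ∀ r s t : ι → ℝ, (∑ l, t l • β l u) (fderiv ℝ S u (S u (∑ i, r i • β i u))
      (∑ j, s j • β j u)) =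
      ∑ i, ∑ j, ∑ l, r i * s j * t l * β l u (fderiv ℝ S u (Y i u) (β j u)) := fun r s t => by
    simp only [map_sum, map_smul, h1, sum_apply, smul_apply, smul_eq_mul, Finset.mul_sum]
    rw [Finset.sum_comm]
    refine Finset.sum_congr rfl fun i _ => Finset.sum_congr rfl fun j _ =>
      Finset.sum_congr rfl fun l _ => ?_
    ring
  rw [h6, h6, h6]
  -- Cyclic relabelling of the summation indices, so that the three triple sums share the
  -- coefficient `rᵢ sⱼ t_l`.
  have h7 : ∀ g : ι → ι → ι → ℝ, ∑ i, ∑ j, ∑ l, g i j l = ∑ l, ∑ i, ∑ j, g i j l := fun g =>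
    (Finset.sum_congr rfl fun i _ => Finset.sum_comm).trans Finset.sum_comm
  obtain ⟨B, hB⟩ : ∃ B : ι → ι → ι → ℝ, ∀ i j l, β l u (fderiv ℝ S u (Y i u) (β j u)) = B i j l :=
    ⟨_, fun _ _ _ => rfl⟩
  simp only [hB] at h5 ⊢
  rw [h7 fun i j l => s i * t j * r l * B i j l,
    (h7 fun i j l => t i * r j * s l * B i j l).trans (h7 _),
    ← Finset.sum_add_distrib, ← Finset.sum_add_distrib]
  refine Finset.sum_eq_zero fun i _ => ?_
  rw [← Finset.sum_add_distrib, ← Finset.sum_add_distrib]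
  refine Finset.sum_eq_zero fun j _ => ?_
  rw [← Finset.sum_add_distrib, ← Finset.sum_add_distrib]
  refine Finset.sum_eq_zero fun l _ => ?_
  linear_combination r i * s j * t l * h5 i j l

end Frame

/-! ## Pulling back vector fields and one-forms to a vector space -/

section Pullback

variable {E H : Type*} [NormedAddCommGroup E] [NormedSpace ℝ E] [TopologicalSpace H]
  {I : ModelWithCorners ℝ E H} {N : Type*} [TopologicalSpace N] [ChartedSpace H N]
  [IsManifold I ∞ N] {F : Type*} [NormedAddCommGroup F] [NormedSpace ℝ F]
  [FiniteDimensional ℝ F] {g : F → N} {y : F}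

theorem contDiffAt_clm_of_apply {T Z : Type*} [NormedAddCommGroup T] [NormedSpace ℝ T]
    [NormedAddCommGroup Z] [NormedSpace ℝ Z] {f : T → F →L[ℝ] Z} {x : T}
    (h : ∀ v, ContDiffAt ℝ ∞ (fun z => f z v) x) : ContDiffAt ℝ ∞ f x := by
  let b := Module.finBasis ℝ F
  have h1 : f = fun z => ∑ i, (LinearMap.toContinuousLinearMap (b.coord i)).smulRight
      (f z (b i)) := by
    funext z
    refine ContinuousLinearMap.coe_injective (b.ext fun j => ?_)
    simp [Finsupp.single_apply, ite_smul]
  rw [h1]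
  exact ContDiffAt.sum fun i _ => contDiffAt_const.smulRight (h (b i))

theorem contMDiffAt_mfderiv_apply (hg : ContMDiffAt 𝓘(ℝ, F) I ∞ g y) (w : F) :
    ContMDiffAt 𝓘(ℝ, F) I.tangent ∞
      (fun z => (⟨g z, mfderiv 𝓘(ℝ, F) I g z w⟩ : TangentBundle I N)) y := by
  have : IsManifold I 1 N := IsManifold.of_le (n := ∞) (by simp)
  have h1 : ContMDiffAt 𝓘(ℝ, F) 𝓘(ℝ, F →L[ℝ] E) ∞
      (inTangentCoordinates 𝓘(ℝ, F) I id g (fun z => mfderiv 𝓘(ℝ, F) I g z) y) y :=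
    hg.mfderiv_const (by simp)
  have h2 : ContMDiffAt 𝓘(ℝ, F) 𝓘(ℝ, F).tangent ∞
      (fun z => (⟨z, w⟩ : TangentBundle 𝓘(ℝ, F) F)) y :=
    contMDiffAt_vectorSpace_iff_contDiffAt.mpr contDiffAt_const
  exact ContMDiffAt.clm_apply_of_inCoordinates h1 h2 hg

/-- The covectors are given along `g` only, not by a one-form on `N`. The canonical one-form
requires this, its value at a point of `T*N` being that point composed with the differential of the
projection. -/
theorem contDiffAt_comp_mfderiv (hg : ContMDiffAt 𝓘(ℝ, F) I ∞ g y)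
    {φ : ∀ z, TangentSpace I (g z) →L[ℝ] ℝ}
    (hφ : ContMDiffAt 𝓘(ℝ, F) (I.prod 𝓘(ℝ, E →L[ℝ] ℝ)) ∞
      (fun z => (⟨g z, φ z⟩ : CotangentBundle I N)) y) :
    ContDiffAt ℝ ∞ (fun z => ((φ z).comp (mfderiv 𝓘(ℝ, F) I g z) : F →L[ℝ] ℝ)) y := by
  refine contDiffAt_clm_of_apply fun w => ?_
  have h1 := ContMDiffAt.clm_bundle_apply (E₂ := Bundle.Trivial N ℝ) hφ (contMDiffAt_mfderiv_apply hg w)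
  exact (contMDiffAt_totalSpace.mp h1).2.contDiffAt


/-- Composing a one-form along `g` with the differential of `g`. -/
def formPullback (g : F → N) (α : ∀ x : N, TangentSpace I x →L[ℝ] ℝ) (z : F) : F →L[ℝ] ℝ :=
  (α (g z)).comp (mfderiv 𝓘(ℝ, F) I g z)

theorem contDiffAt_formPullback (hg : ContMDiffAt 𝓘(ℝ, F) I ∞ g y)
    {α : ∀ x : N, TangentSpace I x →L[ℝ] ℝ} {U : Set N} (hα : SmoothOneFormOn I α U)
    (hU : U ∈ 𝓝 (g y)) : ContDiffAt ℝ ∞ (formPullback g α) y :=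
  contDiffAt_comp_mfderiv hg ((hα.contMDiffAt hU).comp y hg)

/-- The exterior derivative of a one-form commutes with pullback. -/
theorem extDerivOneForm_mfderiv [I.Boundaryless] (hg : ContMDiffAt 𝓘(ℝ, F) I ∞ g y)
    {α : ∀ x : N, TangentSpace I x →L[ℝ] ℝ}
    (hα : DifferentiableAt ℝ (oneFormInChart I α (g y)) (extChartAt I (g y) (g y))) (u v : F) :
    extDerivOneForm I α (g y) (mfderiv 𝓘(ℝ, F) I g y u) (mfderiv 𝓘(ℝ, F) I g y v) =
      curl (formPullback g α) y u v := by
  set x := g y with hx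
  let h : F → E := fun z => extChartAt I x (g z)
  let a := oneFormInChart I α x
  have hsrc : ∀ᶠ z in 𝓝 y, g z ∈ (extChartAt I x).source :=
    hg.continuousAt.eventually (extChartAt_source_mem_nhds x)
  have hh : ContDiffAt ℝ ∞ h y :=
    ((contMDiffAt_extChartAt (n := ∞)).comp y hg).contDiffAt
  have hgd : ∀ᶠ z in 𝓝 y, MDifferentiableAt 𝓘(ℝ, F) I g z := by
    filter_upwards [(contMDiffAt_iff_contMDiffAt_nhds (n := 1) (by simp)).mp (hg.of_le (by simp))] with z hz
    exact hz.mdifferentiableAt (by simp)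
  have hhd : ∀ᶠ z in 𝓝 y, DifferentiableAt ℝ h z ∧ fderiv ℝ h z =
      (mfderiv I 𝓘(ℝ, E) (extChartAt I x) (g z)).comp (mfderiv 𝓘(ℝ, F) I g z) := by
    filter_upwards [hsrc, hgd] with z h1 h2
    have h3 : MDifferentiableAt I 𝓘(ℝ, E) (extChartAt I x) (g z) :=
      (contMDiffAt_extChartAt' (n := 1) (by rwa [extChartAt_source] at h1)).mdifferentiableAt (by simp)
    have h4 := mfderiv_comp z h3 h2
    rw [mfderiv_eq_fderiv] at h4
    exact ⟨mdifferentiableAt_iff_differentiableAt.mp (h3.comp z h2), h4⟩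
  have hpull : formPullback g α =ᶠ[𝓝 y] fun z => (a (h z)).comp (fderiv ℝ h z) := by
    filter_upwards [hsrc, hhd] with z h1 h2
    rw [h2.2]
    have h3 : (extChartAt I x).symm (h z) = g z := (extChartAt I x).left_inv h1
    -- The covector of `α` lives over a point which is only propositionally equal to `g z`; viewing
    -- both in the model space avoids transport between fibres.
    have h4 : ∀ q, q = g z → ∀ v : E, (show E →L[ℝ] ℝ from α q) v = (show E →L[ℝ] ℝ from α (g z)) v := by
      rintro _ rfl _; rfl
    refine ContinuousLinearMap.ext fun v => ?_
    have h5 := mfderivWithin_extChartAt_symm_comp_mfderiv_extChartAt' h1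
    rw [I.range_eq_univ, mfderivWithin_univ] at h5
    refine Eq.trans ?_ (h4 _ h3 _).symm
    exact congrArg (α (g z)) (congrArg (fun A => A (mfderiv 𝓘(ℝ, F) I g z v)) h5).symm
  have hDh : ContDiffAt ℝ ∞ (fderiv ℝ h) y := hh.fderiv_right (by simp)
  have hah : HasFDerivAt (fun z => a (h z)) ((fderiv ℝ a (h y)).comp (fderiv ℝ h y)) y :=
    HasFDerivAt.comp (g := a) (f := h) y hα.hasFDerivAt (hh.differentiableAt (by simp)).hasFDerivAt
  have hDh' := (hDh.differentiableAt (by simp)).hasFDerivAt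
  -- The first term contains the second derivative of `h`, symmetric in `u` and `v`, and disappears
  -- on antisymmetrization. This is why the exterior derivative commutes with pullback.
  have hfd : ∀ u v, fderiv ℝ (formPullback g α) y u v =
      a (h y) (fderiv ℝ (fderiv ℝ h) y u v) + fderiv ℝ a (h y) (fderiv ℝ h y u) (fderiv ℝ h y v) := by
    intro u v
    have h1 : DifferentiableAt ℝ (formPullback g α) y :=
      (hah.differentiableAt.clm_comp (hDh.differentiableAt (by simp))).congr_of_eventuallyEq hpull
    have h2 := h1.hasFDerivAt.clm_apply (hasFDerivAt_const v y)
    have h3 := hah.clm_apply (hDh'.clm_apply (hasFDerivAt_const v y))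
    have h4 : (fun z => formPullback g α z v) =ᶠ[𝓝 y] fun z => a (h z) (fderiv ℝ h z v) := by
      filter_upwards [hpull] with z hz using by rw [hz]; rfl
    have h5 := congrArg (fun A => A u) (h2.unique (h3.congr_of_eventuallyEq h4))
    simpa using h5
  have hc : ∀ u : F, (mfderiv I 𝓘(ℝ, E) (extChartAt I x) x (mfderiv 𝓘(ℝ, F) I g y u) : E) =
      fderiv ℝ h y u := fun u => by rw [hhd.self_of_nhds.2]; rfl
  rw [curl_apply, hfd, hfd, (hh.isSymmSndFDerivAt (by
      simp only [minSmoothness_of_isRCLikeNormedField]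
      exact WithTop.coe_le_coe.mpr (le_top : (2 : ℕ∞) ≤ ⊤))) u v, add_sub_add_left_eq_sub]
  exact congrArg₂ (fun p q : E => fderiv ℝ a (h y) p q - fderiv ℝ a (h y) q p) (hc u) (hc v)

/-- The representative of a form in a chart is by definition its pullback along the inverse chart.
-/
theorem SmoothOneFormOn.differentiableAt_oneFormInChart [I.Boundaryless] [FiniteDimensional ℝ E]
    {α : ∀ x : N, TangentSpace I x →L[ℝ] ℝ} {U : Set N} (hα : SmoothOneFormOn I α U) {x : N}
    (hU : U ∈ 𝓝 x) :
    DifferentiableAt ℝ (oneFormInChart I α x) (extChartAt I x x) := by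
  have h1 : ContMDiffAt 𝓘(ℝ, E) I ∞ (extChartAt I x).symm (extChartAt I x x) :=
    (contMDiffOn_extChartAt_symm x).contMDiffAt (extChartAt_target_mem_nhds x)
  exact (contDiffAt_formPullback h1 hα (by rwa [extChartAt_to_inv])).differentiableAt (by simp)

/-- The chain rule for the differential of a function. -/
theorem dFun_mfderiv {f : N → ℝ} (hf : MDifferentiableAt I 𝓘(ℝ, ℝ) f (g y))
    (hg : MDifferentiableAt 𝓘(ℝ, F) I g y) (u : F) :
    dFun I f (g y) (mfderiv 𝓘(ℝ, F) I g y u) = fderiv ℝ (fun z => f (g z)) y u := by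
  have h := mfderiv_comp y hf hg
  rw [mfderiv_eq_fderiv] at h
  exact (congrArg (fun A => A u) h).symm

theorem mpullback_mfderiv {X : ∀ x : N, TangentSpace I x}
    (hinv : (mfderiv 𝓘(ℝ, F) I g y).IsInvertible) :
    mfderiv 𝓘(ℝ, F) I g y (VectorField.mpullback 𝓘(ℝ, F) I g X y) = X (g y) := by
  obtain ⟨e, he⟩ := hinv
  rw [VectorField.mpullback_apply, ← he, ContinuousLinearMap.inverse_equiv]
  exact e.apply_symm_apply _

theorem contDiffAt_mpullback [CompleteSpace E] {X : ∀ x : N, TangentSpace I x} {U : Set N}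
    (hX : SmoothVectorFieldOn I X U) (hU : U ∈ 𝓝 (g y)) (hg : ContMDiffAt 𝓘(ℝ, F) I ∞ g y)
    (hinv : (mfderiv 𝓘(ℝ, F) I g y).IsInvertible) :
    ContDiffAt ℝ ∞ (VectorField.mpullback 𝓘(ℝ, F) I g X : F → F) y := by
  have : IsManifold I 1 N := IsManifold.of_le (n := ∞) (by simp)
  have : CompleteSpace F := FiniteDimensional.complete ℝ F
  exact contMDiffAt_vectorSpace_iff_contDiffAt.mp
    (ContMDiffAt.mpullback_vectorField_preimage (hX.contMDiffAt hU) hg hinv (by simp))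

theorem mlieBracket_mfderiv [CompleteSpace E] {X Y : ∀ x : N, TangentSpace I x} {U : Set N}
    (hX : SmoothVectorFieldOn I X U) (hY : SmoothVectorFieldOn I Y U) (hU : U ∈ 𝓝 (g y))
    (hg : ContMDiffAt 𝓘(ℝ, F) I ∞ g y) (hinv : (mfderiv 𝓘(ℝ, F) I g y).IsInvertible) :
    VectorField.mlieBracket I X Y (g y) = mfderiv 𝓘(ℝ, F) I g y
      (VectorField.lieBracket ℝ (E := F) (VectorField.mpullback 𝓘(ℝ, F) I g X : F → F)
        (VectorField.mpullback 𝓘(ℝ, F) I g Y : F → F) y) := by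
  have : IsManifold I (minSmoothness ℝ 3) N := IsManifold.of_le (n := ∞) (by
    rw [minSmoothness_of_isRCLikeNormedField]
    exact WithTop.coe_le_coe.mpr (le_top : (3 : ℕ∞) ≤ ⊤))
  have : CompleteSpace F := FiniteDimensional.complete ℝ F
  have h := VectorField.mpullback_mlieBracket (I := 𝓘(ℝ, F)) (f := g) (x₀ := y) (n := ∞)
    ((hX.contMDiffAt hU).mdifferentiableAt (by simp))
    ((hY.contMDiffAt hU).mdifferentiableAt (by simp)) hg (by
      rw [minSmoothness_of_isRCLikeNormedField]
      exact WithTop.coe_le_coe.mpr (le_top : (2 : ℕ∞) ≤ ⊤))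
  rw [← mpullback_mfderiv (X := VectorField.mlieBracket I X Y) hinv, h,
    ← VectorField.mlieBracketWithin_univ, VectorField.mlieBracketWithin_eq_lieBracketWithin]
  exact congrArg (fun v : F => mfderiv 𝓘(ℝ, F) I g y v)
    (congrFun (VectorField.lieBracketWithin_univ (𝕜 := ℝ) (E := F)) y)

end Pullback

/-! ## Dirac structures in a chart -/

section DiracChart

variable {E H : Type*} [NormedAddCommGroup E] [NormedSpace ℝ E] [FiniteDimensional ℝ E]
  [TopologicalSpace H]
  {I : ModelWithCorners ℝ E H} [I.Boundaryless] {N : Type*} [TopologicalSpace N]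
  [ChartedSpace H N]
  [IsManifold I ∞ N] {F : Type*} [NormedAddCommGroup F] [NormedSpace ℝ F]
  [FiniteDimensional ℝ F] {g : F → N} {y : F}

theorem SmoothOneFormOn.mdifferentiableAt_apply {X : ∀ x : N, TangentSpace I x}
    {ξ : ∀ x : N, TangentSpace I x →L[ℝ] ℝ} {U : Set N} (hX : SmoothVectorFieldOn I X U)
    (hξ : SmoothOneFormOn I ξ U) {x : N} (hU : U ∈ 𝓝 x) :
    MDifferentiableAt I 𝓘(ℝ, ℝ) (fun x => ξ x (X x)) x := by
  have h1 := ContMDiffAt.clm_bundle_apply (E₂ := Bundle.Trivial N ℝ) (hξ.contMDiffAt hU)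
    (hX.contMDiffAt hU)
  exact (contMDiffAt_totalSpace.mp h1).2.mdifferentiableAt (by simp)

theorem fderiv_pairing {X : F → F} {ξ : F → F →L[ℝ] ℝ} (hX : ContDiffAt ℝ ∞ X y)
    (hξ : ContDiffAt ℝ ∞ ξ y) (w : F) :
    fderiv ℝ (fun z => ξ z (X z)) y w = ξ y (fderiv ℝ X y w) + fderiv ℝ ξ y w (X y) := by
  rw [((hξ.differentiableAt (by simp)).hasFDerivAt.clm_apply
    (hX.differentiableAt (by simp)).hasFDerivAt).fderiv]
  rfl

/-- Integrability of a Dirac structure, in a chart: the Courant tensor vanishes on sections. -/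
theorem DiracStructure.cyclic_sum_eq_zero (L : DiracStructure I N)
    (hg : ∀ᶠ z in 𝓝 y, ContMDiffAt 𝓘(ℝ, F) I ∞ g z ∧ (mfderiv 𝓘(ℝ, F) I g z).IsInvertible)
    {U : Set N} (hU : IsOpen U) (hy : g y ∈ U) {X Y Z : ∀ x : N, TangentSpace I x}
    {ξ η ζ : ∀ x : N, TangentSpace I x →L[ℝ] ℝ} (hX : SmoothVectorFieldOn I X U)
    (hξ : SmoothOneFormOn I ξ U) (hY : SmoothVectorFieldOn I Y U) (hη : SmoothOneFormOn I η U)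
    (hZ : SmoothVectorFieldOn I Z U) (hζ : SmoothOneFormOn I ζ U)
    (hXL : ∀ x ∈ U, (X x, ξ x) ∈ L.fiber x) (hYL : ∀ x ∈ U, (Y x, η x) ∈ L.fiber x)
    (hZL : ∀ x ∈ U, (Z x, ζ x) ∈ L.fiber x) {X' Y' Z' : F → F} {ξ' η' ζ' : F → F →L[ℝ] ℝ}
    (hX' : X' = VectorField.mpullback 𝓘(ℝ, F) I g X)
    (hY' : Y' = VectorField.mpullback 𝓘(ℝ, F) I g Y)
    (hZ' : Z' = VectorField.mpullback 𝓘(ℝ, F) I g Z)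
    (hξ' : ξ' = formPullback g ξ) (hη' : η' = formPullback g η) (hζ' : ζ' = formPullback g ζ) :
    ζ' y (fderiv ℝ Y' y (X' y)) + fderiv ℝ η' y (X' y) (Z' y) +
      (ξ' y (fderiv ℝ Z' y (Y' y)) + fderiv ℝ ζ' y (Y' y) (X' y)) +
      (η' y (fderiv ℝ X' y (Z' y)) + fderiv ℝ ξ' y (Z' y) (Y' y)) = 0 := by
  obtain ⟨hgy, hinv⟩ := hg.self_of_nhds
  have hUy : U ∈ 𝓝 (g y) := hU.mem_nhds hy
  have hgd := hgy.mdifferentiableAt (by simp)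
  have : CompleteSpace E := FiniteDimensional.complete ℝ E
  have hX's : ContDiffAt ℝ ∞ X' y := hX' ▸ contDiffAt_mpullback hX hUy hgy hinv
  have hY's : ContDiffAt ℝ ∞ Y' y := hY' ▸ contDiffAt_mpullback hY hUy hgy hinv
  have hZ's : ContDiffAt ℝ ∞ Z' y := hZ' ▸ contDiffAt_mpullback hZ hUy hgy hinv
  have hξ's : ContDiffAt ℝ ∞ ξ' y := hξ' ▸ contDiffAt_formPullback hgy hξ hUy
  have hη's : ContDiffAt ℝ ∞ η' y := hη' ▸ contDiffAt_formPullback hgy hη hUy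
  have hζ's : ContDiffAt ℝ ∞ ζ' y := hζ' ▸ contDiffAt_formPullback hgy hζ hUy
  -- pairings of sections
  have hpair : ∀ {X : ∀ x : N, TangentSpace I x} {ξ : ∀ x : N, TangentSpace I x →L[ℝ] ℝ}
      {X' : F → F} {ξ' : F → F →L[ℝ] ℝ}, X' = VectorField.mpullback 𝓘(ℝ, F) I g X →
      ξ' = formPullback g ξ → ∀ z, (mfderiv 𝓘(ℝ, F) I g z).IsInvertible →
      ξ (g z) (X (g z)) = ξ' z (X' z) := by
    rintro X ξ _ _ rfl rfl z hz
    rw [← mpullback_mfderiv (X := X) hz]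
    rfl
  have hpairn : ∀ {X : ∀ x : N, TangentSpace I x} {ξ : ∀ x : N, TangentSpace I x →L[ℝ] ℝ}
      {X' : F → F} {ξ' : F → F →L[ℝ] ℝ}, X' = VectorField.mpullback 𝓘(ℝ, F) I g X →
      ξ' = formPullback g ξ → (fun z => ξ (g z) (X (g z))) =ᶠ[𝓝 y] fun z => ξ' z (X' z) := by
    intro X ξ X' ξ' h1 h2
    filter_upwards [hg] with z hz using hpair h1 h2 z hz.2
  have hiso : ∀ {X Y : ∀ x : N, TangentSpace I x} {ξ η : ∀ x : N, TangentSpace I x →L[ℝ] ℝ}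
      {X' Y' : F → F} {ξ' η' : F → F →L[ℝ] ℝ}, X' = VectorField.mpullback 𝓘(ℝ, F) I g X →
      Y' = VectorField.mpullback 𝓘(ℝ, F) I g Y → ξ' = formPullback g ξ → η' = formPullback g η →
      (∀ x ∈ U, (X x, ξ x) ∈ L.fiber x) → (∀ x ∈ U, (Y x, η x) ∈ L.fiber x) →
      (fun z => ξ' z (Y' z)) =ᶠ[𝓝 y] fun z => -η' z (X' z) := by
    intro X Y ξ η X' Y' ξ' η' h1 h2 h3 h4 h5 h6
    filter_upwards [hg, hgy.continuousAt.eventually hUy] with z hz hzU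
    rw [← hpair h1 h4 z hz.2, ← hpair h2 h3 z hz.2]
    have := L.isotropic (g z) _ (h5 _ hzU) _ (h6 _ hzU)
    exact eq_neg_of_add_eq_zero_left this
  have hXY := hiso hX' hY' hξ' hη' hXL hYL
  have hXZ := hiso hX' hZ' hξ' hζ' hXL hZL
  have hXZ' : fderiv ℝ (fun z => ξ' z (Z' z)) y (Y' y) =
      -fderiv ℝ (fun z => ζ' z (X' z)) y (Y' y) := by
    rw [hXZ.fderiv_eq, fderiv_fun_neg]; rfl
  rw [fderiv_pairing hZ's hξ's, fderiv_pairing hX's hζ's] at hXZ'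
  -- the Courant bracket paired with `(Z, ζ)`
  have hc := L.isotropic (g y) _ (L.courant_mem U hU X Y ξ η hX hξ hY hη hXL hYL (g y) hy) _
    (hZL (g y) hy)
  have hXy : X (g y) = mfderiv 𝓘(ℝ, F) I g y (X' y) := by rw [hX', mpullback_mfderiv hinv]
  have hYy : Y (g y) = mfderiv 𝓘(ℝ, F) I g y (Y' y) := by rw [hY', mpullback_mfderiv hinv]
  have hZy : Z (g y) = mfderiv 𝓘(ℝ, F) I g y (Z' y) := by rw [hZ', mpullback_mfderiv hinv]
  -- Since `ξ(Y) = -η(X)` by isotropy, the three exact terms of the Courant bracket add up to a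
  -- single `d(η(X))`. Pairing the bracket with the third section then gives the cyclic sum.
  have hd1 : dFun I (fun x => η x (X x)) (g y) (Z (g y)) =
      fderiv ℝ (fun z => η' z (X' z)) y (Z' y) := by
    rw [hZy, dFun_mfderiv (hη.mdifferentiableAt_apply hX hUy) hgd, (hpairn hX' hη').fderiv_eq]
  have hd2 : dFun I (fun x => ξ x (Y x)) (g y) (Z (g y)) =
      -fderiv ℝ (fun z => η' z (X' z)) y (Z' y) := by
    rw [hZy, dFun_mfderiv (hξ.mdifferentiableAt_apply hY hUy) hgd, (hpairn hY' hξ').fderiv_eq,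
      hXY.fderiv_eq, fderiv_fun_neg]
    rfl
  have hd3 : dFun I (fun x => ξ x (Y x) - η x (X x)) (g y) (Z (g y)) =
      -2 * fderiv ℝ (fun z => η' z (X' z)) y (Z' y) := by
    have h1 : (fun z => ξ (g z) (Y (g z)) - η (g z) (X (g z))) =ᶠ[𝓝 y]
        fun z => (-2 : ℝ) * η' z (X' z) := by
      filter_upwards [hpairn hY' hξ', hpairn hX' hη', hXY] with z h1 h2 h3
      rw [h1, h2, h3]; ring
    have h2 : MDifferentiableAt I 𝓘(ℝ, ℝ) (fun x => ξ x (Y x) - η x (X x)) (g y) :=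
      (hξ.mdifferentiableAt_apply hY hUy).sub (hη.mdifferentiableAt_apply hX hUy)
    rw [hZy, dFun_mfderiv h2 hgd, h1.fderiv_eq, fderiv_const_mul
      ((hη's.clm_apply hX's).differentiableAt (by simp))]
    rfl
  have hd4 : extDerivOneForm I η (g y) (X (g y)) (Z (g y)) = curl η' y (X' y) (Z' y) := by
    rw [hXy, hZy, extDerivOneForm_mfderiv hgy (hη.differentiableAt_oneFormInChart hUy), hη']
  have hd5 : extDerivOneForm I ξ (g y) (Y (g y)) (Z (g y)) = curl ξ' y (Y' y) (Z' y) := by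
    rw [hYy, hZy, extDerivOneForm_mfderiv hgy (hξ.differentiableAt_oneFormInChart hUy), hξ']
  have hd6 : ζ (g y) (VectorField.mlieBracket I X Y (g y)) =
      ζ' y (fderiv ℝ Y' y (X' y)) - ζ' y (fderiv ℝ X' y (Y' y)) := by
    rw [mlieBracket_mfderiv hX hY hUy hgy hinv, ← hX', ← hY', ← map_sub, hζ']
    rfl
  have hc' : extDerivOneForm I η (g y) (X (g y)) (Z (g y)) +
      dFun I (fun x => η x (X x)) (g y) (Z (g y)) -
      (extDerivOneForm I ξ (g y) (Y (g y)) (Z (g y)) +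
        dFun I (fun x => ξ x (Y x)) (g y) (Z (g y))) +
      (1 / 2 : ℝ) * dFun I (fun x => ξ x (Y x) - η x (X x)) (g y) (Z (g y)) +
      ζ (g y) (VectorField.mlieBracket I X Y (g y)) = 0 := hc
  rw [hd1, hd2, hd3, hd4, hd5, hd6, fderiv_pairing hX's hη's, curl_apply, curl_apply] at hc'
  linarith

/-- A frame of a Dirac structure in a chart. -/
theorem DiracStructure.exists_frame_pullback (L : DiracStructure I N)
    (hg : ∀ᶠ z in 𝓝 y, ContMDiffAt 𝓘(ℝ, F) I ∞ g z ∧ (mfderiv 𝓘(ℝ, F) I g z).IsInvertible) :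
    ∃ (X : Fin (Module.finrank ℝ E) → F → F) (ξ : Fin (Module.finrank ℝ E) → F → F →L[ℝ] ℝ),
      (∀ a, ContDiff ℝ ∞ (X a)) ∧ (∀ a, ContDiff ℝ ∞ (ξ a)) ∧
      (∀ᶠ z in 𝓝 y, ∀ a b, ξ a z (X b z) + ξ b z (X a z) = 0) ∧
      (∀ᶠ z in 𝓝 y, ∀ i j l,
        ξ l z (fderiv ℝ (X j) z (X i z)) + fderiv ℝ (ξ j) z (X i z) (X l z) +
        (ξ i z (fderiv ℝ (X l) z (X j z)) + fderiv ℝ (ξ l) z (X j z) (X i z)) +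
        (ξ j z (fderiv ℝ (X i) z (X l z)) + fderiv ℝ (ξ i) z (X l z) (X j z)) = 0) ∧
      (∀ᶠ z in 𝓝 y, ∀ v η, (v, η) ∈ diracPullback (mfderiv 𝓘(ℝ, F) I g z) (L.fiber (g z)) ↔
        ∃ t : Fin (Module.finrank ℝ E) → ℝ, v = ∑ a, t a • X a z ∧ η = ∑ a, t a • ξ a z) ∧
      ∀ᶠ z in 𝓝 y, ∀ t : Fin (Module.finrank ℝ E) → ℝ,
        ∑ a, t a • X a z = 0 → ∑ a, t a • ξ a z = 0 → t = 0 := by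
  obtain ⟨U, hU, hyU, X, ξ, hX, hξ, hspan⟩ := L.exists_frame (g y)
  have : CompleteSpace E := FiniteDimensional.complete ℝ E
  have hgc : ContinuousAt g y := hg.self_of_nhds.1.continuousAt
  obtain ⟨W, hW, hWo, hyW⟩ := eventually_nhds_iff.mp
    (hg.eventually_nhds.and (hgc.eventually (hU.mem_nhds hyU)).eventually_nhds)
  have hWU : ∀ z ∈ W, g z ∈ U := fun z hz => (hW z hz).2.self_of_nhds
  have hWg := fun z hz => (hW z hz).1.self_of_nhds
  have hmem : ∀ a, ∀ x ∈ U, (X a x, ξ a x) ∈ L.fiber x := fun a x hx => by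
    rw [← hspan x hx]; exact Submodule.subset_span ⟨a, rfl⟩
  have hXs : ∀ a, ContDiffOn ℝ ∞ (VectorField.mpullback 𝓘(ℝ, F) I g (X a) : F → F) W :=
    fun a z hz => (contDiffAt_mpullback (hX a) (hU.mem_nhds (hWU z hz)) (hWg z hz).1
      (hWg z hz).2).contDiffWithinAt
  have hξs : ∀ a, ContDiffOn ℝ ∞ (formPullback g (ξ a)) W := fun a z hz =>
    (contDiffAt_formPullback (hWg z hz).1 (hξ a) (hU.mem_nhds (hWU z hz))).contDiffWithinAt
  choose X' hX' hX'e using fun a => exists_contDiff_eventuallyEq hWo (hXs a) hyW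
  choose ξ' hξ' hξ'e using fun a => exists_contDiff_eventuallyEq hWo (hξs a) hyW
  have hXe : ∀ᶠ z in 𝓝 y, ∀ a, X' a =ᶠ[𝓝 z] VectorField.mpullback 𝓘(ℝ, F) I g (X a) :=
    Filter.eventually_all.mpr fun a => (hX'e a).eventually_nhds
  have hξe : ∀ᶠ z in 𝓝 y, ∀ a, ξ' a =ᶠ[𝓝 z] formPullback g (ξ a) :=
    Filter.eventually_all.mpr fun a => (hξ'e a).eventually_nhds
  have hT : ∀ z ∈ W, ∀ a, mfderiv 𝓘(ℝ, F) I g z (VectorField.mpullback 𝓘(ℝ, F) I g (X a) z) =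
      X a (g z) := fun z hz a => mpullback_mfderiv (hWg z hz).2
  have hsum : ∀ z ∈ W, ∀ t : Fin (Module.finrank ℝ E) → ℝ,
      (mfderiv 𝓘(ℝ, F) I g z (∑ a, t a • VectorField.mpullback 𝓘(ℝ, F) I g (X a) z) =
        ∑ a, t a • X a (g z)) ∧
      (∑ a, t a • formPullback g (ξ a) z =
        (∑ a, t a • ξ a (g z)).comp (mfderiv 𝓘(ℝ, F) I g z)) := fun z hz t => by
    constructor
    · rw [map_sum]
      exact Finset.sum_congr rfl fun a _ => by rw [map_smul, hT z hz]
    · refine ContinuousLinearMap.ext fun v => ?_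
      rw [sum_apply]
      change _ = (∑ a, t a • ξ a (g z)) (mfderiv 𝓘(ℝ, F) I g z v)
      rw [sum_apply]
      rfl
  have hcomb : ∀ z (t : Fin (Module.finrank ℝ E) → ℝ),
      ∑ a, t a • ((X a (g z), ξ a (g z)) : TangentSpace I (g z) × (TangentSpace I (g z) →L[ℝ] ℝ)) =
        (∑ a, t a • X a (g z), ∑ a, t a • ξ a (g z)) := fun z t => by
    simp [Prod.ext_iff, Prod.fst_sum, Prod.snd_sum]
  refine ⟨X', ξ', hX', hξ', ?_, ?_, ?_, ?_⟩
  · filter_upwards [hXe, hξe, hWo.mem_nhds hyW] with z h1 h2 h3 a b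
    rw [(h1 b).self_of_nhds, (h1 a).self_of_nhds, (h2 b).self_of_nhds, (h2 a).self_of_nhds]
    have h4 := L.isotropic (g z) _ (hmem a _ (hWU z h3)) _ (hmem b _ (hWU z h3))
    rw [← hT z h3 a, ← hT z h3 b] at h4
    exact h4
  · filter_upwards [hXe, hξe, hWo.mem_nhds hyW] with z h1 h2 h3 i j l
    have e1 : ∀ a, fderiv ℝ (X' a) z =
        fderiv ℝ (VectorField.mpullback 𝓘(ℝ, F) I g (X a) : F → F) z :=
      fun a => Filter.EventuallyEq.fderiv_eq (h1 a)
    have e2 : ∀ a, fderiv ℝ (ξ' a) z = fderiv ℝ (formPullback g (ξ a)) z :=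
      fun a => Filter.EventuallyEq.fderiv_eq (h2 a)
    have e3 : ∀ a, X' a z = (VectorField.mpullback 𝓘(ℝ, F) I g (X a) : F → F) z :=
      fun a => (h1 a).self_of_nhds
    have e4 : ∀ a, ξ' a z = formPullback g (ξ a) z := fun a => (h2 a).self_of_nhds
    rw [e1, e1, e1, e2, e2, e2, e3, e3, e3, e4, e4, e4]
    exact L.cyclic_sum_eq_zero (hW z h3).1 hU (hWU z h3) (hX i) (hξ i) (hX j) (hξ j) (hX l) (hξ l)
      (hmem i) (hmem j) (hmem l) rfl rfl rfl rfl rfl rfl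
  · filter_upwards [hXe, hξe, hWo.mem_nhds hyW] with z h1 h2 h3 v η
    simp only [fun a => (h1 a).self_of_nhds, fun a => (h2 a).self_of_nhds]
    obtain ⟨e, he⟩ := (hWg z h3).2
    constructor
    · rintro ⟨θ, hθ, rfl⟩
      rw [← hspan _ (hWU z h3), Submodule.mem_span_range_iff_exists_fun] at hθ
      obtain ⟨t, ht⟩ := hθ
      rw [hcomb] at ht
      refine ⟨t, e.injective ?_, ?_⟩
      · have h4 := (hsum z h3 t).1
        rw [← he] at h4
        refine Eq.trans ?_ h4.symm
        refine Eq.trans ?_ (congrArg Prod.fst ht).symm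
        exact congrArg (fun A => A v) he
      · rw [(hsum z h3 t).2]
        exact congrArg (fun θ => ContinuousLinearMap.comp θ (mfderiv 𝓘(ℝ, F) I g z))
          (congrArg Prod.snd ht).symm
    · rintro ⟨t, rfl, rfl⟩
      refine ⟨∑ a, t a • ξ a (g z), ?_, (hsum z h3 t).2⟩
      rw [← hspan _ (hWU z h3), Submodule.mem_span_range_iff_exists_fun]
      exact ⟨t, (hcomb z t).trans (Prod.ext (hsum z h3 t).1.symm rfl)⟩
  · filter_upwards [hXe, hξe, hWo.mem_nhds hyW] with z h1 h2 h3 t ht ht'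
    simp only [fun a => (h1 a).self_of_nhds] at ht
    simp only [fun a => (h2 a).self_of_nhds] at ht'
    have hli : LinearIndependent ℝ (fun a => (X a (g z), ξ a (g z))) := by
      rw [linearIndependent_iff_card_eq_finrank_span, Set.finrank, hspan _ (hWU z h3),
        L.finrank_fiber, Fintype.card_fin]
    refine funext (Fintype.linearIndependent_iff.mp hli t ?_)
    rw [hcomb]
    obtain ⟨e, he⟩ := (hWg z h3).2
    refine Prod.ext ?_ ?_
    · refine (hsum z h3 t).1.symm.trans ?_
      exact (congrArg (mfderiv 𝓘(ℝ, F) I g z) ht).trans (map_zero _)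
    · rw [(hsum z h3 t).2] at ht'
      refine ContinuousLinearMap.ext fun v => ?_
      have h4 := congrArg (fun A => A (e.symm v)) ht'
      have h5 : mfderiv 𝓘(ℝ, F) I g z (e.symm v) = v :=
        (congrArg (fun A => A (e.symm v)) he).symm.trans (e.apply_symm_apply v)
      refine Eq.trans ?_ h4
      change _ = (∑ a, t a • ξ a (g z)) (mfderiv 𝓘(ℝ, F) I g z (e.symm v))
      rw [h5]

end DiracChart

/-! ## Charts with values in a normed space -/

section Charts

variable {E H : Type*} [NormedAddCommGroup E] [NormedSpace ℝ E] [TopologicalSpace H]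
  {I : ModelWithCorners ℝ E H} {N : Type*} [TopologicalSpace N] [ChartedSpace H N]
  [IsManifold I ∞ N] {F : Type*} [NormedAddCommGroup F] [NormedSpace ℝ F]

theorem contMDiffAt_cotangent_comp_mfderiv {EZ HZ Z : Type*} [NormedAddCommGroup EZ]
    [NormedSpace ℝ EZ] [TopologicalSpace HZ] {IZ : ModelWithCorners ℝ EZ HZ} [TopologicalSpace Z]
    [ChartedSpace HZ Z] {b : Z → N} {χ : N → F} {θ : Z → F →L[ℝ] ℝ} {z₀ : Z}
    (hb : ContMDiffAt IZ I ∞ b z₀) (hχ : ContMDiffAt I 𝓘(ℝ, F) ∞ χ (b z₀))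
    (hθ : ContMDiffAt IZ 𝓘(ℝ, F →L[ℝ] ℝ) ∞ θ z₀) :
    ContMDiffAt IZ (I.prod 𝓘(ℝ, E →L[ℝ] ℝ)) ∞ (fun z =>
      (⟨b z, (θ z).comp (mfderiv I 𝓘(ℝ, F) χ (b z))⟩ : CotangentBundle I N)) z₀ := by
  have : IsManifold I 1 N := IsManifold.of_le (n := ∞) (by simp)
  refine (contMDiffAt_hom_bundle (E₂ := Bundle.Trivial N ℝ) _).mpr ⟨hb, ?_⟩
  have h1 : ContMDiffAt I 𝓘(ℝ, E →L[ℝ] F) ∞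
      (inTangentCoordinates I 𝓘(ℝ, F) id χ (fun x => mfderiv I 𝓘(ℝ, F) χ x) (b z₀)) (b z₀) :=
    hχ.mfderiv_const (by simp)
  have h2 := hθ.clm_comp (h1.comp z₀ hb)
  refine h2.congr_of_eventuallyEq (Filter.Eventually.of_forall fun z => ?_)
  simp only [Function.comp_def, inTangentCoordinates, ContinuousLinearMap.inCoordinates,
    TangentBundle.continuousLinearMapAt_model_space]
  refine (congrArg (fun A : ℝ →L[ℝ] ℝ => A.comp (((θ z).comp (mfderiv I 𝓘(ℝ, F) χ (b z))).comp
    (Trivialization.symmL ℝ (trivializationAt E (TangentSpace I) (b z₀)) (b z))))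
    (Bundle.Trivial.continuousLinearMapAt_trivialization ℝ N ℝ _)).trans rfl

/-- Smoothness, in both directions, of a chart with values in a normed space. -/
structure IsSmoothChart (I : ModelWithCorners ℝ E H) (χ : OpenPartialHomeomorph N F) : Prop where
  smooth : ContMDiffOn I 𝓘(ℝ, F) ∞ χ χ.source
  smooth_symm : ContMDiffOn 𝓘(ℝ, F) I ∞ χ.symm χ.target

namespace IsSmoothChart

variable {χ : OpenPartialHomeomorph N F}

theorem contMDiffAt (h : IsSmoothChart I χ) {x : N} (hx : x ∈ χ.source) :
    ContMDiffAt I 𝓘(ℝ, F) ∞ χ x := h.smooth.contMDiffAt (χ.open_source.mem_nhds hx)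

theorem contMDiffAt_symm (h : IsSmoothChart I χ) {u : F} (hu : u ∈ χ.target) :
    ContMDiffAt 𝓘(ℝ, F) I ∞ χ.symm u := h.smooth_symm.contMDiffAt (χ.open_target.mem_nhds hu)

/-- The right side is stated in `E` because the tangent spaces at `χ.symm (χ x)` and at `x` both
unfold to `E` although the two points are only propositionally equal. -/
theorem mfderiv_symm_apply (h : IsSmoothChart I χ) {x : N} (hx : x ∈ χ.source)
    (v : TangentSpace I x) : mfderiv 𝓘(ℝ, F) I χ.symm (χ x) (mfderiv I 𝓘(ℝ, F) χ x v) =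
      (show E from v) := by
  have h1 := (((h.contMDiffAt_symm (χ.map_source hx)).mdifferentiableAt (by simp)).hasMFDerivAt.comp
    x ((h.contMDiffAt hx).mdifferentiableAt (by simp)).hasMFDerivAt)
  have h2 : HasMFDerivAt I I (χ.symm ∘ χ) x (ContinuousLinearMap.id ℝ (TangentSpace I x)) :=
    (hasMFDerivAt_id x).congr_of_eventuallyEq (χ.eventually_left_inverse hx)
  exact congrArg (fun A : E →L[ℝ] E => A v) (hasMFDerivAt_unique h1 h2)

theorem mfderiv_apply_symm (h : IsSmoothChart I χ) {u : F} (hu : u ∈ χ.target) (v : F) :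
    mfderiv I 𝓘(ℝ, F) χ (χ.symm u) (mfderiv 𝓘(ℝ, F) I χ.symm u v) = v := by
  have h1 := (((h.contMDiffAt (χ.map_target hu)).mdifferentiableAt (by simp)).hasMFDerivAt.comp
    u ((h.contMDiffAt_symm hu).mdifferentiableAt (by simp)).hasMFDerivAt)
  have h2 : HasMFDerivAt 𝓘(ℝ, F) 𝓘(ℝ, F) (χ ∘ χ.symm) u (ContinuousLinearMap.id ℝ F) :=
    (hasMFDerivAt_id u).congr_of_eventuallyEq (χ.eventually_right_inverse hu)
  exact congrArg (fun A : F →L[ℝ] F => A v) (hasMFDerivAt_unique h1 h2)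

theorem mfderiv_symm_apply' (h : IsSmoothChart I χ) {u : F} (hu : u ∈ χ.target)
    (v : TangentSpace I (χ.symm u)) :
    mfderiv 𝓘(ℝ, F) I χ.symm u (mfderiv I 𝓘(ℝ, F) χ (χ.symm u) v) = v := by
  have h1 := h.mfderiv_symm_apply (χ.map_target hu) v
  rw [χ.right_inv hu] at h1
  exact h1

/-- The differential of the inverse of a chart. -/
def derivSymm (h : IsSmoothChart I χ) {u : F} (hu : u ∈ χ.target) :
    F ≃L[ℝ] TangentSpace I (χ.symm u) :=
  ContinuousLinearEquiv.equivOfInverse (mfderiv 𝓘(ℝ, F) I χ.symm u)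
    (mfderiv I 𝓘(ℝ, F) χ (χ.symm u)) (h.mfderiv_apply_symm hu) (h.mfderiv_symm_apply' hu)

theorem isInvertible_mfderiv_symm (h : IsSmoothChart I χ) {u : F} (hu : u ∈ χ.target) :
    (mfderiv 𝓘(ℝ, F) I χ.symm u).IsInvertible := ⟨h.derivSymm hu, rfl⟩

theorem inverse_mfderiv_symm (h : IsSmoothChart I χ) {u : F} (hu : u ∈ χ.target) :
    (mfderiv 𝓘(ℝ, F) I χ.symm u).inverse = mfderiv I 𝓘(ℝ, F) χ (χ.symm u) :=
  ContinuousLinearMap.inverse_equiv (h.derivSymm hu)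

theorem eventually_symm (h : IsSmoothChart I χ) {u : F} (hu : u ∈ χ.target) :
    ∀ᶠ z in 𝓝 u, ContMDiffAt 𝓘(ℝ, F) I ∞ χ.symm z ∧
      (mfderiv 𝓘(ℝ, F) I χ.symm z).IsInvertible := by
  filter_upwards [χ.open_target.mem_nhds hu] with z hz
  exact ⟨h.contMDiffAt_symm hz, h.isInvertible_mfderiv_symm hz⟩

end IsSmoothChart

end Charts

/-! ## Poisson structures in a chart -/

section PoissonChart

variable {E H : Type*} [NormedAddCommGroup E] [NormedSpace ℝ E] [FiniteDimensional ℝ E]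
  [TopologicalSpace H] {I : ModelWithCorners ℝ E H} {N : Type*} [TopologicalSpace N]
  [ChartedSpace H N] [IsManifold I ∞ N] {F : Type*} [NormedAddCommGroup F] [NormedSpace ℝ F]
  [FiniteDimensional ℝ F] {χ : OpenPartialHomeomorph N F}

/-- The sharp map of a Poisson structure in a chart. -/
def PoissonStructure.sharpInChart (Pi : PoissonStructure I N) (χ : OpenPartialHomeomorph N F)
    (u : F) : (F →L[ℝ] ℝ) →L[ℝ] F :=
  (mfderiv I 𝓘(ℝ, F) χ (χ.symm u)).comp ((Pi.sharp (χ.symm u)).comp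
    ((ContinuousLinearMap.compL ℝ E F ℝ).flip (mfderiv I 𝓘(ℝ, F) χ (χ.symm u))))

theorem PoissonStructure.sharpInChart_apply (Pi : PoissonStructure I N)
    (χ : OpenPartialHomeomorph N F) (u : F) (ξ : F →L[ℝ] ℝ) :
    Pi.sharpInChart χ u ξ = mfderiv I 𝓘(ℝ, F) χ (χ.symm u)
      (Pi.sharp (χ.symm u) (ξ.comp (mfderiv I 𝓘(ℝ, F) χ (χ.symm u)))) := rfl

/-- For a constant covector `ξ` the value is the pullback, along the inverse chart, of the smooth
vector field `♯(χ^*ξ)`. Smoothness on each constant covector suffices in finite dimension. -/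
theorem PoissonStructure.contDiffOn_sharpInChart (Pi : PoissonStructure I N)
    (hχ : IsSmoothChart I χ) : ContDiffOn ℝ ∞ (Pi.sharpInChart χ) χ.target := by
  intro u hu
  refine ContDiffAt.contDiffWithinAt (contDiffAt_clm_of_apply fun ξ => ?_)
  have : CompleteSpace E := FiniteDimensional.complete ℝ E
  let X : ∀ x : N, TangentSpace I x := fun x => Pi.sharp x (ξ.comp (mfderiv I 𝓘(ℝ, F) χ x))
  have hX : SmoothVectorFieldOn I X χ.source := fun x hx => by
    have h1 : ContMDiffAt I (I.prod 𝓘(ℝ, E →L[ℝ] ℝ)) ∞ (fun z =>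
      (⟨z, ξ.comp (mfderiv I 𝓘(ℝ, F) χ z)⟩ : CotangentBundle I N)) x :=
      contMDiffAt_cotangent_comp_mfderiv (b := id) (θ := fun _ => ξ) contMDiffAt_id
        (hχ.contMDiffAt hx) contMDiffAt_const
    exact (ContMDiffAt.clm_bundle_apply (Pi.smooth x) h1).contMDiffWithinAt
  have h2 := contDiffAt_mpullback hX (χ.open_source.mem_nhds (χ.map_target hu))
    (hχ.contMDiffAt_symm hu) (hχ.isInvertible_mfderiv_symm hu)
  refine h2.congr_of_eventuallyEq ?_
  filter_upwards [χ.open_target.mem_nhds hu] with z hz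
  rw [Pi.sharpInChart_apply]
  exact congrArg (fun A => A (X (χ.symm z))) (hχ.inverse_mfderiv_symm hz).symm

theorem dFun_comp {f : F → ℝ} {χ : N → F} {x : N} (hf : DifferentiableAt ℝ f (χ x))
    (hχ : MDifferentiableAt I 𝓘(ℝ, F) χ x) :
    dFun I (fun z => f (χ z)) x = (fderiv ℝ f (χ x)).comp (mfderiv I 𝓘(ℝ, F) χ x) := by
  have h1 := mfderiv_comp x hf.mdifferentiableAt hχ
  rw [mfderiv_eq_fderiv] at h1
  exact h1

/-- The Jacobi identity is evaluated on the functions `ξ ∘ χ` with `ξ` a constant covector. The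
bracket of two of them is `ζ(S η)`, with no second derivatives, so each iterated bracket is a
directional derivative `ζ(DS(S ξ) η)`. -/
theorem PoissonStructure.exists_isPoissonNear (Pi : PoissonStructure I N)
    (hχ : IsSmoothChart I χ) {u₀ : F} (hu₀ : u₀ ∈ χ.target) :
    ∃ S : F → (F →L[ℝ] ℝ) →L[ℝ] F, IsPoissonNear S u₀ ∧
      ∀ᶠ u in 𝓝 u₀, S u = Pi.sharpInChart χ u := by
  have hs := Pi.contDiffOn_sharpInChart hχ
  obtain ⟨S, hS, hSe⟩ := exists_contDiff_eventuallyEq χ.open_target hs hu₀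
  refine ⟨S, ⟨hS, ?_, ?_⟩, hSe⟩
  · filter_upwards [hSe] with u hu ξ η
    rw [hu]
    exact Pi.skew (χ.symm u) (ξ.comp (mfderiv I 𝓘(ℝ, F) χ (χ.symm u)))
      (η.comp (mfderiv I 𝓘(ℝ, F) χ (χ.symm u)))
  · filter_upwards [hSe.eventually_nhds, χ.open_target.mem_nhds hu₀] with u hu hut ξ η ζ
    have hlin : ∀ (ξ : F →L[ℝ] ℝ), ∀ x ∈ χ.source,
        dFun I (fun z => ξ (χ z)) x = ξ.comp (mfderiv I 𝓘(ℝ, F) χ x) := fun ξ x hx => by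
      rw [dFun_comp ξ.differentiableAt ((hχ.contMDiffAt hx).mdifferentiableAt (by simp)),
        ξ.fderiv]
    have hsm : ∀ ξ : F →L[ℝ] ℝ, ContMDiffOn I 𝓘(ℝ, ℝ) ∞ (fun z => ξ (χ z)) χ.source :=
      fun ξ => ξ.contMDiff.comp_contMDiffOn hχ.smooth
    have hbr : ∀ ξ η : F →L[ℝ] ℝ, ∀ x ∈ χ.source,
        dFun I (fun z => η (χ z)) x (Pi.sharp x (dFun I (fun z => ξ (χ z)) x)) =
          η (Pi.sharpInChart χ (χ x) ξ) := fun ξ η x hx => by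
      rw [hlin _ x hx, hlin _ x hx, Pi.sharpInChart_apply, χ.left_inv hx]
      rfl
    have hbr2 : ∀ ξ η ζ : F →L[ℝ] ℝ, dFun I (fun x => dFun I (fun z => ζ (χ z)) x
        (Pi.sharp x (dFun I (fun z => η (χ z)) x))) (χ.symm u)
        (Pi.sharp (χ.symm u) (dFun I (fun z => ξ (χ z)) (χ.symm u))) =
          ζ (fderiv ℝ S u (S u ξ) η) := fun ξ η ζ => by
      have hxs := χ.map_target hut
      have h1 : (fun x => dFun I (fun z => ζ (χ z)) x
          (Pi.sharp x (dFun I (fun z => η (χ z)) x))) =ᶠ[𝓝 (χ.symm u)]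
          fun x => (fun u => ζ (S u η)) (χ x) := by
        have h2 : Filter.Tendsto χ (𝓝 (χ.symm u)) (𝓝 u) := by
          have := χ.continuousAt hxs
          rwa [ContinuousAt, χ.right_inv hut] at this
        filter_upwards [χ.open_source.mem_nhds hxs, h2.eventually hu] with x hx hx2
        rw [hbr η ζ x hx, hx2]
      have hd : HasFDerivAt (fun u => ζ (S u η)) (ζ.comp ((fderiv ℝ S u).flip η)) u :=
        ζ.hasFDerivAt.comp u (((hS.differentiable (by simp) u).hasFDerivAt).clm_apply
          (hasFDerivAt_const η u) |>.congr_fderiv (by ext; simp))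
      have h3 : dFun I (fun x => dFun I (fun z => ζ (χ z)) x
          (Pi.sharp x (dFun I (fun z => η (χ z)) x))) (χ.symm u) =
          dFun I (fun x => (fun u => ζ (S u η)) (χ x)) (χ.symm u) := h1.mfderiv_eq
      have hd' : HasFDerivAt (fun u => ζ (S u η)) (ζ.comp ((fderiv ℝ S u).flip η))
          (χ (χ.symm u)) := by rw [χ.right_inv hut]; exact hd
      rw [h3, dFun_comp hd'.differentiableAt
        ((hχ.contMDiffAt hxs).mdifferentiableAt (by simp)), hd'.fderiv, hlin _ _ hxs,
        hu.self_of_nhds]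
      rfl
    have h := Pi.jacobi χ.source χ.open_source _ _ _ (hsm ξ) (hsm η) (hsm ζ) (χ.symm u)
      (χ.map_target hut)
    have h' : ζ (fderiv ℝ S u (S u ξ) η) + ξ (fderiv ℝ S u (S u η) ζ) +
        η (fderiv ℝ S u (S u ζ) ξ) = 0 := by
      rw [← hbr2, ← hbr2, ← hbr2]
      exact h
    exact h'

end PoissonChart

/-! ## Charts adapted to an embedded submanifold -/

section SliceChart

variable {E E' : Type*} [NormedAddCommGroup E] [NormedSpace ℝ E] [FiniteDimensional ℝ E]
  [NormedAddCommGroup E'] [NormedSpace ℝ E'] [FiniteDimensional ℝ E']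
  {N : Type*} [TopologicalSpace N] [ChartedSpace E N] [IsManifold 𝓘(ℝ, E) ∞ N]
  {P : Type*} [TopologicalSpace P] [ChartedSpace E' P] [IsManifold 𝓘(ℝ, E') ∞ P] {k : ℕ}

/-- The immersion charts already give `f` the form `a ↦ (a, 0)`, with a complement identified with
`ℝ^k` by dimension. Since `f` is a topological embedding, the chart of `P` can be shrunk until it
meets the image in the slice only. -/
theorem Manifold.IsSmoothEmbedding.exists_slice_chart {f : N → P}
    (hf : IsSmoothEmbedding 𝓘(ℝ, E) 𝓘(ℝ, E') ∞ f)
    (hk : Module.finrank ℝ E' = Module.finrank ℝ E + k) (x : N) :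
    ∃ (φ : OpenPartialHomeomorph N E) (χ : OpenPartialHomeomorph P (E × (Fin k → ℝ))),
      IsSmoothChart 𝓘(ℝ, E) φ ∧ IsSmoothChart 𝓘(ℝ, E') χ ∧ x ∈ φ.source ∧
      (∀ y ∈ φ.source, f y ∈ χ.source ∧ χ (f y) = (φ y, 0)) ∧
      ∀ u ∈ χ.source, u ∈ Set.range f ↔ (χ u).2 = 0 := by
  let h := hf.isImmersion.isImmersionAt x
  have hfin : FiniteDimensional ℝ (E × h.complement) :=
    h.equiv.symm.toLinearEquiv.finiteDimensional
  have : FiniteDimensional ℝ h.complement :=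
    FiniteDimensional.of_injective (LinearMap.inr ℝ E h.complement) LinearMap.inr_injective
  have hC : Module.finrank ℝ h.complement = Module.finrank ℝ (Fin k → ℝ) := by
    have h1 := h.equiv.toLinearEquiv.finrank_eq
    rw [Module.finrank_prod, hk] at h1
    rw [Module.finrank_fin_fun]
    omega
  let e := ContinuousLinearEquiv.ofFinrankEq hC
  let ψ : E' ≃L[ℝ] E × (Fin k → ℝ) :=
    h.equiv.symm.trans ((ContinuousLinearEquiv.refl ℝ E).prodCongr e)
  let φ := h.domChart
  let χ₀ := h.codChart.trans ψ.toHomeomorph.toOpenPartialHomeomorph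
  have hχ₀ : IsSmoothChart 𝓘(ℝ, E') χ₀ := by
    constructor
    · have h1 := contMDiffOn_of_mem_maximalAtlas h.codChart_mem_maximalAtlas
      exact ψ.contDiff.contMDiff.comp_contMDiffOn (h1.mono fun u hu => hu.1)
    · have h1 := contMDiffOn_symm_of_mem_maximalAtlas h.codChart_mem_maximalAtlas
      exact h1.comp ψ.symm.contDiff.contMDiff.contMDiffOn fun u hu => hu.2
  have hφ : IsSmoothChart 𝓘(ℝ, E) φ :=
    ⟨contMDiffOn_of_mem_maximalAtlas h.domChart_mem_maximalAtlas,
      contMDiffOn_symm_of_mem_maximalAtlas h.domChart_mem_maximalAtlas⟩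
  have hsrc : χ₀.source = h.codChart.source := by simp [χ₀]
  have hw : ∀ y ∈ φ.source, χ₀ (f y) = (φ y, 0) := fun y hy => by
    have h0 := h.writtenInCharts
    have h1 := @h0 (φ y) (by simpa using! (φ.map_source hy : φ y ∈ h.domChart.target))
    have h2 : h.codChart (f y) = h.equiv (φ y, 0) := by
      simpa [φ, h.domChart.left_inv hy] using h1
    change ψ (h.codChart (f y)) = _
    rw [h2]
    simp [ψ]
  -- The open set `W` removes the parts of the image that come from points outside the source of
  -- `φ`.
  obtain ⟨W, hW, hWf⟩ := hf.isEmbedding.isInducing.isOpen_iff.mp φ.open_source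
  have hWy : ∀ y, f y ∈ W ↔ y ∈ φ.source := fun y => by rw [← hWf]; rfl
  -- Requiring the first coordinate to lie in the target of `φ` ensures that every point of the
  -- slice is the image of a point of `N`.
  have hO := χ₀.isOpen_inter_preimage (φ.open_target.prod (isOpen_univ (X := Fin k → ℝ)))
  let χ := χ₀.restrOpen (W ∩ (χ₀.source ∩ χ₀ ⁻¹' (φ.target ×ˢ Set.univ))) (hW.inter hO)
  have hχs : ∀ u, u ∈ χ.source ↔ u ∈ χ₀.source ∧ u ∈ W ∧ (χ₀ u).1 ∈ φ.target := fun u => by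
    simp [χ]
    tauto
  refine ⟨φ, χ, hφ, ⟨hχ₀.smooth.mono fun u hu => ((hχs u).mp hu).1,
    hχ₀.smooth_symm.mono fun u hu => ?_⟩, h.mem_domChart_source, fun y hy => ⟨(hχs _).mpr
      ⟨?_, (hWy y).mpr hy, ?_⟩, hw y hy⟩, fun u hu => ⟨?_, fun hu2 => ?_⟩⟩
  · have h1 := χ₀.map_source ((hχs _).mp (χ.map_target hu)).1
    have h2 : χ₀ (χ.symm u) = u := χ.right_inv hu
    rwa [h2] at h1
  · rw [hsrc]; exact h.source_subset_preimage_source hy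
  · rw [hw y hy]; exact φ.map_source hy
  · rintro ⟨y, rfl⟩
    have := hw y ((hWy y).mp ((hχs _).mp hu).2.1)
    change (χ₀ (f y)).2 = 0
    rw [this]
  · have h3 := (hχs u).mp hu
    have h4 := φ.map_target h3.2.2
    refine ⟨φ.symm (χ₀ u).1, χ₀.injOn ?_ h3.1 ?_⟩
    · rw [hsrc]; exact h.source_subset_preimage_source h4
    · rw [hw _ h4, φ.right_inv h3.2.2]
      exact Prod.ext rfl hu2.symm

end SliceChart

/-! ## Coisotropic embeddings in adapted charts -/

section CoisotropicChart

variable {E E' H H' : Type*} [NormedAddCommGroup E] [NormedSpace ℝ E] [FiniteDimensional ℝ E]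
  [NormedAddCommGroup E'] [NormedSpace ℝ E'] [FiniteDimensional ℝ E'] [TopologicalSpace H]
  [TopologicalSpace H'] {I : ModelWithCorners ℝ E H} {I' : ModelWithCorners ℝ E' H'}
  {N : Type*} [TopologicalSpace N] [ChartedSpace H N] [IsManifold I ∞ N]
  {P : Type*} [TopologicalSpace P] [ChartedSpace H' P] [IsManifold I' ∞ P] {k : ℕ}
  {A : Type*} [NormedAddCommGroup A] [NormedSpace ℝ A] [FiniteDimensional ℝ A]
  {L : DiracStructure I N} {Pi : PoissonStructure I' P} {f : N → P}
  {φ : OpenPartialHomeomorph N A} {χ : OpenPartialHomeomorph P (A × (Fin k → ℝ))}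

theorem PoissonStructure.sharpInChart_of_eq {F : Type*} [NormedAddCommGroup F] [NormedSpace ℝ F]
    [FiniteDimensional ℝ F]
    {χ : OpenPartialHomeomorph P F} {p : P} (hp : p ∈ χ.source) {u : F} (hu : χ p = u)
    (η : F →L[ℝ] ℝ) : Pi.sharpInChart χ u η =
      mfderiv I' 𝓘(ℝ, F) χ p (Pi.sharp p (η.comp (mfderiv I' 𝓘(ℝ, F) χ p))) := by
  subst hu
  rw [Pi.sharpInChart_apply, χ.left_inv hp]

theorem mfderiv_slice_chart (hf : MDifferentiable I I' f) (hφ : IsSmoothChart I φ)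
    (hχ : IsSmoothChart I' χ) (hφχ : ∀ y ∈ φ.source, f y ∈ χ.source ∧ χ (f y) = (φ y, 0))
    {y : N} (hy : y ∈ φ.source) (v : TangentSpace I y) :
    mfderiv I' 𝓘(ℝ, A × (Fin k → ℝ)) χ (f y) (mfderiv I I' f y v) =
      (((mfderiv I 𝓘(ℝ, A) φ y v : A), (0 : Fin k → ℝ)) : A × (Fin k → ℝ)) := by
  have h1 := (((hχ.contMDiffAt (hφχ y hy).1).mdifferentiableAt (by simp)).hasMFDerivAt.comp y
    (hf y).hasMFDerivAt)
  let J : A →L[ℝ] A × (Fin k → ℝ) := ContinuousLinearMap.inl ℝ A (Fin k → ℝ)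
  have h2 : HasMFDerivAt I 𝓘(ℝ, A × (Fin k → ℝ)) (χ ∘ f) y (J.comp (mfderiv I 𝓘(ℝ, A) φ y)) := by
    have h3 := J.hasFDerivAt (x := φ y) |>.hasMFDerivAt.comp y
      ((hφ.contMDiffAt hy).mdifferentiableAt (by simp)).hasMFDerivAt
    refine h3.congr_of_eventuallyEq ?_
    filter_upwards [φ.open_source.mem_nhds hy] with z hz using (hφχ z hz).2
  exact congrArg (fun B : E →L[ℝ] A × (Fin k → ℝ) => B v) (hasMFDerivAt_unique h1 h2)

theorem IsSmoothChart.mfderiv_injective {F : Type*} [NormedAddCommGroup F] [NormedSpace ℝ F]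
    {χ : OpenPartialHomeomorph P F} (hχ : IsSmoothChart I' χ) {p : P} (hp : p ∈ χ.source) :
    Function.Injective (mfderiv I' 𝓘(ℝ, F) χ p) := fun v w h => by
  have h1 := congrArg (mfderiv 𝓘(ℝ, F) I' χ.symm (χ p)) h
  exact (hχ.mfderiv_symm_apply hp v).symm.trans (h1.trans (hχ.mfderiv_symm_apply hp w))

variable (hi : IsCoisotropicEmbedding L Pi f) (hf : MDifferentiable I I' f)
  (hφ : IsSmoothChart I φ) (hχ : IsSmoothChart I' χ)
  (hφχ : ∀ y ∈ φ.source, f y ∈ χ.source ∧ χ (f y) = (φ y, 0))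

include hi hf hφ hχ hφχ

/-- In adapted charts the differential of the embedding is `inl`, so `i^*L_Π = L` becomes the
statement that the pullback of the bivector to `c = 0` is the chart form of `L`. -/
theorem IsCoisotropicEmbedding.inducedRel_iff {a : A} (ha : a ∈ φ.target) (v : A)
    (ξ : A →L[ℝ] ℝ) : InducedRel (Pi.sharpInChart χ) a v ξ ↔
      (v, ξ) ∈ diracPullback (mfderiv 𝓘(ℝ, A) I φ.symm a) (L.fiber (φ.symm a)) := by
  set y := φ.symm a with hy
  have hys : y ∈ φ.source := φ.map_target ha
  have hφy : φ y = a := φ.right_inv ha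
  obtain ⟨hp, hχp⟩ := hφχ y hys
  rw [hφy] at hχp
  have hT : ∀ w : A, mfderiv I' 𝓘(ℝ, A × (Fin k → ℝ)) χ (f y) (mfderiv I I' f y
      (mfderiv 𝓘(ℝ, A) I φ.symm a w)) = ((w, 0) : A × (Fin k → ℝ)) := fun w => by
    refine (mfderiv_slice_chart hf hφ hχ hφχ hys _).trans ?_
    exact congrArg (fun w : A => ((w, 0) : A × (Fin k → ℝ))) (hφ.mfderiv_apply_symm ha w)
  constructor
  · rintro ⟨η, h1, rfl⟩
    rw [PoissonStructure.sharpInChart_of_eq hp hχp] at h1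
    let ζ := η.comp (mfderiv I' 𝓘(ℝ, A × (Fin k → ℝ)) χ (f y))
    refine ⟨ζ.comp (mfderiv I I' f y), ?_, ?_⟩
    · rw [← hi.pullback_eq y]
      refine ⟨ζ, ⟨ζ, Prod.ext ?_ rfl⟩, rfl⟩
      apply hχ.mfderiv_injective hp
      exact h1.trans (hT v).symm
    · refine ContinuousLinearMap.ext fun w => ?_
      exact (congrArg η (hT w)).symm
  · rintro ⟨θ, hθ, hξ⟩
    rw [← hi.pullback_eq y] at hθ
    obtain ⟨ζ, ⟨ζ', hζ'⟩, hθζ⟩ := hθ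
    have h1 : Pi.sharp (f y) ζ = mfderiv I I' f y (mfderiv 𝓘(ℝ, A) I φ.symm a v) := by
      have h2 : ζ' = ζ := congrArg Prod.snd hζ'
      rw [← h2]
      exact congrArg Prod.fst hζ'
    have hinv : ∀ w, mfderiv 𝓘(ℝ, A × (Fin k → ℝ)) I' χ.symm (χ (f y))
        (mfderiv I' 𝓘(ℝ, A × (Fin k → ℝ)) χ (f y) w) = w := hχ.mfderiv_symm_apply hp
    let η : A × (Fin k → ℝ) →L[ℝ] ℝ := (show E' →L[ℝ] ℝ from ζ).comp
      (show A × (Fin k → ℝ) →L[ℝ] E' from mfderiv 𝓘(ℝ, A × (Fin k → ℝ)) I' χ.symm (χ (f y)))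
    have hη : η.comp (mfderiv I' 𝓘(ℝ, A × (Fin k → ℝ)) χ (f y)) = ζ :=
      ContinuousLinearMap.ext fun w => congrArg ζ (hinv w)
    refine ⟨η, ?_, ?_⟩
    · rw [PoissonStructure.sharpInChart_of_eq hp hχp, hη, h1]
      exact hT v
    · refine ContinuousLinearMap.ext fun w => ?_
      have h3 : ξ w = ζ (mfderiv I I' f y (mfderiv 𝓘(ℝ, A) I φ.symm a w)) := by
        have h4 : ξ = θ.comp (mfderiv 𝓘(ℝ, A) I φ.symm a) := hξ
        have h5 : θ = ζ.comp (mfderiv I I' f y) := hθζ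
        rw [h4, h5]
        rfl
      rw [h3, ← hη]
      exact congrArg η (hT w).symm

/-- The covector `κ ∘ snd`, pulled back by the chart, annihilates the image of the embedding, so
coisotropy applies. -/
theorem IsCoisotropicEmbedding.sharpInChart_snd {a : A} (ha : a ∈ φ.target)
    (κ : (Fin k → ℝ) →L[ℝ] ℝ) :
    (Pi.sharpInChart χ (a, 0) (κ.comp (ContinuousLinearMap.snd ℝ A (Fin k → ℝ)))).2 = 0 := by
  have hys := φ.map_target ha
  obtain ⟨hp, hχp⟩ := hφχ _ hys
  rw [φ.right_inv ha] at hχp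
  rw [PoissonStructure.sharpInChart_of_eq hp hχp]
  obtain ⟨v, hv⟩ := hi.coisotropic (φ.symm a)
    ((κ.comp (ContinuousLinearMap.snd ℝ A (Fin k → ℝ))).comp
      (mfderiv I' 𝓘(ℝ, A × (Fin k → ℝ)) χ (f (φ.symm a)))) (fun v => by
      refine Eq.trans (congrArg (κ.comp (ContinuousLinearMap.snd ℝ A (Fin k → ℝ)))
        (mfderiv_slice_chart hf hφ hχ hφχ hys v)) ?_
      simp)
  rw [← hv]
  exact congrArg Prod.snd (mfderiv_slice_chart hf hφ hχ hφχ hys v)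

/-- By coisotropy and `i^*L_Π = L`, sharp maps conormal covectors into `E`, and onto it, because a
vector `w` of `E` gives `(w, 0)` in `L`, hence a covector that vanishes on the slice and has sharp
`w`. Both spaces have dimension `k`, the codimension being equal to the rank of `E`, so the map is
injective. -/
theorem IsCoisotropicEmbedding.sharpInChart_injective (hL : L.HasCharRank k) {a : A}
    (ha : a ∈ φ.target) (κ : (Fin k → ℝ) →L[ℝ] ℝ)
    (hκ : Pi.sharpInChart χ (a, 0) (κ.comp (ContinuousLinearMap.snd ℝ A (Fin k → ℝ))) = 0) :
    κ = 0 := by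
  have hind := hi.inducedRel_iff hf hφ hχ hφχ ha
  let D := hφ.derivSymm ha
  let Ψ₀ : ((Fin k → ℝ) →L[ℝ] ℝ) →ₗ[ℝ] TangentSpace I (φ.symm a) :=
    { toFun := fun κ => D (Pi.sharpInChart χ (a, 0)
        (κ.comp (ContinuousLinearMap.snd ℝ A (Fin k → ℝ)))).1
      map_add' := fun κ κ' => by
        rw [ContinuousLinearMap.add_comp, map_add, Prod.fst_add, map_add]
      map_smul' := fun c κ => by
        rw [ContinuousLinearMap.smul_comp, map_smul, Prod.smul_fst, map_smul]; rfl }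
  have hmem : ∀ κ, Ψ₀ κ ∈ L.char (φ.symm a) := fun κ => by
    have h1 : InducedRel (Pi.sharpInChart χ) a (Pi.sharpInChart χ (a, 0)
        (κ.comp (ContinuousLinearMap.snd ℝ A (Fin k → ℝ)))).1 0 := by
      refine ⟨_, Prod.ext rfl (hi.sharpInChart_snd hf hφ hχ hφχ ha κ), ?_⟩
      exact ContinuousLinearMap.ext fun w => by simp
    obtain ⟨θ, hθ, hθ0⟩ := (hind _ _).mp h1
    have h2 : θ = 0 := ContinuousLinearMap.ext fun w => by
      have h3 := congrArg (fun B : A →L[ℝ] ℝ => B (D.symm w)) hθ0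
      exact (congrArg θ (D.apply_symm_apply w)).symm.trans h3.symm
    rw [h2] at hθ
    exact hθ
  let Ψ := Ψ₀.codRestrict _ hmem
  have hfin := finiteDimensional_char L (φ.symm a)
  have hsurj : Function.Surjective Ψ := fun w => by
    have h1 : (D.symm w.1, (0 : A →L[ℝ] ℝ)) ∈
        diracPullback (mfderiv 𝓘(ℝ, A) I φ.symm a) (L.fiber (φ.symm a)) := by
      refine ⟨0, ?_, ContinuousLinearMap.ext fun w => rfl⟩
      have h2 : D (D.symm w.1) = w.1 := D.apply_symm_apply _
      have h3 : (w.1, (0 : TangentSpace I (φ.symm a) →L[ℝ] ℝ)) ∈ L.fiber (φ.symm a) := w.2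
      rw [← h2] at h3
      exact h3
    obtain ⟨η, hη, hη0⟩ := (hind _ _).mpr h1
    have h4 : (η.comp (ContinuousLinearMap.inr ℝ A (Fin k → ℝ))).comp
        (ContinuousLinearMap.snd ℝ A (Fin k → ℝ)) = η :=
      ContinuousLinearMap.ext fun z => by
        have h5 : η (z.1, 0) = 0 := congrArg (fun B : A →L[ℝ] ℝ => B z.1) hη0
        have h6 : z = (z.1, 0) + (0, z.2) := by simp
        change η (0, z.2) = η z
        rw [h6, map_add, h5]
        simp
    refine ⟨η.comp (ContinuousLinearMap.inr ℝ A (Fin k → ℝ)), Subtype.ext ?_⟩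
    change D (Pi.sharpInChart χ (a, 0) ((η.comp (ContinuousLinearMap.inr ℝ A (Fin k → ℝ))).comp
      (ContinuousLinearMap.snd ℝ A (Fin k → ℝ)))).1 = w
    rw [h4, hη]
    exact D.apply_symm_apply _
  have hdim : Module.finrank ℝ ((Fin k → ℝ) →L[ℝ] ℝ) = Module.finrank ℝ (L.char (φ.symm a)) := by
    rw [hL, ← (LinearMap.toContinuousLinearMap (𝕜 := ℝ) (E := Fin k → ℝ) (F' := ℝ)).finrank_eq,
      Module.finrank_linearMap, Module.finrank_fin_fun, Module.finrank_self, mul_one]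
  have hinj := (LinearMap.injective_iff_surjective_of_finrank_eq_finrank hdim).mpr hsurj
  refine hinj (Subtype.ext ?_)
  rw [map_zero]
  change D (Pi.sharpInChart χ (a, 0) (κ.comp (ContinuousLinearMap.snd ℝ A (Fin k → ℝ)))).1 = 0
  rw [hκ]
  exact map_zero D

theorem IsCoisotropicEmbedding.isCoisotropicNear (hL : L.HasCharRank k)
    {S : A × (Fin k → ℝ) → (A × (Fin k → ℝ) →L[ℝ] ℝ) →L[ℝ] A × (Fin k → ℝ)} {a₀ : A}
    (ha₀ : a₀ ∈ φ.target) (hS : ∀ᶠ u in 𝓝 (a₀, 0), S u = Pi.sharpInChart χ u) :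
    IsCoisotropicNear S a₀ ∧ ∀ᶠ a in 𝓝 a₀, ∀ v ξ, InducedRel S a v ξ ↔
      (v, ξ) ∈ diracPullback (mfderiv 𝓘(ℝ, A) I φ.symm a) (L.fiber (φ.symm a)) := by
  have hc : Filter.Tendsto (fun a : A => (a, (0 : Fin k → ℝ))) (𝓝 a₀) (𝓝 (a₀, 0)) :=
    (Continuous.prodMk_left (0 : Fin k → ℝ)).tendsto a₀
  have hS' := hc.eventually hS
  refine ⟨⟨?_, fun κ hκ => ?_⟩, ?_⟩
  · filter_upwards [hS', φ.open_target.mem_nhds ha₀] with a h1 h2 κ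
    rw [h1]
    exact hi.sharpInChart_snd hf hφ hχ hφχ h2 κ
  · rw [hS.self_of_nhds] at hκ
    exact hi.sharpInChart_injective hf hφ hχ hφχ hL ha₀ κ hκ
  · filter_upwards [hS', φ.open_target.mem_nhds ha₀] with a h1 h2 v ξ
    rw [← hi.inducedRel_iff hf hφ hχ hφχ h2, InducedRel, h1, InducedRel]

end CoisotropicChart

/-! ## Charts of `E*` -/

section DualChart

variable {E H : Type*} [NormedAddCommGroup E] [NormedSpace ℝ E] [FiniteDimensional ℝ E]
  [TopologicalSpace H] {I : ModelWithCorners ℝ E H} {N : Type*} [TopologicalSpace N]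
  [ChartedSpace H N] [IsManifold I ∞ N] {k : ℕ}
  {A : Type*} [NormedAddCommGroup A] [NormedSpace ℝ A] [FiniteDimensional ℝ A]
  (L : DiracStructure I N) (hL : L.HasCharRank k)

/-- A smooth frame of `L ∩ TN` around `x`. -/
def charFrameAt (x : N) : CharFrame L k := (exists_charFrame L hL x).choose

theorem mem_base_charFrameAt (x : N) : x ∈ (charFrameAt L hL x).base :=
  (exists_charFrame L hL x).choose_spec

variable (φ : OpenPartialHomeomorph N A) (x : N)

/-- The chart of `E*` given by a chart of `N` and the frame `charFrameAt`. -/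
def charDualChart : OpenPartialHomeomorph (L.CharDualSpace hL) (A × (Fin k → ℝ)) :=
  (trivializationAt (Fin k → ℝ) (L.CharDual hL) x).toOpenPartialHomeomorph.trans
    (φ.prod (OpenPartialHomeomorph.refl (Fin k → ℝ)))

/-- The preferred trivialization at `x` is by construction the one given by `charFrameAt L hL x`, so
the membership condition unfolds definitionally. -/
theorem mem_charDualChart_source (e : L.CharDualSpace hL) :
    e ∈ (charDualChart L hL φ x).source ↔
      e.proj ∈ (charFrameAt L hL x).base ∧ e.proj ∈ φ.source := by
  have h1 : e ∈ (charDualChart L hL φ x).source ↔ e.proj ∈ (charFrameAt L hL x).base ∧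
    (e.proj ∈ φ.source ∧ (charDualChart L hL φ x e).2 ∈ Set.univ) := Iff.rfl
  rw [h1]
  simp

theorem mem_charDualChart_target (u : A × (Fin k → ℝ)) :
    u ∈ (charDualChart L hL φ x).target ↔
      u.1 ∈ φ.target ∧ φ.symm u.1 ∈ (charFrameAt L hL x).base := by
  have h1 : u ∈ (charDualChart L hL φ x).target ↔ (u.1 ∈ φ.target ∧ u.2 ∈ Set.univ) ∧
    (φ.symm u.1 ∈ (charFrameAt L hL x).base ∧ u.2 ∈ Set.univ) := Iff.rfl
  rw [h1]
  simp

variable {φ}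

theorem isSmoothChart_charDualChart (hφ : IsSmoothChart I φ) :
    IsSmoothChart (I.prod 𝓘(ℝ, Fin k → ℝ)) (charDualChart L hL φ x) := by
  let τ := trivializationAt (Fin k → ℝ) (L.CharDual hL) x
  constructor
  · have h1 : ContMDiffOn (I.prod 𝓘(ℝ, Fin k → ℝ)) (I.prod 𝓘(ℝ, Fin k → ℝ)) ∞ τ τ.source :=
      τ.contMDiffOn
    have h2 : ContMDiffOn (I.prod 𝓘(ℝ, Fin k → ℝ)) (I.prod 𝓘(ℝ, Fin k → ℝ)) ∞ τ
        (charDualChart L hL φ x).source := h1.mono (fun e he => he.1)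
    exact (hφ.smooth.comp (contMDiff_fst.comp_contMDiffOn h2) fun e he => he.2.1).prodMk_space
      (contMDiff_snd.comp_contMDiffOn h2)
  · have h1 : ContMDiffOn (I.prod 𝓘(ℝ, Fin k → ℝ)) (I.prod 𝓘(ℝ, Fin k → ℝ)) ∞
      τ.toOpenPartialHomeomorph.symm τ.target := τ.contMDiffOn_symm
    have h2 : ContMDiffOn 𝓘(ℝ, A × (Fin k → ℝ)) (I.prod 𝓘(ℝ, Fin k → ℝ)) ∞
        (fun u : A × (Fin k → ℝ) => (φ.symm u.1, u.2)) (charDualChart L hL φ x).target :=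
      (hφ.smooth_symm.comp contDiff_fst.contMDiff.contMDiffOn fun u hu => hu.1.1).prodMk
        contDiff_snd.contMDiff.contMDiffOn
    exact h1.comp h2 fun u hu => hu.2

theorem charDualChart_symm_apply_vec {u : A × (Fin k → ℝ)}
    (hu : u ∈ (charDualChart L hL φ x).target) (i : Fin k) :
    (show L.char (φ.symm u.1) →L[ℝ] ℝ from ((charDualChart L hL φ x).symm u).2)
      ((charFrameAt L hL x).vec i (φ.symm u.1)) = u.2 i :=
  congrFun (congrArg Prod.snd ((charDualChart L hL φ x).right_inv hu)) i

end DualChart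

/-! ## The coframe of a splitting -/

section Coframe

variable {E H : Type*} [NormedAddCommGroup E] [NormedSpace ℝ E] [FiniteDimensional ℝ E]
  [TopologicalSpace H] {I : ModelWithCorners ℝ E H} {N : Type*} [TopologicalSpace N]
  [ChartedSpace H N] [IsManifold I ∞ N] {k : ℕ}
  {A : Type*} [NormedAddCommGroup A] [NormedSpace ℝ A] [FiniteDimensional ℝ A]
  {L : DiracStructure I N} {φ : OpenPartialHomeomorph N A}

/-- A frame of `E` and a frame of `V` together are a frame of the whole space. Inverting the frame
matrix gives the smooth dual coframe, of which the members belonging to `E` are kept. -/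
theorem DiracStructure.Splitting.exists_coframe (V : L.Splitting) (hL : L.HasCharRank k)
    (f : CharFrame L k)
    (hφ : IsSmoothChart I φ) {a₀ : A} (ha₀ : a₀ ∈ φ.target) (hf : φ.symm a₀ ∈ f.base) :
    ∃ (Φ : Fin k → A → A →L[ℝ] ℝ) (W : Set A), IsOpen W ∧ a₀ ∈ W ∧ W ⊆ φ.target ∧
      (∀ a ∈ W, φ.symm a ∈ f.base) ∧ (∀ j, ContDiff ℝ ∞ (Φ j)) ∧
      ∀ a ∈ W, (∀ i j, Φ j a (mfderiv I 𝓘(ℝ, A) φ (φ.symm a) (f.vec i (φ.symm a))) =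
          if i = j then 1 else 0) ∧
        ∀ j, ∀ v ∈ V.fiber (φ.symm a), Φ j a (mfderiv I 𝓘(ℝ, A) φ (φ.symm a) v) = 0 := by
  have : CompleteSpace E := FiniteDimensional.complete ℝ E
  have : CompleteSpace A := FiniteDimensional.complete ℝ A
  obtain ⟨U, hU, hxU, r, X, hX, hXV⟩ := V.smooth (φ.symm a₀)
  have hfd : ∀ y : N, FiniteDimensional ℝ (TangentSpace I y) := fun y =>
    inferInstanceAs (FiniteDimensional ℝ E)
  -- The generators of `V` may be redundant; those forming a basis of `V` at the base point are
  -- selected.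
  obtain ⟨d, σ, hσspan, hσind⟩ : ∃ (d : ℕ) (σ : Fin d → Fin r),
      Submodule.span ℝ (Set.range fun l => X (σ l) (φ.symm a₀)) = V.fiber (φ.symm a₀) ∧
      LinearIndependent ℝ (fun l => X (σ l) (φ.symm a₀)) := by
    obtain ⟨g, hg, hgspan, hgind⟩ := Submodule.exists_fun_fin_finrank_span_eq ℝ
      (Set.range fun l => X l (φ.symm a₀))
    choose σ hσ using hg
    have h1 : g = fun l => X (σ l) (φ.symm a₀) := funext fun l => (hσ l).symm
    refine ⟨_, σ, ?_, ?_⟩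
    · rw [← h1, hgspan, hXV _ hxU]
    · rw [← h1]; exact hgind
  let s : Fin k → A → A := fun i a => mfderiv I 𝓘(ℝ, A) φ (φ.symm a) (f.vec i (φ.symm a))
  let t : Fin d → A → A := fun l a => mfderiv I 𝓘(ℝ, A) φ (φ.symm a) (X (σ l) (φ.symm a))
  let C : A → (Fin k → ℝ) × (Fin d → ℝ) →L[ℝ] A := fun a =>
    (combMap fun i => s i a).coprod (combMap fun l => t l a)
  have hC : ∀ a z, C a z = mfderiv I 𝓘(ℝ, A) φ (φ.symm a)
      (∑ i, z.1 i • (f.vec i (φ.symm a) : TangentSpace I (φ.symm a)) +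
        ∑ l, z.2 l • X (σ l) (φ.symm a)) := fun a z => by
    rw [map_add, map_sum, map_sum]
    simp only [map_smul]
    change combMap (fun i => s i a) z.1 + combMap (fun l => t l a) z.2 = _
    rw [combMap_apply, combMap_apply]
    rfl
  let W₀ := φ.target ∩ φ.symm ⁻¹' (f.base ∩ U)
  have hW₀ : IsOpen W₀ := φ.symm.isOpen_inter_preimage (f.isOpen_base.inter hU)
  have hCs : ContDiffOn ℝ ∞ C W₀ := fun a ha => by
    have h1 : ∀ {Y : ∀ y : N, TangentSpace I y} {O : Set N}, SmoothVectorFieldOn I Y O →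
        O ∈ 𝓝 (φ.symm a) → ContMDiffAt 𝓘(ℝ, A) 𝓘(ℝ, A) ∞
          (fun a => (mfderiv I 𝓘(ℝ, A) φ (φ.symm a) (Y (φ.symm a)) : A)) a := fun {Y O} hY hO => by
      have h2 := contDiffAt_mpullback hY hO (hφ.contMDiffAt_symm ha.1)
        (hφ.isInvertible_mfderiv_symm ha.1)
      refine (h2.congr_of_eventuallyEq ?_).contMDiffAt
      filter_upwards [φ.open_target.mem_nhds ha.1] with z hz
      exact congrArg (fun B => B (Y (φ.symm z))) (hφ.inverse_mfderiv_symm hz).symm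
    have h3 := contMDiffAt_combMap (σ := s) (fun i => h1 (f.smooth i) (f.isOpen_base.mem_nhds ha.2.1))
    have h4 := contMDiffAt_combMap (σ := t) (fun l => h1 (hX (σ l)) (hU.mem_nhds ha.2.2))
    have h5 : ContDiffAt ℝ ∞ C a := by
      refine contDiffAt_clm_of_apply fun z => ?_
      exact (h3.contDiffAt.clm_apply contDiffAt_const).add
        (h4.contDiffAt.clm_apply contDiffAt_const)
    exact h5.contDiffWithinAt
  have ha₀W : a₀ ∈ W₀ := ⟨ha₀, hf, hxU⟩
  have hfsum : ∀ (y : N) (c : Fin k → ℝ), ∑ i, c i • (f.vec i y : TangentSpace I y) =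
      ((∑ i, c i • f.vec i y : L.char y) : TangentSpace I y) := fun y c => by simp
  have hinj : LinearMap.ker (C a₀).toLinearMap = ⊥ := by
    rw [LinearMap.ker_eq_bot']
    rintro ⟨c, z⟩ hz
    have h1 : C a₀ (c, z) = 0 := hz
    rw [hC] at h1
    have h2 := hφ.mfderiv_injective (φ.map_target ha₀) (h1.trans (map_zero _).symm)
    have h3 : ∑ l, z l • X (σ l) (φ.symm a₀) ∈ V.fiber (φ.symm a₀) := by
      rw [← hσspan, Submodule.mem_span_range_iff_exists_fun]; exact ⟨z, rfl⟩
    have h4 : ∑ l, z l • X (σ l) (φ.symm a₀) = 0 := by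
      refine Submodule.disjoint_def.mp (V.isCompl _).disjoint _ ?_ h3
      rw [eq_neg_of_add_eq_zero_right h2, hfsum]
      exact Submodule.neg_mem _ (Subtype.prop _)
    rw [h4, add_zero, hfsum] at h2
    refine Prod.ext (funext ?_) (funext ?_)
    · exact Fintype.linearIndependent_iff.mp (f.indep _ hf) c (Subtype.ext h2)
    · exact Fintype.linearIndependent_iff.mp hσind z h4
  have hrange : LinearMap.range (C a₀).toLinearMap = ⊤ := by
    rw [LinearMap.range_eq_top]
    intro v
    have h1 : hφ.derivSymm ha₀ v ∈ L.char (φ.symm a₀) ⊔ V.fiber (φ.symm a₀) := by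
      rw [(V.isCompl _).sup_eq_top]; trivial
    obtain ⟨e, he, w, hw, hew⟩ := Submodule.mem_sup.mp h1
    rw [← hσspan, Submodule.mem_span_range_iff_exists_fun] at hw
    obtain ⟨z, hz⟩ := hw
    refine ⟨(fun i => (f.basis hL hf).repr ⟨e, he⟩ i, z), ?_⟩
    change C a₀ _ = v
    rw [hC]
    have h2 : ∑ i, (f.basis hL hf).repr ⟨e, he⟩ i • (f.vec i (φ.symm a₀) :
        TangentSpace I (φ.symm a₀)) = e := by
      rw [hfsum]
      have h3 := (f.basis hL hf).sum_repr ⟨e, he⟩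
      have h4 : ∀ j, f.basis hL hf j = f.vec j (φ.symm a₀) := fun j => by simp [CharFrame.basis]
      simp only [h4] at h3
      rw [h3]
    simp only [h2, hz, hew]
    exact hφ.mfderiv_apply_symm ha₀ v
  let e₀ := ContinuousLinearEquiv.ofBijective (C a₀) hinj hrange
  have he₀ : (e₀ : (Fin k → ℝ) × (Fin d → ℝ) →L[ℝ] A) = C a₀ := rfl
  have hevinv : ∀ᶠ a in 𝓝 a₀, (C a).IsInvertible :=
    (hCs.contDiffAt (hW₀.mem_nhds ha₀W)).continuousAt.eventually
      (he₀ ▸ ContinuousLinearEquiv.nhds e₀)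
  obtain ⟨W₁, hW₁, hW₁o, ha₀W₁⟩ := eventually_nhds_iff.mp hevinv
  let Φ : Fin k → A → A →L[ℝ] ℝ := fun j a =>
    ((ContinuousLinearMap.proj j : (Fin k → ℝ) →L[ℝ] ℝ).comp
      (ContinuousLinearMap.fst ℝ (Fin k → ℝ) (Fin d → ℝ))).comp (C a).inverse
  have hΦs : ∀ j, ContDiffOn ℝ ∞ (Φ j) (W₀ ∩ W₁) := fun j a ha => by
    obtain ⟨e, he⟩ := hW₁ a ha.2
    have h1 : ContDiffAt ℝ ∞ (ContinuousLinearMap.inverse :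
      ((Fin k → ℝ) × (Fin d → ℝ) →L[ℝ] A) → _) (C a) := by rw [← he]; exact contDiffAt_map_inverse e
    exact (contDiffAt_const.clm_comp (h1.comp a
      (hCs.contDiffAt (hW₀.mem_nhds ha.1)))).contDiffWithinAt
  choose Φ' hΦ' hΦ'e using fun j =>
    exists_contDiff_eventuallyEq (hW₀.inter hW₁o) (hΦs j) ⟨ha₀W, ha₀W₁⟩
  obtain ⟨W₂, hW₂, hW₂o, ha₀W₂⟩ := eventually_nhds_iff.mp (Filter.eventually_all.mpr hΦ'e)
  refine ⟨Φ', W₀ ∩ W₁ ∩ W₂, (hW₀.inter hW₁o).inter hW₂o, ⟨⟨ha₀W, ha₀W₁⟩, ha₀W₂⟩,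
    fun a ha => ha.1.1.1, fun a ha => ha.1.1.2.1, hΦ', fun a ha => ?_⟩
  obtain ⟨e, he⟩ := hW₁ a ha.1.2
  have hΦC : ∀ j z, Φ' j a (C a z) = z.1 j := fun j z => by
    rw [hW₂ a ha.2 j]
    change ((C a).inverse (C a z)).1 j = z.1 j
    rw [← he, ContinuousLinearMap.inverse_equiv]
    simp
  constructor
  · intro i j
    have h1 := hΦC j (Pi.single i 1, 0)
    rw [hC] at h1
    simp only [Pi.zero_apply, zero_smul, Finset.sum_const_zero, add_zero] at h1
    rw [Finset.sum_eq_single i (fun b _ hb => by simp [hb]) (by simp), Pi.single_eq_same,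
      one_smul] at h1
    rw [h1, Pi.single_apply]
    simp [eq_comm]
  · intro j v hv
    -- `V` has constant rank, being a complement of `E` of rank `k`. So the selected fields, still
    -- independent at nearby points, still span `V` there.
    have hdim : Module.finrank ℝ (V.fiber (φ.symm a)) = d := by
      have h1 := Submodule.finrank_add_eq_of_isCompl (V.isCompl (φ.symm a))
      have h2 := Submodule.finrank_add_eq_of_isCompl (V.isCompl (φ.symm a₀))
      have h3 : Module.finrank ℝ (V.fiber (φ.symm a₀)) = d := by
        rw [← hσspan, finrank_span_eq_card hσind, Fintype.card_fin]
      have h4 : Module.finrank ℝ (TangentSpace I (φ.symm a)) =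
        Module.finrank ℝ (TangentSpace I (φ.symm a₀)) := rfl
      rw [hL] at h1 h2
      omega
    have hind : LinearIndependent ℝ (fun l => X (σ l) (φ.symm a)) := by
      rw [Fintype.linearIndependent_iff]
      intro z hz l
      have h1 : C a (0, z) = 0 := by
        rw [hC]
        simp [hz]
        rfl
      rw [← he] at h1
      have h2 := e.injective (h1.trans (map_zero e).symm)
      exact congrFun (congrArg Prod.snd h2) l
    have hspan : Submodule.span ℝ (Set.range fun l => X (σ l) (φ.symm a)) = V.fiber (φ.symm a) := by
      refine Submodule.eq_of_le_of_finrank_eq ?_ ?_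
      · rw [← hXV _ ha.1.1.2.2]
        exact Submodule.span_mono (by rintro _ ⟨l, rfl⟩; exact ⟨σ l, rfl⟩)
      · rw [hdim, finrank_span_eq_card hind, Fintype.card_fin]
    rw [← hspan, Submodule.mem_span_range_iff_exists_fun] at hv
    obtain ⟨z, rfl⟩ := hv
    have h1 := hΦC j (0, z)
    rw [hC] at h1
    simpa using h1

end Coframe

/-! ## The canonical Dirac structure in a chart -/

section CanonicalForm

variable {E H : Type*} [NormedAddCommGroup E] [NormedSpace ℝ E] [FiniteDimensional ℝ E]
  [TopologicalSpace H] {I : ModelWithCorners ℝ E H} [I.Boundaryless] {N : Type*}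
  [TopologicalSpace N] [ChartedSpace H N] [IsManifold I ∞ N]
  {F : Type*} [NormedAddCommGroup F] [NormedSpace ℝ F] [FiniteDimensional ℝ F]

/-- The tautological property of the canonical one-form: pulled back along `h`, it returns the
covectors `h` themselves, composed with the differential of the base map. -/
theorem formPullback_canonicalOneForm {h : F → CotangentBundle I N} {u : F}
    (hh : MDifferentiableAt 𝓘(ℝ, F) (I.prod 𝓘(ℝ, E →L[ℝ] ℝ)) h u) :
    formPullback h (canonicalOneForm I) u =
      (h u).2.comp (mfderiv 𝓘(ℝ, F) I (fun z => (h z).proj) u) := by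
  have h1 : MDifferentiableAt (I.prod 𝓘(ℝ, E →L[ℝ] ℝ)) I (fun y : CotangentBundle I N => y.proj)
      (h u) := (contMDiff_proj (n := ∞) (fun x : N => TangentSpace I x →L[ℝ] ℝ)).mdifferentiable
        (by simp) (h u)
  have h2 := mfderiv_comp u h1 hh
  exact congrArg (fun B : F →L[ℝ] E => ContinuousLinearMap.comp (h u).2 B) h2.symm

/-- By the tautological formula, the chart representative at `y` is the covector part of the inverse
chart composed with the differential of its base map; both depend smoothly on `y`. -/
theorem differentiableAt_canonicalOneForm (z : CotangentBundle I N) :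
    DifferentiableAt ℝ (oneFormInChart (I.prod 𝓘(ℝ, E →L[ℝ] ℝ)) (canonicalOneForm I) z)
      (extChartAt (I.prod 𝓘(ℝ, E →L[ℝ] ℝ)) z z) := by
  let J := I.prod 𝓘(ℝ, E →L[ℝ] ℝ)
  let h : E × (E →L[ℝ] ℝ) → CotangentBundle I N := (extChartAt J z).symm
  have hopen := isOpen_extChartAt_target (I := J) z
  have hs : ∀ y ∈ (extChartAt J z).target, ContMDiffAt 𝓘(ℝ, E × (E →L[ℝ] ℝ)) J ∞ h y :=
    fun y hy => (contMDiffOn_extChartAt_symm (n := ∞) z).contMDiffAt (hopen.mem_nhds hy)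
  have hz := mem_extChartAt_target (I := J) z
  have h1 : ContDiffAt ℝ ∞ (fun y => ((h y).2.comp
      (mfderiv 𝓘(ℝ, E × (E →L[ℝ] ℝ)) I (fun y => (h y).proj) y) : E × (E →L[ℝ] ℝ) →L[ℝ] ℝ))
      (extChartAt J z z) := by
    refine contDiffAt_comp_mfderiv (g := fun y => (h y).proj) (φ := fun y => (h y).2) ?_ (hs _ hz)
    exact (contMDiff_proj (n := ∞) (fun x : N => TangentSpace I x →L[ℝ] ℝ)).contMDiffAt.comp _
      (hs _ hz)
  refine (h1.differentiableAt (by simp)).congr_of_eventuallyEq ?_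
  filter_upwards [hopen.mem_nhds hz] with y hy
  exact formPullback_canonicalOneForm ((hs y hy).mdifferentiableAt (by simp))

/-- Naturality of the exterior derivative, `h^*dα = d(h^*α)`, where `h^*α` is computed by the
tautological property. -/
theorem canonicalTwoForm_mfderiv {h : F → CotangentBundle I N} {u : F}
    (hh : ∀ᶠ z in 𝓝 u, ContMDiffAt 𝓘(ℝ, F) (I.prod 𝓘(ℝ, E →L[ℝ] ℝ)) ∞ h z)
    {θ : F → F →L[ℝ] ℝ}
    (hθ : ∀ᶠ z in 𝓝 u, (h z).2.comp (mfderiv 𝓘(ℝ, F) I (fun z => (h z).proj) z) = θ z)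
    (v w : F) :
    canonicalTwoForm I (h u) (mfderiv 𝓘(ℝ, F) (I.prod 𝓘(ℝ, E →L[ℝ] ℝ)) h u v)
      (mfderiv 𝓘(ℝ, F) (I.prod 𝓘(ℝ, E →L[ℝ] ℝ)) h u w) = curl θ u v w := by
  have h1 : formPullback h (canonicalOneForm I) =ᶠ[𝓝 u] θ := by
    filter_upwards [hh, hθ] with z h1 h2
    rw [formPullback_canonicalOneForm (h1.mdifferentiableAt (by simp)), h2]
  have h2 := extDerivOneForm_mfderiv hh.self_of_nhds (differentiableAt_canonicalOneForm (h u)) v w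
  refine h2.trans ?_
  rw [curl_apply, curl_apply, h1.fderiv_eq]

end CanonicalForm

/-! ### The canonical Dirac structure in charts of the dual bundle -/

section CanonicalChart

variable {E H : Type*} [NormedAddCommGroup E] [NormedSpace ℝ E] [FiniteDimensional ℝ E]
  [TopologicalSpace H] {I : ModelWithCorners ℝ E H} [I.Boundaryless] {N : Type*}
  [TopologicalSpace N] [ChartedSpace H N] [IsManifold I ∞ N] {k : ℕ}
  {A : Type*} [NormedAddCommGroup A] [NormedSpace ℝ A] [FiniteDimensional ℝ A]
  {L : DiracStructure I N} {hL : L.HasCharRank k} {φ : OpenPartialHomeomorph N A} {x : N}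

/-- The one-form `∑ c_j Φ_j` on `A × ℝ^k` given by a coframe `Φ`. -/
def coframeForm (Φ : Fin k → A → A →L[ℝ] ℝ) (u : A × (Fin k → ℝ)) : A × (Fin k → ℝ) →L[ℝ] ℝ :=
  (∑ j, u.2 j • Φ j u.1).comp (ContinuousLinearMap.fst ℝ A (Fin k → ℝ))

/-- `Φ` is the coframe of `L ∩ TN` dual to `charFrameAt`, extended by zero on `V`, in a chart. -/
structure IsCoframe (V : L.Splitting) (hL : L.HasCharRank k) (φ : OpenPartialHomeomorph N A)
    (x : N) (Φ : Fin k → A → A →L[ℝ] ℝ) (W : Set A) : Prop where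
  isOpen : IsOpen W
  subset_target : W ⊆ φ.target
  mem_base : ∀ a ∈ W, φ.symm a ∈ (charFrameAt L hL x).base
  smooth : ∀ j, ContDiff ℝ ∞ (Φ j)
  apply_vec : ∀ a ∈ W, ∀ i j, Φ j a (mfderiv I 𝓘(ℝ, A) φ (φ.symm a)
    ((charFrameAt L hL x).vec i (φ.symm a))) = if i = j then 1 else 0
  apply_splitting : ∀ a ∈ W, ∀ j, ∀ v ∈ V.fiber (φ.symm a),
    Φ j a (mfderiv I 𝓘(ℝ, A) φ (φ.symm a) v) = 0

variable {V : L.Splitting} {Φ : Fin k → A → A →L[ℝ] ℝ} {W : Set A}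

namespace IsCoframe

variable (hΦ : IsCoframe V hL φ x Φ W) (hφ : IsSmoothChart I φ)

include hΦ

theorem mem_target {u : A × (Fin k → ℝ)} (hu : u.1 ∈ W) :
    u ∈ (charDualChart L hL φ x).target :=
  (mem_charDualChart_target L hL φ x u).mpr ⟨hΦ.subset_target hu, hΦ.mem_base _ hu⟩

theorem contDiff_coframeForm : ContDiff ℝ ∞ (coframeForm Φ) := by
  have h1 : ContDiff ℝ ∞ (fun u : A × (Fin k → ℝ) => ∑ j, u.2 j • Φ j u.1) :=
    ContDiff.sum fun j _ => ContDiff.smul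
      ((contDiff_apply ℝ ℝ j).comp contDiff_snd) ((hΦ.smooth j).comp contDiff_fst)
  exact h1.clm_comp contDiff_const

/-- Two covectors that vanish on `V` and take the values `u.2 i` on the frame of `E` coincide. -/
theorem embed_eq {u : A × (Fin k → ℝ)} (hu : u.1 ∈ W) :
    V.embed ((charDualChart L hL φ x).symm u) =
      ⟨φ.symm u.1, (∑ j, u.2 j • Φ j u.1).comp (mfderiv I 𝓘(ℝ, A) φ (φ.symm u.1))⟩ := by
  have : FiniteDimensional ℝ (TangentSpace I (φ.symm u.1)) :=
    inferInstanceAs (FiniteDimensional ℝ E)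
  have : T2Space (TangentSpace I (φ.symm u.1)) := inferInstanceAs (T2Space E)
  let l : L.char (φ.symm u.1) →L[ℝ] ℝ := ((charDualChart L hL φ x).symm u).2
  have hl : ∀ i, l ((charFrameAt L hL x).vec i (φ.symm u.1)) = u.2 i :=
    charDualChart_symm_apply_vec L hL x (hΦ.mem_target hu)
  have hmk : V.embed ((charDualChart L hL φ x).symm u) = ⟨φ.symm u.1,
    LinearMap.toContinuousLinearMap (l.toLinearMap ∘ₗ
      (L.char (φ.symm u.1)).projectionOnto (V.fiber (φ.symm u.1)) (V.isCompl (φ.symm u.1)))⟩ := rfl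
  rw [hmk]
  refine congrArg (TotalSpace.mk (φ.symm u.1)) ?_
  have key : ∀ w, l ((L.char (φ.symm u.1)).projectionOnto (V.fiber (φ.symm u.1))
      (V.isCompl (φ.symm u.1)) w) =
      (∑ j, u.2 j • Φ j u.1) (mfderiv I 𝓘(ℝ, A) φ (φ.symm u.1) w) := fun w => by
    have h1 : w ∈ L.char (φ.symm u.1) ⊔ V.fiber (φ.symm u.1) := by
      rw [(V.isCompl _).sup_eq_top]; trivial
    obtain ⟨e, he, v, hv, rfl⟩ := Submodule.mem_sup.mp h1
    let b := (charFrameAt L hL x).basis hL (hΦ.mem_base _ hu)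
    have hb : ∀ i, b i = (charFrameAt L hL x).vec i (φ.symm u.1) := fun i => by
      simp [b, CharFrame.basis]
    have hsum := b.sum_repr ⟨e, he⟩
    simp only [hb] at hsum
    have h2 : l ⟨e, he⟩ = ∑ i, b.repr ⟨e, he⟩ i * u.2 i := by
      conv_lhs => rw [← hsum]
      rw [map_sum]
      exact Finset.sum_congr rfl fun i _ => by rw [map_smul, hl, smul_eq_mul]
    let B : TangentSpace I (φ.symm u.1) →L[ℝ] A := mfderiv I 𝓘(ℝ, A) φ (φ.symm u.1)
    have hB : ∀ i j, (Φ j u.1).comp B ((charFrameAt L hL x).vec i (φ.symm u.1)) =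
      if i = j then 1 else 0 := hΦ.apply_vec _ hu
    have hBv : ∀ j, (Φ j u.1).comp B v = 0 := fun j => hΦ.apply_splitting _ hu j v hv
    have h3 : ∀ j, (Φ j u.1).comp B e = b.repr ⟨e, he⟩ j := fun j => by
      have h4 : e = ∑ i, b.repr ⟨e, he⟩ i • ((charFrameAt L hL x).vec i (φ.symm u.1) :
          TangentSpace I (φ.symm u.1)) := by
        have h5 := congrArg Subtype.val hsum
        simpa using h5.symm
      conv_lhs => rw [h4]
      rw [map_sum]
      simp only [map_smul, hB]
      simp
    have h4 : (L.char (φ.symm u.1)).projectionOnto (V.fiber (φ.symm u.1))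
        (V.isCompl (φ.symm u.1)) (e + v) = ⟨e, he⟩ := by
      rw [map_add, Submodule.projectionOnto_apply_right _ ⟨v, hv⟩,
        Submodule.projectionOnto_apply_left _ ⟨e, he⟩, add_zero]
    rw [h4, h2]
    have h5 : ∑ j, u.2 j • (Φ j u.1).comp B (e + v) = (∑ j, u.2 j • Φ j u.1) (B (e + v)) := by
      rw [sum_apply]; rfl
    refine Eq.trans ?_ h5
    refine Finset.sum_congr rfl fun j _ => ?_
    rw [map_add, h3, hBv, add_zero, smul_eq_mul, mul_comm]
  exact ContinuousLinearMap.ext key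

include hφ

theorem contMDiffAt_embed {u : A × (Fin k → ℝ)} (hu : u.1 ∈ W) :
    ContMDiffAt 𝓘(ℝ, A × (Fin k → ℝ)) (I.prod 𝓘(ℝ, E →L[ℝ] ℝ)) ∞
      (fun u => V.embed ((charDualChart L hL φ x).symm u)) u := by
  have h1 : ContMDiffAt 𝓘(ℝ, A × (Fin k → ℝ)) (I.prod 𝓘(ℝ, E →L[ℝ] ℝ)) ∞
      (fun u : A × (Fin k → ℝ) => (⟨φ.symm u.1, (∑ j, u.2 j • Φ j u.1).comp
        (mfderiv I 𝓘(ℝ, A) φ (φ.symm u.1))⟩ : CotangentBundle I N)) u := by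
    have hut := hΦ.subset_target hu
    refine contMDiffAt_cotangent_comp_mfderiv (b := fun u : A × (Fin k → ℝ) => φ.symm u.1)
      (θ := fun u : A × (Fin k → ℝ) => ∑ j, u.2 j • Φ j u.1) ?_ (hφ.contMDiffAt (φ.map_target hut)) ?_
    · exact (hφ.contMDiffAt_symm hut).comp u contDiff_fst.contMDiff.contMDiffAt
    · have h1 : ContDiff ℝ ∞ (fun u : A × (Fin k → ℝ) => ∑ j, u.2 j • Φ j u.1) :=
        ContDiff.sum fun j _ => ContDiff.smul
          ((contDiff_apply ℝ ℝ j).comp contDiff_snd) ((hΦ.smooth j).comp contDiff_fst)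
      exact h1.contMDiff.contMDiffAt
  refine h1.congr_of_eventuallyEq ?_
  filter_upwards [(hΦ.isOpen.preimage continuous_fst).mem_nhds hu] with z hz
  exact hΦ.embed_eq hz

/-- The two-form defining the canonical Dirac structure, in a chart. -/
theorem pullbackForm_apply {u : A × (Fin k → ℝ)} (hu : u.1 ∈ W) (v w : A × (Fin k → ℝ)) :
    V.pullbackForm hL ((charDualChart L hL φ x).symm u)
      (mfderiv 𝓘(ℝ, A × (Fin k → ℝ)) (I.prod 𝓘(ℝ, Fin k → ℝ)) (charDualChart L hL φ x).symm u v)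
      (mfderiv 𝓘(ℝ, A × (Fin k → ℝ)) (I.prod 𝓘(ℝ, Fin k → ℝ)) (charDualChart L hL φ x).symm u w) =
      curl (coframeForm Φ) u v w := by
  have hχ := isSmoothChart_charDualChart L hL x hφ
  have hut := hΦ.mem_target hu
  set χ := charDualChart L hL φ x with hχdef
  let h : A × (Fin k → ℝ) → CotangentBundle I N := fun u => V.embed (χ.symm u)
  have hh : ∀ᶠ z in 𝓝 u, z.1 ∈ W := (hΦ.isOpen.preimage continuous_fst).mem_nhds hu
  -- Differentiability of the embedding is read off its expression in the chart, where it is given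
  -- by the smooth coframe.
  have hemb : MDifferentiableAt (I.prod 𝓘(ℝ, Fin k → ℝ)) (I.prod 𝓘(ℝ, E →L[ℝ] ℝ))
      (fun y : L.CharDualSpace hL => V.embed y) (χ.symm u) := by
    have h1 : MDifferentiableAt (I.prod 𝓘(ℝ, Fin k → ℝ)) (I.prod 𝓘(ℝ, E →L[ℝ] ℝ)) (h ∘ χ)
        (χ.symm u) := by
      refine MDifferentiableAt.comp (χ.symm u) (I' := 𝓘(ℝ, A × (Fin k → ℝ))) ?_
        ((hχ.contMDiffAt (χ.map_target hut)).mdifferentiableAt (by simp))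
      rw [χ.right_inv hut]
      exact (hΦ.contMDiffAt_embed hφ hu).mdifferentiableAt (by simp)
    refine h1.congr_of_eventuallyEq ?_
    filter_upwards [χ.open_source.mem_nhds (χ.map_target hut)] with e he
    exact (congrArg V.embed (χ.left_inv he)).symm
  have hcomp : mfderiv 𝓘(ℝ, A × (Fin k → ℝ)) (I.prod 𝓘(ℝ, E →L[ℝ] ℝ)) h u =
      (mfderiv (I.prod 𝓘(ℝ, Fin k → ℝ)) (I.prod 𝓘(ℝ, E →L[ℝ] ℝ))
        (fun y : L.CharDualSpace hL => V.embed y) (χ.symm u)).comp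
        (mfderiv 𝓘(ℝ, A × (Fin k → ℝ)) (I.prod 𝓘(ℝ, Fin k → ℝ)) χ.symm u) :=
    mfderiv_comp u hemb ((hχ.contMDiffAt_symm hut).mdifferentiableAt (by simp))
  -- The Liouville form pulls back to `∑ cⱼ Φⱼ`: the differential of `φ` in the covector cancels
  -- that of `φ.symm` in the base map.
  have hθ : ∀ᶠ z in 𝓝 u, (h z).2.comp (mfderiv 𝓘(ℝ, A × (Fin k → ℝ)) I (fun z => (h z).proj) z) =
      coframeForm Φ z := by
    filter_upwards [hh] with z hz
    have h1 : mfderiv 𝓘(ℝ, A × (Fin k → ℝ)) I (fun z : A × (Fin k → ℝ) => φ.symm z.1) z =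
        (mfderiv 𝓘(ℝ, A) I φ.symm z.1).comp (ContinuousLinearMap.fst ℝ A (Fin k → ℝ)) := by
      refine HasMFDerivAt.mfderiv ?_
      exact ((hφ.contMDiffAt_symm (hΦ.subset_target hz)).mdifferentiableAt
        (by simp)).hasMFDerivAt.comp z hasFDerivAt_fst.hasMFDerivAt
    refine ContinuousLinearMap.ext fun w => ?_
    have h2 : (h z).2 = (∑ j, z.2 j • Φ j z.1).comp (mfderiv I 𝓘(ℝ, A) φ (φ.symm z.1)) := by
      have h3 := hΦ.embed_eq hz
      exact eq_of_heq (TotalSpace.mk.inj h3).2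
    have h4 := hφ.mfderiv_apply_symm (hΦ.subset_target hz) w.1
    have h5 : (h z).2 (mfderiv 𝓘(ℝ, A × (Fin k → ℝ)) I (fun z : A × (Fin k → ℝ) => φ.symm z.1) z w) =
        (∑ j, z.2 j • Φ j z.1) w.1 := by
      rw [h1, h2]
      exact congrArg (fun w => (∑ j, z.2 j • Φ j z.1) w) h4
    exact h5
  have h6 := canonicalTwoForm_mfderiv (hh.mono fun z hz => hΦ.contMDiffAt_embed hφ hz) hθ v w
  refine Eq.trans ?_ h6
  have h7 : mfderiv 𝓘(ℝ, A × (Fin k → ℝ)) (I.prod 𝓘(ℝ, E →L[ℝ] ℝ))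
      (fun z => V.embed (χ.symm z)) u = _ := hcomp
  rw [h7]
  rfl

/-- In the chart the bundle projection is `fst` and the gauge form is the curl of `coframeForm Φ`.
The fibre component of `w` is therefore constrained only through the gauge term. -/
theorem mem_diracPullback_canonicalDirac {u : A × (Fin k → ℝ)} (hu : u.1 ∈ W)
    (w : A × (Fin k → ℝ)) (η : A × (Fin k → ℝ) →L[ℝ] ℝ) :
    (w, η) ∈ diracPullback (mfderiv 𝓘(ℝ, A × (Fin k → ℝ)) (I.prod 𝓘(ℝ, Fin k → ℝ))
      (charDualChart L hL φ x).symm u)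
      (V.canonicalDirac hL ((charDualChart L hL φ x).symm u)) ↔
    ∃ ξ : A →L[ℝ] ℝ, (w.1, ξ) ∈ diracPullback (mfderiv 𝓘(ℝ, A) I φ.symm u.1)
      (L.fiber (φ.symm u.1)) ∧ η = ξ.comp (ContinuousLinearMap.fst ℝ A (Fin k → ℝ)) +
        curl (coframeForm Φ) u w := by
  have hχ := isSmoothChart_charDualChart L hL x hφ
  have hut := hΦ.mem_target hu
  have hform := hΦ.pullbackForm_apply hφ hu
  set χ := charDualChart L hL φ x with hχdef
  have hproj : (mfderiv (I.prod 𝓘(ℝ, Fin k → ℝ)) I (fun y : L.CharDualSpace hL => y.proj)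
      (χ.symm u)).comp (mfderiv 𝓘(ℝ, A × (Fin k → ℝ)) (I.prod 𝓘(ℝ, Fin k → ℝ)) χ.symm u) =
      (mfderiv 𝓘(ℝ, A) I φ.symm u.1).comp (ContinuousLinearMap.fst ℝ A (Fin k → ℝ)) := by
    have h1 : MDifferentiableAt (I.prod 𝓘(ℝ, Fin k → ℝ)) I (fun y : L.CharDualSpace hL => y.proj)
      (χ.symm u) := (contMDiff_proj (n := ∞) (L.CharDual hL)).mdifferentiable (by simp) _
    have h2 := h1.hasMFDerivAt.comp u
      ((hχ.contMDiffAt_symm hut).mdifferentiableAt (by simp)).hasMFDerivAt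
    have h3 : HasMFDerivAt 𝓘(ℝ, A × (Fin k → ℝ)) I (fun z : A × (Fin k → ℝ) => φ.symm z.1) u
        ((mfderiv 𝓘(ℝ, A) I φ.symm u.1).comp (ContinuousLinearMap.fst ℝ A (Fin k → ℝ))) :=
      ((hφ.contMDiffAt_symm (hΦ.subset_target hu)).mdifferentiableAt
        (by simp)).hasMFDerivAt.comp u hasFDerivAt_fst.hasMFDerivAt
    exact hasMFDerivAt_unique h2 h3
  have hprojv : ∀ z : A × (Fin k → ℝ), mfderiv (I.prod 𝓘(ℝ, Fin k → ℝ)) I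
      (fun y : L.CharDualSpace hL => y.proj) (χ.symm u)
      (mfderiv 𝓘(ℝ, A × (Fin k → ℝ)) (I.prod 𝓘(ℝ, Fin k → ℝ)) χ.symm u z) =
      mfderiv 𝓘(ℝ, A) I φ.symm u.1 z.1 := fun z => congrArg (fun B : A × (Fin k → ℝ) →L[ℝ] E => B z) hproj
  let D := hχ.derivSymm hut
  constructor
  · rintro ⟨ζ, ⟨ξ', ⟨ξ'', h1, hξ'⟩, hζ⟩, hη⟩
    refine ⟨ξ''.comp (mfderiv 𝓘(ℝ, A) I φ.symm u.1), ⟨ξ'', ?_, rfl⟩, ?_⟩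
    · exact (hprojv w) ▸ h1
    · refine ContinuousLinearMap.ext fun z => ?_
      have h2 : η z = ζ (D z) := congrArg (fun B : A × (Fin k → ℝ) →L[ℝ] ℝ => B z) hη
      have h3 : ζ (D z) = ξ' (D z) + V.pullbackForm hL (χ.symm u) (D w) (D z) :=
        congrArg (fun B => B (D z)) hζ
      have h4 : ξ' (D z) = ξ'' (mfderiv 𝓘(ℝ, A) I φ.symm u.1 z.1) :=
        (congrArg (fun B => B (D z)) hξ').trans (congrArg ξ'' (hprojv z))
      rw [h2, h3, h4]
      exact congrArg (ξ'' (mfderiv 𝓘(ℝ, A) I φ.symm u.1 z.1) + ·) (hform w z)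
  · rintro ⟨ξ, ⟨ξ'', h1, hξ⟩, rfl⟩
    refine ⟨ξ''.comp (mfderiv (I.prod 𝓘(ℝ, Fin k → ℝ)) I
      (fun y : L.CharDualSpace hL => y.proj) (χ.symm u)) +
        V.pullbackForm hL (χ.symm u) (D w), ⟨_, ⟨ξ'', ?_, rfl⟩, rfl⟩, ?_⟩
    · exact (hprojv w) ▸ h1
    · refine ContinuousLinearMap.ext fun z => ?_
      have h4 : ξ z.1 = ξ'' (mfderiv 𝓘(ℝ, A) I φ.symm u.1 z.1) :=
        congrArg (fun B : A →L[ℝ] ℝ => B z.1) hξ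
      have h5 : ξ z.1 + curl (coframeForm Φ) u w z = ξ'' (mfderiv (I.prod 𝓘(ℝ, Fin k → ℝ)) I
          (fun y : L.CharDualSpace hL => y.proj) (χ.symm u) (D z)) +
          V.pullbackForm hL (χ.symm u) (D w) (D z) := by
        rw [h4]
        exact congrArg₂ (· + ·) (congrArg ξ'' (hprojv z)).symm (hform w z).symm
      exact h5

end IsCoframe

end CanonicalChart

/-! ## The canonical Poisson structure in a chart -/

section CanonicalPoisson

theorem diracPullback_isotropic {V W : Type*} [AddCommGroup V] [Module ℝ V] [TopologicalSpace V]
    [AddCommGroup W] [Module ℝ W] [TopologicalSpace W] {B : V →L[ℝ] W}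
    {D : Submodule ℝ (W × (W →L[ℝ] ℝ))} (hD : ∀ a ∈ D, ∀ b ∈ D, a.2 b.1 + b.2 a.1 = 0)
    {v w : V} {ξ η : V →L[ℝ] ℝ} (hv : (v, ξ) ∈ diracPullback B D)
    (hw : (w, η) ∈ diracPullback B D) : ξ w + η v = 0 := by
  obtain ⟨ξ', h1, h2⟩ := hv
  obtain ⟨η', h3, h4⟩ := hw
  have h5 : ξ = ξ'.comp B := h2
  have h6 : η = η'.comp B := h4
  rw [h5, h6]
  exact hD _ h1 _ h3

variable {E H : Type*} [NormedAddCommGroup E] [NormedSpace ℝ E] [FiniteDimensional ℝ E]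
  [TopologicalSpace H] {I : ModelWithCorners ℝ E H} [I.Boundaryless] {N : Type*}
  [TopologicalSpace N] [ChartedSpace H N] [IsManifold I ∞ N] {k : ℕ}
  {A : Type*} [NormedAddCommGroup A] [NormedSpace ℝ A] [FiniteDimensional ℝ A]
  {L : DiracStructure I N} {hL : L.HasCharRank k} {φ : OpenPartialHomeomorph N A} {x : N}
  {V : L.Splitting} {Φ : Fin k → A → A →L[ℝ] ℝ} {W : Set A}

/-- On the zero section the derivatives of the `Φⱼ` are multiplied by `cⱼ = 0`, so `d(∑ cⱼ Φⱼ)`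
reduces to `∑ dcⱼ ∧ Φⱼ`. -/
theorem curl_coframeForm (hΦ : ∀ j, ContDiff ℝ ∞ (Φ j)) (a : A) (v w : A × (Fin k → ℝ)) :
    curl (coframeForm Φ) (a, 0) v w = ∑ j, v.2 j * Φ j a w.1 - ∑ j, w.2 j * Φ j a v.1 := by
  have h1 : HasFDerivAt (fun u : A × (Fin k → ℝ) => ∑ j, u.2 j • Φ j u.1)
      (∑ j, ((ContinuousLinearMap.proj j : (Fin k → ℝ) →L[ℝ] ℝ).comp
        (ContinuousLinearMap.snd ℝ A (Fin k → ℝ))).smulRight (Φ j a)) (a, 0) := by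
    refine HasFDerivAt.fun_sum fun j _ => ?_
    have h2 : HasFDerivAt (fun u : A × (Fin k → ℝ) => u.2 j)
        ((ContinuousLinearMap.proj j : (Fin k → ℝ) →L[ℝ] ℝ).comp
          (ContinuousLinearMap.snd ℝ A (Fin k → ℝ))) (a, 0) :=
      ((ContinuousLinearMap.proj j : (Fin k → ℝ) →L[ℝ] ℝ).comp
          (ContinuousLinearMap.snd ℝ A (Fin k → ℝ))).hasFDerivAt
    have h3 : HasFDerivAt (fun u : A × (Fin k → ℝ) => Φ j u.1)
        ((fderiv ℝ (Φ j) a).comp (ContinuousLinearMap.fst ℝ A (Fin k → ℝ))) (a, 0) :=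
      ((hΦ j).differentiable (by simp) a).hasFDerivAt.comp (a, (0 : Fin k → ℝ)) hasFDerivAt_fst
    refine (h2.smul h3).congr_fderiv ?_
    simp
  have h2 : fderiv ℝ (coframeForm Φ) (a, 0) = _ :=
    (((ContinuousLinearMap.compL ℝ (A × (Fin k → ℝ)) A ℝ).flip
      (ContinuousLinearMap.fst ℝ A (Fin k → ℝ))).hasFDerivAt.comp (a, (0 : Fin k → ℝ)) h1).fderiv
  have h3 : ∀ v w : A × (Fin k → ℝ), fderiv ℝ (coframeForm Φ) (a, 0) v w =
      ∑ j, v.2 j * Φ j a w.1 := fun v w => by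
    rw [h2]
    simp [sum_apply]
  rw [curl_apply, h3, h3]

namespace IsCoframe

variable (hΦ : IsCoframe V hL φ x Φ W) (hφ : IsSmoothChart I φ)

include hΦ hφ

theorem exists_char_frame {a : A} (ha : a ∈ W) : ∃ s : Fin k → A,
    (∀ i, (s i, (0 : A →L[ℝ] ℝ)) ∈
      diracPullback (mfderiv 𝓘(ℝ, A) I φ.symm a) (L.fiber (φ.symm a))) ∧
    ∀ i j, Φ j a (s i) = if i = j then 1 else 0 := by
  refine ⟨fun i => mfderiv I 𝓘(ℝ, A) φ (φ.symm a) ((charFrameAt L hL x).vec i (φ.symm a)),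
    fun i => ⟨0, ?_, ContinuousLinearMap.ext fun w => rfl⟩, hΦ.apply_vec a ha⟩
  have h1 := hφ.mfderiv_symm_apply' (hΦ.subset_target ha)
    ((charFrameAt L hL x).vec i (φ.symm a) : TangentSpace I (φ.symm a))
  have h2 : (((charFrameAt L hL x).vec i (φ.symm a) : TangentSpace I (φ.symm a)),
    (0 : TangentSpace I (φ.symm a) →L[ℝ] ℝ)) ∈ L.fiber (φ.symm a) :=
      ((charFrameAt L hL x).vec i (φ.symm a)).2
  exact h1.symm ▸ h2

theorem eq_zero {a : A} (ha : a ∈ W) {v : A} (hv : (v, (0 : A →L[ℝ] ℝ)) ∈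
      diracPullback (mfderiv 𝓘(ℝ, A) I φ.symm a) (L.fiber (φ.symm a)))
    (hv' : ∀ j, Φ j a v = 0) : v = 0 := by
  let D := hφ.derivSymm (hΦ.subset_target ha)
  obtain ⟨θ, hθ, hθ0⟩ := hv
  have h2 : θ = 0 := ContinuousLinearMap.ext fun w => by
    have h3 := congrArg (fun B : A →L[ℝ] ℝ => B (D.symm w)) hθ0
    exact (congrArg θ (D.apply_symm_apply w)).symm.trans h3.symm
  rw [h2] at hθ
  have hc : D v ∈ L.char (φ.symm a) := hθ
  let b := (charFrameAt L hL x).basis hL (hΦ.mem_base _ ha)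
  have hb : ∀ i, b i = (charFrameAt L hL x).vec i (φ.symm a) := fun i => by
    simp [b, CharFrame.basis]
  have hsum := b.sum_repr ⟨D v, hc⟩
  simp only [hb] at hsum
  have h4 : D v = ∑ i, b.repr ⟨D v, hc⟩ i • ((charFrameAt L hL x).vec i (φ.symm a) :
      TangentSpace I (φ.symm a)) := by
    have h5 := congrArg Subtype.val hsum
    simpa using h5.symm
  let B : TangentSpace I (φ.symm a) →L[ℝ] A := mfderiv I 𝓘(ℝ, A) φ (φ.symm a)
  have hB : ∀ i j, (Φ j a).comp B ((charFrameAt L hL x).vec i (φ.symm a)) =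
    if i = j then 1 else 0 := hΦ.apply_vec _ ha
  have hBD : B (D v) = v := hφ.mfderiv_apply_symm (hΦ.subset_target ha) v
  have h6 : ∀ j, b.repr ⟨D v, hc⟩ j = 0 := fun j => by
    have h7 : (Φ j a).comp B (D v) = 0 := by
      change Φ j a (B (D v)) = 0
      rw [hBD]; exact hv' j
    rw [h4, map_sum] at h7
    simp only [map_smul, hB] at h7
    simpa using h7
  have h8 : D v = 0 := by rw [h4]; simp [h6]
  rw [← hBD, h8]
  exact map_zero B

/-- The canonical Dirac structure is the graph of a Poisson structure near the zero section. -/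
theorem exists_isPoissonNear {a₀ : A} (ha₀ : a₀ ∈ W) :
    ∃ S : A × (Fin k → ℝ) → (A × (Fin k → ℝ) →L[ℝ] ℝ) →L[ℝ] A × (Fin k → ℝ),
      IsPoissonNear S (a₀, 0) ∧ ∀ᶠ u in 𝓝 (a₀, (0 : Fin k → ℝ)), ∀ v η, S u η = v ↔
        ∃ ξ : A →L[ℝ] ℝ, (v.1, ξ) ∈ diracPullback (mfderiv 𝓘(ℝ, A) I φ.symm u.1)
          (L.fiber (φ.symm u.1)) ∧ η = ξ.comp (ContinuousLinearMap.fst ℝ A (Fin k → ℝ)) +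
            curl (coframeForm Φ) u v := by
  obtain ⟨X, ξ, hX, hξ, hiso, hT, hmem, hind⟩ :=
    L.exists_frame_pullback (hφ.eventually_symm (hΦ.subset_target ha₀))
  have hn : Module.finrank ℝ E = Module.finrank ℝ A :=
    (hφ.derivSymm (hΦ.subset_target ha₀)).toLinearEquiv.finrank_eq.symm
  have hc : Filter.Tendsto (Prod.fst : A × (Fin k → ℝ) → A) (𝓝 (a₀, 0)) (𝓝 a₀) :=
    continuous_fst.tendsto _
  -- The frame of `π^*L`: the frame of `L` with zero fibre component, and the vertical vectors with
  -- zero covector. It is gauged by the differential of `coframeForm Φ`.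
  let Y : Fin (Module.finrank ℝ E) ⊕ Fin k → A × (Fin k → ℝ) → A × (Fin k → ℝ) :=
    Sum.elim (fun a u => (X a u.1, 0)) (fun j _ => (0, Pi.single j 1))
  let Ξ : Fin (Module.finrank ℝ E) ⊕ Fin k → A × (Fin k → ℝ) → A × (Fin k → ℝ) →L[ℝ] ℝ :=
    Sum.elim (fun a u => (ξ a u.1).comp (ContinuousLinearMap.fst ℝ A (Fin k → ℝ))) (fun _ _ => 0)
  have hY : ∀ i, ContDiff ℝ ∞ (Y i) := by
    rintro (a | j)
    · exact ((hX a).comp contDiff_fst).prodMk contDiff_const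
    · exact contDiff_const
  have hΞ : ∀ i, ContDiff ℝ ∞ (Ξ i) := by
    rintro (a | j)
    · exact ((hξ a).comp contDiff_fst).clm_comp contDiff_const
    · exact contDiff_const
  have hYd : ∀ a u w, fderiv ℝ (Y (Sum.inl a)) u w = (fderiv ℝ (X a) u.1 w.1, 0) := fun a u w => by
    have h1 : HasFDerivAt (fun u : A × (Fin k → ℝ) => X a u.1) _ u :=
      ((hX a).differentiable (by simp) u.1).hasFDerivAt.comp u hasFDerivAt_fst
    have h2 : fderiv ℝ (Y (Sum.inl a)) u = _ := (h1.prodMk (hasFDerivAt_const 0 u)).fderiv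
    rw [h2]
    simp
  have hΞd : ∀ a u w z, fderiv ℝ (Ξ (Sum.inl a)) u w z = fderiv ℝ (ξ a) u.1 w.1 z.1 :=
      fun a u w z => by
    have h1 : HasFDerivAt (fun u : A × (Fin k → ℝ) => ξ a u.1) _ u :=
      ((hξ a).differentiable (by simp) u.1).hasFDerivAt.comp u hasFDerivAt_fst
    have h2 : fderiv ℝ (Ξ (Sum.inl a)) u = _ :=
      (((ContinuousLinearMap.compL ℝ (A × (Fin k → ℝ)) A ℝ).flip
        (ContinuousLinearMap.fst ℝ A (Fin k → ℝ))).hasFDerivAt.comp u h1).fderiv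
    rw [h2]
    simp
  have hYd' : ∀ j u, fderiv ℝ (Y (Sum.inr j)) u = 0 := fun j u => by
    exact (hasFDerivAt_const _ u).fderiv
  have hΞd' : ∀ j u, fderiv ℝ (Ξ (Sum.inr j)) u = 0 := fun j u => by
    exact (hasFDerivAt_const _ u).fderiv
  have hYl : ∀ a u, Y (Sum.inl a) u = (X a u.1, 0) := fun _ _ => rfl
  have hYr : ∀ j u, Y (Sum.inr j) u = (0, Pi.single j 1) := fun _ _ => rfl
  have hΞl : ∀ a u z, Ξ (Sum.inl a) u z = ξ a u.1 z.1 := fun _ _ _ => rfl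
  have hΞr : ∀ j u, Ξ (Sum.inr j) u = 0 := fun _ _ => rfl
  have hsum : ∀ (u : A × (Fin k → ℝ)) (t : Fin (Module.finrank ℝ E) ⊕ Fin k → ℝ),
      ∑ i, t i • Y i u = (∑ a, t (Sum.inl a) • X a u.1, fun j => t (Sum.inr j)) ∧
      ∑ i, t i • Ξ i u = (∑ a, t (Sum.inl a) • ξ a u.1).comp
        (ContinuousLinearMap.fst ℝ A (Fin k → ℝ)) := fun u t => by
    constructor
    · rw [Fintype.sum_sum_type]
      simp only [hYl, hYr]
      refine Prod.ext ?_ ?_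
      · simp [Prod.fst_sum]
      · funext j
        simp [Prod.snd_sum, Finset.sum_apply, Pi.single_apply]
    · rw [Fintype.sum_sum_type]
      refine ContinuousLinearMap.ext fun z => ?_
      simp [hΞr, hΞl, sum_apply]
  have hsum' : ∀ (u : A × (Fin k → ℝ)) (t : Fin (Module.finrank ℝ E) ⊕ Fin k → ℝ),
      ∑ i, t i • (Ξ i u + curl (coframeForm Φ) u (Y i u)) =
        (∑ a, t (Sum.inl a) • ξ a u.1).comp (ContinuousLinearMap.fst ℝ A (Fin k → ℝ)) +
        curl (coframeForm Φ) u (∑ a, t (Sum.inl a) • X a u.1, fun j => t (Sum.inr j)) :=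
      fun u t => by
    rw [← (hsum u t).1, ← (hsum u t).2, map_sum, ← Finset.sum_add_distrib]
    exact Finset.sum_congr rfl fun i _ => by rw [smul_add, map_smul]
  obtain ⟨S, hS, hSm⟩ := exists_sharp_of_frame (u₀ := (a₀, 0)) hY hΞ hΦ.contDiff_coframeForm
    (by
      filter_upwards [hc.eventually hiso] with u hu
      rintro (a | i) (b | j)
      · exact hu a b
      · simp [hYr, hΞl, hΞr]
      · simp [hYr, hΞl, hΞr]
      · simp [hΞr])
    (by
      filter_upwards [hc.eventually hT] with u hu
      rintro (a | i) (b | j) (c | l)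
      · simp only [hYd, hΞd, hYl, hΞl]; exact hu a b c
      all_goals simp [hYd, hΞd, hYd', hΞd', hYl, hYr, hΞl, hΞr])
    (by
      rw [Fintype.card_sum, Fintype.card_fin, Fintype.card_fin, Module.finrank_prod,
        Module.finrank_fin_fun, hn])
    (by
      -- Nondegeneracy at the zero section. Testing on fibre directions gives `Φⱼ(v) = 0`. Testing
      -- on the frame `sᵢ` of `E`, where `η(sᵢ) = 0` by isotropy, shows that the fibre coefficients
      -- vanish. The remaining directions give `η = 0`, so `v` lies in `E` and is killed by the
      -- coframe, hence is zero.
      intro t ht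
      rw [hsum'] at ht
      set v := ∑ a, t (Sum.inl a) • X a a₀ with hv
      set η := ∑ a, t (Sum.inl a) • ξ a a₀ with hη
      have hvη := (hmem.self_of_nhds v η).mpr ⟨fun a => t (Sum.inl a), hv, hη⟩
      have heq : ∀ z : A × (Fin k → ℝ), η z.1 + (∑ j, t (Sum.inr j) * Φ j a₀ z.1 -
          ∑ j, z.2 j * Φ j a₀ v) = 0 := fun z => by
        have h1 := congrArg (fun B : A × (Fin k → ℝ) →L[ℝ] ℝ => B z) ht
        have h2 := curl_coframeForm hΦ.smooth a₀ (v, fun j => t (Sum.inr j)) z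
        rw [← h2]
        exact h1
      have h1 : ∀ j, Φ j a₀ v = 0 := fun j => by
        have := heq (0, Pi.single j 1)
        simpa [Pi.single_apply] using this
      obtain ⟨s, hs, hsΦ⟩ := hΦ.exists_char_frame hφ ha₀
      have h2 : ∀ i, t (Sum.inr i) = 0 := fun i => by
        have h3 := heq (s i, 0)
        have h4 := diracPullback_isotropic (L.isotropic _) hvη (hs i)
        have h5 : η (s i) = 0 := by
          have h6 : (0 : A →L[ℝ] ℝ) v = 0 := rfl
          rw [← h4]
          exact (add_zero _).symm
        simpa [h5, hsΦ] using h3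
      have h3 : η = 0 := ContinuousLinearMap.ext fun w => by
        have := heq (w, 0)
        simpa [h2] using this
      rw [h3] at hvη
      have h4 : v = 0 := hΦ.eq_zero hφ ha₀ hvη h1
      have h5 := hind.self_of_nhds (fun a => t (Sum.inl a)) (hv.symm.trans h4) (hη.symm.trans h3)
      funext i
      rcases i with a | j
      · exact congrFun h5 a
      · exact h2 j)
  refine ⟨S, hS, ?_⟩
  filter_upwards [hSm, hc.eventually hmem] with u h1 h2 v η
  rw [h1]
  constructor
  · rintro ⟨t, hv, hη⟩
    rw [(hsum u t).1] at hv
    rw [hsum', ← hv] at hη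
    exact ⟨_, (h2 _ _).mpr ⟨fun a => t (Sum.inl a), by rw [hv], rfl⟩, hη⟩
  · rintro ⟨ζ, hζ, rfl⟩
    obtain ⟨t, ht1, ht2⟩ := (h2 _ _).mp hζ
    refine ⟨Sum.elim t v.2, ?_, ?_⟩
    · rw [(hsum u _).1]
      exact Prod.ext ht1 rfl
    · rw [hsum', ht2]
      have h3 : v = (∑ a, t a • X a u.1, v.2) := Prod.ext ht1 rfl
      conv_lhs => rw [h3]
      rfl

omit hφ in
theorem eventually_prod_mem {a₀ : A} (ha₀ : a₀ ∈ W) :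
    ∀ᶠ u in 𝓝 (a₀, (0 : Fin k → ℝ)), u.1 ∈ W :=
  (hΦ.isOpen.preimage continuous_fst).mem_nhds ha₀

/-- At `c = 0` the gauge form pairs the fibre directions with `E` through the coframe and vanishes
on pairs tangent to the zero section. The first fact places the sharp of conormal covectors in `E`;
the second makes the induced structure on the zero section equal to `L`. -/
theorem isCoisotropicNear {a₀ : A} (ha₀ : a₀ ∈ W)
    {S : A × (Fin k → ℝ) → (A × (Fin k → ℝ) →L[ℝ] ℝ) →L[ℝ] A × (Fin k → ℝ)}
    (hS : ∀ᶠ u in 𝓝 (a₀, (0 : Fin k → ℝ)), ∀ v η, S u η = v ↔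
        ∃ ξ : A →L[ℝ] ℝ, (v.1, ξ) ∈ diracPullback (mfderiv 𝓘(ℝ, A) I φ.symm u.1)
          (L.fiber (φ.symm u.1)) ∧ η = ξ.comp (ContinuousLinearMap.fst ℝ A (Fin k → ℝ)) +
            curl (coframeForm Φ) u v) :
    IsCoisotropicNear S a₀ ∧ ∀ᶠ a in 𝓝 a₀, ∀ v ξ, InducedRel S a v ξ ↔
      (v, ξ) ∈ diracPullback (mfderiv 𝓘(ℝ, A) I φ.symm a) (L.fiber (φ.symm a)) := by
  have hc : Filter.Tendsto (fun a : A => (a, (0 : Fin k → ℝ))) (𝓝 a₀) (𝓝 (a₀, 0)) :=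
    (Continuous.prodMk_left (0 : Fin k → ℝ)).tendsto a₀
  have hS' := hc.eventually hS
  have hcurl := curl_coframeForm hΦ.smooth
  refine ⟨⟨?_, fun κ hκ => ?_⟩, ?_⟩
  · filter_upwards [hS', hΦ.isOpen.mem_nhds ha₀] with a h1 h2 κ
    obtain ⟨s, hs, hsΦ⟩ := hΦ.exists_char_frame hφ h2
    -- The coefficients of the characteristic vector are found by contracting `∑ dcⱼ ∧ Φⱼ` with it;
    -- the sign comes from the order of the two factors.
    have h3 : S (a, 0) (κ.comp (ContinuousLinearMap.snd ℝ A (Fin k → ℝ))) =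
        (-∑ j, κ (Pi.single j 1) • s j, 0) := by
      rw [h1]
      refine ⟨0, ?_, ContinuousLinearMap.ext fun z => ?_⟩
      · have h4 := Submodule.neg_mem _ (Submodule.sum_mem _ fun j (_ : j ∈ Finset.univ) =>
          Submodule.smul_mem _ (κ (Pi.single j 1)) (hs j))
        have h5 : -∑ j, κ (Pi.single j 1) • ((s j, 0) : A × (A →L[ℝ] ℝ)) =
            (-∑ j, κ (Pi.single j 1) • s j, 0) := by
          refine Prod.ext ?_ ?_
          · simp [Prod.fst_sum]
          · simp [Prod.snd_sum]
        exact h5 ▸ h4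
      · have h6 : κ z.2 = ∑ j, z.2 j * κ (Pi.single j 1) := by
          conv_lhs => rw [pi_eq_sum_univ' z.2, map_sum]
          simp
        rw [add_apply, hcurl]
        simp [hsΦ, h6]
    rw [h3]
  · have h1 := (hS.self_of_nhds _ _).mp hκ
    obtain ⟨ξ, -, h2⟩ := h1
    refine ContinuousLinearMap.ext fun c => ?_
    have h3 := congrArg (fun B : A × (Fin k → ℝ) →L[ℝ] ℝ => B (0, c)) h2
    simpa using h3
  · filter_upwards [hS', hΦ.isOpen.mem_nhds ha₀] with a h1 h2 v ξ
    have h0 : ∀ v w : A, curl (coframeForm Φ) (a, 0) (v, (0 : Fin k → ℝ)) (w, 0) = 0 :=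
      fun v w => by rw [hcurl]; simp
    constructor
    · rintro ⟨η, hη, rfl⟩
      obtain ⟨ξ, hξ, h3⟩ := (h1 _ _).mp hη
      have h4 : η.comp (ContinuousLinearMap.inl ℝ A (Fin k → ℝ)) = ξ :=
        ContinuousLinearMap.ext fun w => by
          rw [h3]
          simp [h0]
      rw [h4]
      exact hξ
    · intro h
      refine ⟨_, (h1 _ _).mpr ⟨ξ, h, rfl⟩, ContinuousLinearMap.ext fun w => ?_⟩
      simp [h0]

end IsCoframe

end CanonicalPoisson

/-! ## Poisson diffeomorphisms from charts -/

section Transfer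

variable {E E' H H' : Type*} [NormedAddCommGroup E] [NormedSpace ℝ E] [FiniteDimensional ℝ E]
  [NormedAddCommGroup E'] [NormedSpace ℝ E'] [TopologicalSpace H]
  [TopologicalSpace H'] {I : ModelWithCorners ℝ E H} {J : ModelWithCorners ℝ E' H'}
  {P : Type*} [TopologicalSpace P] [ChartedSpace H P] [IsManifold I ∞ P]
  {Q : Type*} [TopologicalSpace Q] [ChartedSpace H' Q] [IsManifold J ∞ Q]
  {F : Type*} [NormedAddCommGroup F] [NormedSpace ℝ F] [FiniteDimensional ℝ F]
  {χ₁ : OpenPartialHomeomorph P F} {χ₂ : OpenPartialHomeomorph Q F}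

theorem IsSmoothChart.trans {χ : OpenPartialHomeomorph P F} (hχ : IsSmoothChart I χ)
    {G : OpenPartialHomeomorph F F} (hG : ContDiffOn ℝ ∞ G G.source)
    (hG' : ContDiffOn ℝ ∞ G.symm G.target) : IsSmoothChart I (χ.trans G) := by
  constructor
  · exact hG.contMDiffOn.comp (hχ.smooth.mono fun u hu => hu.1) fun u hu => hu.2
  · exact hχ.smooth_symm.comp (hG'.contMDiffOn.mono fun u hu => hu.1) fun u hu => hu.2

/-- The diffeomorphism identifying two charts. -/
def IsSmoothChart.partialDiffeomorph (h₁ : IsSmoothChart I χ₁) (h₂ : IsSmoothChart J χ₂) :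
    PartialDiffeomorph I J P Q ∞ where
  toPartialEquiv := (χ₁.trans χ₂.symm).toPartialEquiv
  open_source := (χ₁.trans χ₂.symm).open_source
  open_target := (χ₁.trans χ₂.symm).open_target
  contMDiffOn_toFun :=
    h₂.smooth_symm.comp (h₁.smooth.mono fun _ hu => hu.1) fun _ hu => hu.2
  contMDiffOn_invFun :=
    h₁.smooth_symm.comp (h₂.smooth.mono fun _ hu => hu.1) fun _ hu => hu.2

variable {D : ∀ q : Q, Submodule ℝ (TangentSpace J q × (TangentSpace J q →L[ℝ] ℝ))}
  {Pi : PoissonStructure I P}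
  (h₁ : IsSmoothChart I χ₁) (h₂ : IsSmoothChart J χ₂)
  (hD : ∀ z ∈ χ₁.target, z ∈ χ₂.target → ∀ v η, Pi.sharpInChart χ₁ z η = v ↔
    (v, η) ∈ diracPullback (mfderiv 𝓘(ℝ, F) J χ₂.symm z) (D (χ₂.symm z)))

include h₁ h₂ hD

/-- In the common chart `D` is the graph of a sharp map, and `(w, 0)` in a graph forces `w = ♯0 =
0`. -/
theorem IsSmoothChart.eq_zero_of_mem {q : Q}
    (hq : q ∈ (h₁.partialDiffeomorph h₂).target) (w : TangentSpace J q)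
    (hw : (w, 0) ∈ D q) : w = 0 := by
  have hq2 : q ∈ χ₂.source := hq.1
  have hq1 : χ₂ q ∈ χ₁.target := hq.2
  obtain ⟨z, hz, hz1, rfl⟩ : ∃ z ∈ χ₂.target, z ∈ χ₁.target ∧ χ₂.symm z = q :=
    ⟨χ₂ q, χ₂.map_source hq2, hq1, χ₂.left_inv hq2⟩
  let B := h₂.derivSymm hz
  have h3 : (B.symm w, (0 : F →L[ℝ] ℝ)) ∈
      diracPullback (mfderiv 𝓘(ℝ, F) J χ₂.symm z) (D (χ₂.symm z)) := by
    refine ⟨0, ?_, ContinuousLinearMap.ext fun v => rfl⟩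
    exact (B.apply_symm_apply w).symm ▸ hw
  have h4 := (hD z hz1 hz _ _).mpr h3
  rw [map_zero] at h4
  rw [← B.apply_symm_apply w, ← h4]
  exact map_zero B

/-- The diffeomorphism reads as the identity in the two charts, so its differential is that of the
first chart followed by that of the inverse of the second. The hypothesis `hD` says that both
structures have the same expression in the common model. -/
theorem IsSmoothChart.diracPullback_eq_graph {u : P}
    (hu : u ∈ (h₁.partialDiffeomorph h₂).source) :
    diracPullback (mfderiv I J (h₁.partialDiffeomorph h₂) u) (D (h₁.partialDiffeomorph h₂ u)) =
      Pi.graph u := by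
  have hu1 : u ∈ χ₁.source := hu.1
  have hu2 : χ₁ u ∈ χ₂.target := hu.2
  let T : TangentSpace I u →L[ℝ] F := mfderiv I 𝓘(ℝ, F) χ₁ u
  let T' : F →L[ℝ] TangentSpace I u := mfderiv 𝓘(ℝ, F) I χ₁.symm (χ₁ u)
  have hT'T : ∀ v, T' (T v) = v := h₁.mfderiv_symm_apply hu1
  let B := h₂.derivSymm hu2
  have hcomp : ∀ v, mfderiv I J (h₁.partialDiffeomorph h₂) u v = B (T v) := fun v => by
    have h3 := mfderiv_comp u ((h₂.contMDiffAt_symm hu2).mdifferentiableAt (by simp))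
      ((h₁.contMDiffAt hu1).mdifferentiableAt (by simp))
    exact congrArg (fun B : E →L[ℝ] E' => B v) h3
  have hsharp : ∀ η : F →L[ℝ] ℝ, Pi.sharpInChart χ₁ (χ₁ u) η = T (Pi.sharp u (η.comp T)) :=
    fun η => PoissonStructure.sharpInChart_of_eq hu1 rfl η
  have hD' := hD (χ₁ u) (χ₁.map_source hu1) hu2
  refine Submodule.ext fun p => ?_
  obtain ⟨v, η⟩ := p
  constructor
  · rintro ⟨ζ, hζ, hη⟩
    have hζ' : (B (T v), ζ) ∈ D (χ₂.symm (χ₁ u)) := by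
      rw [← hcomp v]
      exact hζ
    have h3 := (hD' (T v) (ζ.comp (mfderiv 𝓘(ℝ, F) J χ₂.symm (χ₁ u)))).mpr ⟨ζ, hζ', rfl⟩
    rw [hsharp] at h3
    have h4 : (ContinuousLinearMap.comp ζ (mfderiv 𝓘(ℝ, F) J χ₂.symm (χ₁ u))).comp T = η := by
      refine ContinuousLinearMap.ext fun w => ?_
      have h5 : η w = ζ (mfderiv I J (h₁.partialDiffeomorph h₂) u w) :=
        congrArg (fun B : E →L[ℝ] ℝ => B w) hη
      rw [h5, hcomp]
      rfl
    refine ⟨η, Prod.ext ?_ rfl⟩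
    change Pi.sharp u η = v
    have h6 : T (Pi.sharp u η) = T v := (congrArg (fun θ => T (Pi.sharp u θ)) h4).symm.trans h3
    exact (hT'T _).symm.trans ((congrArg T' h6).trans (hT'T v))
  · rintro ⟨η', hη'⟩
    have h3 : η' = η := congrArg Prod.snd hη'
    have h4 : Pi.sharp u η = v := by rw [← h3]; exact congrArg Prod.fst hη'
    have h5 : (η.comp T').comp T = η := ContinuousLinearMap.ext fun w => congrArg η (hT'T w)
    obtain ⟨ζ, hζ, hη⟩ := (hD' (T v) (η.comp T')).mp (by rw [hsharp, h5, h4])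
    refine ⟨ζ, ?_, ?_⟩
    · have hζ' : (B (T v), ζ) ∈ D (χ₂.symm (χ₁ u)) := hζ
      rw [← hcomp v] at hζ'
      exact hζ'
    · refine ContinuousLinearMap.ext fun w => ?_
      have h6 : η w = (η.comp T') (T w) := congrArg η (hT'T w).symm
      have h7 : (η.comp T') (T w) = ζ (B (T w)) := congrArg (fun B : F →L[ℝ] ℝ => B (T w)) hη
      rw [← hcomp] at h7
      exact h6.trans h7

end Transfer

/-! ## Local uniqueness -/

section ZeroSection

variable {E H : Type*} [NormedAddCommGroup E] [NormedSpace ℝ E] [FiniteDimensional ℝ E]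
  [TopologicalSpace H] {I : ModelWithCorners ℝ E H} {N : Type*} [TopologicalSpace N]
  [ChartedSpace H N] [IsManifold I ∞ N] {k : ℕ}
  {A : Type*} [NormedAddCommGroup A] [NormedSpace ℝ A] [FiniteDimensional ℝ A]
  (L : DiracStructure I N) (hL : L.HasCharRank k) {φ : OpenPartialHomeomorph N A} (x : N)

theorem charDualChart_symm_snd_eq_zero_iff {u : A × (Fin k → ℝ)}
    (hu : u ∈ (charDualChart L hL φ x).target) :
    ((charDualChart L hL φ x).symm u).2 = 0 ↔ u.2 = 0 := by
  have hb := ((mem_charDualChart_target L hL φ x u).mp hu).2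
  have h1 : (charFrameAt L hL x).dualEquiv hL hb ((charDualChart L hL φ x).symm u).2 = u.2 := by
    funext i
    refine ((charFrameAt L hL x).dualEquiv_apply hL hb _ i).trans ?_
    exact charDualChart_symm_apply_vec L hL x hu i
  rw [← h1]
  exact ((charFrameAt L hL x).dualEquiv hL hb).map_eq_zero_iff.symm

theorem charDualChart_symm_zero (hx : x ∈ φ.source) :
    (charDualChart L hL φ x).symm (φ x, 0) = ⟨x, 0⟩ := by
  have h1 : charDualChart L hL φ x ⟨x, 0⟩ = (φ x, 0) := rfl
  rw [← h1]
  exact (charDualChart L hL φ x).left_inv ((mem_charDualChart_source L hL φ x _).mpr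
    ⟨mem_base_charFrameAt L hL x, hx⟩)

end ZeroSection

end

theorem mainTheorem9 (m k : ℕ)
    (M : Type*) [TopologicalSpace M] [ChartedSpace (EuclideanSpace ℝ (Fin m)) M]
    [IsManifold (𝓡 m) ∞ M] [T2Space M] [SecondCountableTopology M]
    (P : Type*) [TopologicalSpace P] [ChartedSpace (EuclideanSpace ℝ (Fin (m + k))) P]
    [IsManifold (𝓡 (m + k)) ∞ P] [T2Space P] [SecondCountableTopology P]
    (L : DiracStructure (𝓡 m) M) (hL : L.HasCharRank k)
    (Pi : PoissonStructure (𝓡 (m + k)) P) (i : M → P) (hi : IsCoisotropicEmbedding L Pi i)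
    (V : L.Splitting) (x : M) :
    ∃ Φ : PartialDiffeomorph (𝓡 (m + k)) ((𝓡 m).prod 𝓘(ℝ, Fin k → ℝ)) P (L.CharDualSpace hL) ∞,
      i x ∈ Φ.source ∧ IsPoissonDiffeoToCanonical hL Pi V Φ ∧
      Φ (i x) = ⟨x, 0⟩ ∧ ∀ u ∈ Φ.source, u ∈ Set.range i ↔ (Φ u).2 = 0 := by
  obtain ⟨φ, χ, hφ, hχ, hx, hφχ, hrange⟩ :=
    hi.isSmoothEmbedding.exists_slice_chart (k := k) (by simp) x
  have hf : MDifferentiable (𝓡 m) (𝓡 (m + k)) i :=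
    hi.isSmoothEmbedding.contMDiff.mdifferentiable (by simp)
  have ha₀ : φ x ∈ φ.target := φ.map_source hx
  have hu₀ : (φ x, (0 : Fin k → ℝ)) ∈ χ.target := (hφχ x hx).2 ▸ χ.map_source (hφχ x hx).1
  obtain ⟨S, hS, hSe⟩ := Pi.exists_isPoissonNear hχ hu₀
  obtain ⟨hC, hI⟩ := hi.isCoisotropicNear hf hφ hχ hφχ hL ha₀ hSe
  obtain ⟨Θ, W, hWo, hxW, hWt, hWb, hΘs, hΘ⟩ := V.exists_coframe hL (charFrameAt L hL x) hφ ha₀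
    ((φ.left_inv hx).symm ▸ mem_base_charFrameAt L hL x)
  have hco : IsCoframe V hL φ x Θ W :=
    ⟨hWo, hWt, hWb, hΘs, fun a ha => (hΘ a ha).1, fun a ha => (hΘ a ha).2⟩
  obtain ⟨S', hS', hSe'⟩ := hco.exists_isPoissonNear hφ hxW
  obtain ⟨hC', hI'⟩ := hco.isCoisotropicNear hφ hxW hSe'
  -- Both bivectors induce on `c = 0` the Dirac structure `L` read in the same chart `φ` of `M`, so
  -- the comparison applies for any `V`.
  obtain ⟨G, hG0, hGfix, hGs, hGs', hG2, hGS⟩ := exists_poisson_diffeo hS hC hS' hC' (by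
    filter_upwards [hI, hI'] with a h1 h2 v ξ
    rw [h1, h2])
  -- `S` and `S'` are global maps that agree with the geometric structures only near the base point;
  -- `T` and `T'` are open sets where they do, and `G` is cut down accordingly.
  obtain ⟨T, hT, hTo, hT0⟩ := eventually_nhds_iff.mp hSe
  obtain ⟨T', hT', hTo', hT0'⟩ := eventually_nhds_iff.mp
    (hSe'.and (hco.eventually_prod_mem hxW))
  let G' := (G.restrOpen T hTo).trans (OpenPartialHomeomorph.ofSet T' hTo')
  have hG's : ∀ u, u ∈ G'.source → u ∈ G.source ∧ u ∈ T ∧ G u ∈ T' := fun u hu =>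
    ⟨hu.1.1, hu.1.2, hu.2⟩
  -- In this modified chart of `P` the Poisson structure has the expression `S'`, which is that of
  -- the canonical structure in the chart of `E*`. The required diffeomorphism identifies the two
  -- charts.
  have h₁ : IsSmoothChart (𝓡 (m + k)) (χ.trans G') := by
    refine hχ.trans (hGs.mono fun u hu => (hG's u hu).1) (hGs'.mono fun u hu => ?_)
    have h1 := G.map_source (hG's _ (G'.map_target hu)).1
    have h2 : G (G'.symm u) = u := G'.right_inv hu
    rwa [h2] at h1
  have h₂ := isSmoothChart_charDualChart L hL x hφ
  have hD : ∀ z ∈ (χ.trans G').target, z ∈ (charDualChart L hL φ x).target → ∀ v η,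
      Pi.sharpInChart (χ.trans G') z η = v ↔ (v, η) ∈ diracPullback
        (mfderiv 𝓘(ℝ, EuclideanSpace ℝ (Fin m) × (Fin k → ℝ)) ((𝓡 m).prod 𝓘(ℝ, Fin k → ℝ))
          (charDualChart L hL φ x).symm z)
        (V.canonicalDirac hL ((charDualChart L hL φ x).symm z)) := by
    intro z hz _ v η
    obtain ⟨u, hu, rfl⟩ : ∃ u ∈ (χ.trans G').source, (χ.trans G') u = z :=
      ⟨_, (χ.trans G').map_target hz, (χ.trans G').right_inv hz⟩
    have huχ : u ∈ χ.source := hu.1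
    obtain ⟨huG, huT, huT'⟩ := hG's (χ u) hu.2
    refine Iff.trans ?_ (hco.mem_diracPullback_canonicalDirac hφ (hT' _ huT').2 v η).symm
    rw [← (hT' _ huT').1]
    have hGd : MDifferentiableAt 𝓘(ℝ, EuclideanSpace ℝ (Fin m) × (Fin k → ℝ))
        𝓘(ℝ, EuclideanSpace ℝ (Fin m) × (Fin k → ℝ)) G (χ u) :=
      ((hGs.contDiffAt (G.open_source.mem_nhds huG)).differentiableAt
        (by simp)).mdifferentiableAt
    have h3 := mfderiv_comp u hGd ((hχ.contMDiffAt huχ).mdifferentiableAt (by simp))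
    rw [mfderiv_eq_fderiv] at h3
    have h4 : Pi.sharpInChart (χ.trans G') ((χ.trans G') u) η = S' (G (χ u)) η := by
      rw [← hGS _ huG, hT _ huT, PoissonStructure.sharpInChart_of_eq hu rfl,
        PoissonStructure.sharpInChart_of_eq huχ rfl]
      have h5 : mfderiv (𝓡 (m + k)) 𝓘(ℝ, EuclideanSpace ℝ (Fin m) × (Fin k → ℝ))
        (χ.trans G') u = _ := h3
      rw [h5]
      rfl
    rw [h4]
  refine ⟨h₁.partialDiffeomorph h₂, ?_, ⟨fun q hq w hw => h₁.eq_zero_of_mem h₂ hD hq w hw,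
    fun u hu => h₁.diracPullback_eq_graph h₂ hD hu⟩, ?_, fun u hu => ?_⟩
  · obtain ⟨h1, h2⟩ := hφχ x hx
    refine ⟨⟨h1, ?_⟩, ?_⟩
    · change χ (i x) ∈ G'.source
      rw [h2]
      exact ⟨⟨hG0, hT0⟩, (hGfix.symm ▸ hT0' : G (φ x, 0) ∈ T')⟩
    · change G (χ (i x)) ∈ (charDualChart L hL φ x).target
      rw [h2, hGfix]
      exact hco.mem_target hxW
  · change (charDualChart L hL φ x).symm (G (χ (i x))) = _
    rw [(hφχ x hx).2, hGfix]
    exact charDualChart_symm_zero L hL x hx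
  · have hu2 : G (χ u) ∈ (charDualChart L hL φ x).target := hu.2
    refine (hrange u hu.1.1).trans ((hG2 _ (hG's _ hu.1.2).1).trans ?_)
    exact (charDualChart_symm_snd_eq_zero_iff L hL x hu2).symm
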